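/- Let $\ell\neq p$ be primes, $\mathbf F$ a finite field of characteristic $\ell$ with ring of Witt vectors $W(\mathbf F)$, $K_v$ a non-archimedean local field of characteristic $p$, $G_v$ its absolute Galois group, $I_v\subset G_v$ the inertia subgroup, and $\bar\rho_v\colon G_v\to \mathrm{GL}_n(\mathbf F)$ a continuous representation. Let $\mathrm{ad}^0(\bar\rho)$ be the space of traceless $n\times n$ matrices over $\mathbf F$ with $G_v$ acting by conjugation through $\bar\rho_v$, let $H^i$ denote continuous cohomology, $h^0(G_v,M)=\dim_{\mathbf F}H^0(G_v,M)$, and $H^1_{\mathrm{unr}}(G_v,M)$ the image of the inflation map $H^1(G_v/I_v,M^{I_v})\to H^1(G_v,M)$. Let $\eta_v\colon G_v\to W(\mathbf F)^*$ be the Teichmüller lift of $\det\bar\rho_v$, and $\mathcal A$ the category of complete noetherian local $W(\mathbf F)$-algebras $(R,\mathfrak m_R)$ with residue field $\mathbf F$. A lift of $\bar\rho_v$ to $R\in\mathcal A$ means a continuous homomorphism $\rho\colon G_v\to\mathrm{GL}_n(R)$ with $\rho \bmod \mathfrak m_R=\bar\rho_v$ and $\det\rho=\eta_v$. Suppose that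 $\bar\rho_v(I_v)$ has order prime to $\ell$. For $R\in\mathcal A$ let $\mathcal C_v(R)$ be the set of lifts $\rho$ of $\bar\rho_v$ to $R$ for which reduction modulo $\mathfrak m_R$ maps $\rho(I_v)$ isomorphically onto $\bar\rho_v(I_v)$. Let $L_v\subset H^1(G_v,\mathrm{ad}^0(\bar\rho))$ be the set of classes of those cocycles $c$ with values in $\mathrm{ad}^0(\bar\rho)$ for which $\rho=(1+\varepsilon c)\bar\rho_v$ lies in $\mathcal C_v(\mathbf F[\varepsilon]/(\varepsilon^2))$. Then: (1) $L_v$ is a subspace, and the pair $(\mathcal C_v,L_v)$ has the following properties. P1: $\bar\rho_v\in\mathcal C_v(\mathbf F)$. P2: $\mathcal C_v(R)$ is stable under conjugation by $1+M_n(\mathfrak m_R)$. P3: If $f\colon R\to S$ is a morphism in $\mathcal A$ and $\rho\in\mathcal C_v(R)$, then $f\circ\rho\in\mathcal C_v(S)$. P4: If $\rho_i\in\mathcal C_v(R_i)$ and $I_i\subsetneq R_i$ is an ideal ($i=1,2$), and $\varphi\colon R_1/I_1\cong R_2/I_2$ is an isomorphism of $W(\mathbf F)$-algebras carrying $\rho_1\bmod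 I_1$ to $\rho_2\bmod I_2$, then the ring $R_3$ of pairs in $R_1\times R_2$ with the same image in $R_1/I_1\cong R_2/I_2$ is in $\mathcal A$ and $(\rho_1,\rho_2)\in\mathcal C_v(R_3)$. P5: If $\rho$ is a lift to $R$, $(J_k)$ is a decreasing sequence of proper ideals of $R$ with $\bigcap_k J_k=0$ (for example $J_k=\mathfrak m_R^{k}$, $k\ge1$), and $\rho\bmod J_k\in\mathcal C_v(R/J_k)$ for all $k$, then $\rho\in\mathcal C_v(R)$. P6: If $J\subsetneq R$ is an ideal with $\mathfrak m_RJ=0$, then $\mathcal C_v(R)\to\mathcal C_v(R/J)$ is surjective. P7: If $J\subset R$ is an ideal with $\mathfrak m_RJ=0$, $\rho_1\in\mathcal C_v(R)$, and $\rho_2$ is a lift to $R$ with $\rho_1\equiv\rho_2\bmod J$, then $\rho_2\in\mathcal C_v(R)$ if and only if the class $[\rho_2-\rho_1]\in H^1(G_v,\mathrm{ad}^0(\bar\rho))\otimes_{\mathbf F}J$ of the cocycle $g\mapsto\rho_2(g)\rho_1(g)^{-1}-1$ lies in $L_v\otimes_{\mathbf F}J$. (2) $L_v=H^1_{\mathrm{unr}}(G_v,\mathrm{ad}^0(\bar\rho))$,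 and this space is finite-dimensional with $\dim_{\mathbf F}L_v=h^0(G_v,\mathrm{ad}^0(\bar\rho))$. (3) For every $R\in\mathcal A$ and $\rho\in\mathcal C_v(R)$, the modules $(R^n)^{\rho(G_v^x)}$, $x>-1$, are free over $R$, where $G_v^x$ are the ramification groups of $G_v$ in the upper numbering (so $G_v^x=I_v$ for $-1<x\le0$), and the conductor $\int_{-1}^{\infty}\bigl(n-\mathrm{rank}_R (R^n)^{\rho(G_v^x)}\bigr)\,dx$ of $\rho$ equals the conductor $\int_{-1}^{\infty}\bigl(n-\dim_{\mathbf F} (\mathbf F^n)^{\bar\rho_v(G_v^x)}\bigr)\,dx$ of $\bar\rho_v$. -/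

import Mathlib

open scoped Matrix ENNReal

universe u v w

noncomputable section

namespace LocalDef

/-! ### Continuous `H⁰`, `H¹` and unramified classes -/

section Cohomology

variable {F : Type u} [Field F] {G : Type v} [Group G] [TopologicalSpace G]
  {M : Type w} [AddCommGroup M] [Module F M]

/-- Continuous 1-cocycles of `G` with values in the discrete module `M`. -/
def Z1 (r : Representation F G M) : Submodule F (G → M) where
  carrier := {c | IsLocallyConstant c ∧ ∀ g h, c (g * h) = c g + r g (c h)}
  add_mem' := by
    rintro a b ⟨ha, ha'⟩ ⟨hb, hb'⟩
    refine ⟨ha.add hb, fun g h => ?_⟩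
    simp only [Pi.add_apply, ha', hb', map_add]
    abel
  zero_mem' := ⟨IsLocallyConstant.const 0, fun g h => by simp⟩
  smul_mem' := by
    rintro a c ⟨hc, hc'⟩
    refine ⟨hc.comp (fun m => a • m), fun g h => ?_⟩
    simp [hc', smul_add]

/-- 1-coboundaries `g ↦ g m - m`. -/
def B1 (r : Representation F G M) : Submodule F (G → M) :=
  LinearMap.range (LinearMap.pi (fun g => r g - LinearMap.id) : M →ₗ[F] (G → M))

/-- Continuous first cohomology `H¹(G, M)`, as 1-cocycles modulo 1-coboundaries. -/
abbrev H1 (r : Representation F G M) : Type _ := Z1 r ⧸ (B1 r).submoduleOf (Z1 r)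

/-- The class of a cocycle. -/
def H1.mk (r : Representation F G M) : Z1 r →ₗ[F] H1 r := ((B1 r).submoduleOf (Z1 r)).mkQ

/-- Pull back of functions `G ⧸ I → M^I` to functions `G → M`. -/
def inflate (r : Representation F G M) (I : Subgroup G) :
    (G ⧸ I → Representation.invariants (r.comp I.subtype)) →ₗ[F] (G → M) where
  toFun c g := (c (QuotientGroup.mk g) : M)
  map_add' _ _ := rfl
  map_smul' _ _ := rfl

/-- `H¹_unr(G, M)`: the image of the inflation map `H¹(G ⧸ I, M^I) → H¹(G, M)`. -/
def H1unr (r : Representation F G M) (I : Subgroup G) [I.Normal] : Submodule F (H1 r) :=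
  (((Z1 (r.quotientToInvariants I)).map (inflate r I)).submoduleOf (Z1 r)).map (H1.mk r)

end Cohomology

/-! ### The adjoint representation -/

section Adjoint

variable {F : Type u} [Field F] {G : Type v} [Group G] {n : ℕ}

/-- Traceless `n × n` matrices. -/
abbrev Traceless (n : ℕ) (F : Type u) [Field F] : Submodule F (Matrix (Fin n) (Fin n) F) :=
  LinearMap.ker (Matrix.traceLinearMap (Fin n) F F)

/-- `ad⁰`: conjugation on traceless matrices through `ρbar`. -/
def ad0 (ρbar : G →* GL (Fin n) F) : Representation F G (Traceless n F) where
  toFun g :=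
    { toFun := fun A => ⟨(ρbar g).1 * A.1 * ((ρbar g)⁻¹).1, by
        have hA := A.2
        rw [LinearMap.mem_ker, Matrix.traceLinearMap_apply] at hA ⊢
        rw [Matrix.trace_mul_comm, ← mul_assoc, ← Units.val_mul, inv_mul_cancel, Units.val_one, one_mul, hA]⟩
      map_add' := fun A B => by ext1; simp [mul_add, add_mul]
      map_smul' := fun a A => by ext1; simp }
  map_one' := by ext1 A; ext1; simp
  map_mul' g h := by ext1 A; ext1; simp [mul_assoc]

end Adjoint

/-! ### The category of coefficient rings -/

/-- A complete noetherian local `W(F)`-algebra with residue field `F`: a complete noetherian local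
ring with a structure map from `W(F)` and a reduction map to `F` (necessarily surjective, hence with
kernel the maximal ideal) which is compatible with the canonical map `W(F) → F`. -/
structure CNL (ℓ : ℕ) [Fact ℓ.Prime] (F : Type u) [Field F] where
  carrier : Type u
  [commRing : CommRing carrier]
  [isLocalRing : IsLocalRing carrier]
  [isNoetherianRing : IsNoetherianRing carrier]
  [isAdicComplete : IsAdicComplete (IsLocalRing.maximalIdeal carrier) carrier]
  str : WittVector ℓ F →+* carrier
  residue : carrier →+* F
  residue_comp_str : residue.comp str = WittVector.constantCoeff

namespace CNL

variable {ℓ : ℕ} [Fact ℓ.Prime] {F : Type u} [Field F]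

instance : CoeSort (CNL ℓ F) (Type u) := ⟨carrier⟩
instance (R : CNL ℓ F) : CommRing R := R.commRing
instance (R : CNL ℓ F) : IsLocalRing R := R.isLocalRing
instance (R : CNL ℓ F) : IsNoetherianRing R := R.isNoetherianRing
instance (R : CNL ℓ F) : IsAdicComplete (IsLocalRing.maximalIdeal R) R := R.isAdicComplete

/-- The maximal ideal. -/
abbrev m (R : CNL ℓ F) : Ideal R := IsLocalRing.maximalIdeal R

/-- Morphisms: ring homomorphisms compatible with the structure maps from `W(F)` and inducing the
identity on the residue field `F` (in particular local). -/
structure Hom (R S : CNL ℓ F) where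
  toRingHom : R →+* S
  comp_str : toRingHom.comp R.str = S.str
  residue_comp : S.residue.comp toRingHom = R.residue

/-- The Teichmüller lift `F → W(F) → R`. -/
def teich (R : CNL ℓ F) (a : F) : R := R.str (WittVector.teichmuller ℓ a)

variable (ℓ F) in
/-- The residue field `F` itself. -/
abbrev field : CNL ℓ F where
  carrier := F
  isAdicComplete := by
    rw [IsLocalRing.maximalIdeal_eq_bot]
    infer_instance
  str := WittVector.constantCoeff
  residue := RingHom.id F
  residue_comp_str := RingHom.id_comp _

theorem dualNumber_isAdicComplete :
    IsAdicComplete (IsLocalRing.maximalIdeal (DualNumber F)) (DualNumber F) := by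
  have h2 : (IsLocalRing.maximalIdeal (DualNumber F)) ^ 2 = ⊥ := by
    rw [DualNumber.maximalIdeal_eq_span_singleton_eps, Ideal.span_singleton_pow, pow_two,
      DualNumber.eps_mul_eps]
    simp
  have key : ∀ k, 2 ≤ k → (IsLocalRing.maximalIdeal (DualNumber F)) ^ k = ⊥ := fun k hk =>
    le_bot_iff.1 (h2 ▸ Ideal.pow_le_pow_right hk)
  refine { haus' := fun x hx => ?_, prec' := fun f hf => ⟨f 2, fun k => ?_⟩ }
  · have := hx 2
    rw [h2] at this
    simpa [SModEq.bot] using this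
  · rcases le_total k 2 with hk | hk
    · exact hf hk
    · have := hf hk
      rw [h2, Submodule.bot_smul, SModEq.bot] at this
      exact this ▸ SModEq.refl _

variable (ℓ F) in
/-- The dual numbers `F[ε]`. -/
abbrev dual : CNL ℓ F where
  carrier := DualNumber F
  isAdicComplete := dualNumber_isAdicComplete
  str := (TrivSqZeroExt.inlHom F F).comp WittVector.constantCoeff
  residue := (TrivSqZeroExt.fstHom F F F).toRingHom
  residue_comp_str := by ext x; rfl

variable (ℓ F) in
/-- The inclusion `F → F[ε]`. -/
def dualInl : F →+* dual ℓ F := TrivSqZeroExt.inlHom F F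

variable (ℓ F) in
/-- The element `ε` of `F[ε]`. -/
def dualEps : dual ℓ F := (DualNumber.eps : DualNumber F)

end CNL

/-! ### Lifts, and the axioms for a local deformation problem -/

section Lifts

variable {ℓ : ℕ} [Fact ℓ.Prime] {F : Type u} [Field F]
  {G : Type v} [Group G] [TopologicalSpace G] {n : ℕ}

/-- Base change of a representation along a ring homomorphism. -/
def push {R S : Type*} [CommRing R] [CommRing S] (f : R →+* S) (ρ : G →* GL (Fin n) R) :
    G →* GL (Fin n) S :=
  (Matrix.GeneralLinearGroup.map f).comp ρ

/-- Continuity of `ρ : G → GL_n(R)` for the `m_R`-adic topology: for every `k` the kernel of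
`ρ mod m_R ^ k` is open. -/
def IsContinuousRep {R : CNL ℓ F} (ρ : G →* GL (Fin n) R) : Prop :=
  ∀ k : ℕ, IsOpen {g : G | ∀ i j, (ρ g).1 i j - (1 : Matrix (Fin n) (Fin n) R) i j ∈ R.m ^ k}

/-- Lifts of `ρbar` to `R` whose determinant is the Teichmüller lift of `det ρbar`. -/
structure IsLift (ρbar : G →* GL (Fin n) F) {R : CNL ℓ F} (ρ : G →* GL (Fin n) R) : Prop where
  continuous : IsContinuousRep ρ
  reduction : push R.residue ρ = ρbar
  det_eq : ∀ g, (ρ g).1.det = R.teich (ρbar g).1.det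

variable (ℓ F G n) in
/-- A collection of representations of `G` over the various coefficient rings. -/
abbrev Collection : Type _ := ∀ R : CNL ℓ F, Set (G →* GL (Fin n) R)

/-- For lifts `ρ₁ ≡ ρ₂ mod J` of the same determinant, with `m_R J = 0`, the function
`g ↦ ρ₂(g) ρ₁(g)⁻¹ - 1` is a 1-cocycle with values in the traceless matrices over the `F`-vector
space `J`; its class `[ρ₂ - ρ₁]` lies in `H¹(G, ad⁰ ⊗ J) = H¹(G, ad⁰) ⊗ J`. This predicate says
that the class lies in `L ⊗ J`: up to the coboundary of a traceless matrix `B` over `J`, the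
cocycle is a finite sum of terms `x ⊗ c` with `x ∈ J` and `c` a cocycle with class in `L`. (The
matrix `x • (c g).map R.teich` is `x ⊗ c g`; it is independent of the lift from `F` to `R`, as `J`
is killed by `m_R`.) -/
def DiffClassMem (ρbar : G →* GL (Fin n) F) (L : Submodule F (H1 (ad0 ρbar)))
    {R : CNL ℓ F} (J : Ideal R) (ρ₁ ρ₂ : G →* GL (Fin n) R) : Prop :=
  ∃ (k : ℕ) (x : Fin k → R) (c : Fin k → Z1 (ad0 ρbar)) (B : Matrix (Fin n) (Fin n) R),
    (∀ a, x a ∈ J) ∧ (∀ a, H1.mk (ad0 ρbar) (c a) ∈ L) ∧ (∀ i j, B i j ∈ J) ∧ B.trace = 0 ∧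
    ∀ g, (ρ₂ g).1 * ((ρ₁ g)⁻¹).1 - 1 =
      (∑ a, x a • ((c a).1 g).1.map R.teich) +
        ((ρ₁ g).1 * B * ((ρ₁ g)⁻¹).1 - B)

/-- The conditions P1–P7 for a pair `(C, L)`. Quotients `R ⧸ J` by proper ideals are written as
surjective morphisms out of `R` with kernel `J`. -/
structure Admissible (ρbar : G →* GL (Fin n) F) (C : Collection ℓ F G n)
    (L : Submodule F (H1 (ad0 ρbar))) : Prop where
  /-- `C` consists of lifts of `ρbar` with the prescribed determinant. -/
  isLift : ∀ (R : CNL ℓ F) (ρ : G →* GL (Fin n) R), ρ ∈ C R → IsLift ρbar ρ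
  /-- `ρbar` itself belongs to `C`. -/
  P1 : ρbar ∈ C (CNL.field ℓ F)
  /-- Stability under conjugation by `1 + M_n(m_R)`. -/
  P2 : ∀ (R : CNL ℓ F) (ρ : G →* GL (Fin n) R) (A : GL (Fin n) R), ρ ∈ C R →
    (∀ i j, A.1 i j - (1 : Matrix (Fin n) (Fin n) R) i j ∈ R.m) →
    (MulAut.conj A).toMonoidHom.comp ρ ∈ C R
  /-- Functoriality. -/
  P3 : ∀ (R S : CNL ℓ F) (f : R.Hom S) (ρ : G →* GL (Fin n) R), ρ ∈ C R →
    push f.toRingHom ρ ∈ C S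
  /-- Gluing: given `φ : R₁ ⧸ I₁ ≅ R₂ ⧸ I₂` matching `ρ₁ mod I₁` with `ρ₂ mod I₂`, the ring `R₃` of
  pairs in `R₁ × R₂` with the same image is a coefficient ring, and `(ρ₁, ρ₂)` belongs to
  `C R₃`. -/
  P4 : ∀ (R₁ R₂ : CNL ℓ F) (I₁ : Ideal R₁) (I₂ : Ideal R₂) (φ : R₁ ⧸ I₁ ≃+* R₂ ⧸ I₂)
    (ρ₁ : G →* GL (Fin n) R₁) (ρ₂ : G →* GL (Fin n) R₂),
    I₁ ≠ ⊤ → I₂ ≠ ⊤ →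
    (∀ w, φ (Ideal.Quotient.mk I₁ (R₁.str w)) = Ideal.Quotient.mk I₂ (R₂.str w)) →
    ρ₁ ∈ C R₁ → ρ₂ ∈ C R₂ →
    push (φ.toRingHom.comp (Ideal.Quotient.mk I₁)) ρ₁ = push (Ideal.Quotient.mk I₂) ρ₂ →
    ∃ (R₃ : CNL ℓ F) (p₁ : R₃.Hom R₁) (p₂ : R₃.Hom R₂),
      Function.Injective (fun c => (p₁.toRingHom c, p₂.toRingHom c)) ∧
      Set.range (fun c => (p₁.toRingHom c, p₂.toRingHom c)) =
        {ab | φ (Ideal.Quotient.mk I₁ ab.1) = Ideal.Quotient.mk I₂ ab.2} ∧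
      ∃ ρ₃ ∈ C R₃, push p₁.toRingHom ρ₃ = ρ₁ ∧ push p₂.toRingHom ρ₃ = ρ₂
  /-- Completeness: a lift to `R` belongs to `C` if its reductions modulo a decreasing sequence of
  ideals with zero intersection do (for instance modulo the powers of `m_R`). -/
  P5 : ∀ (R : CNL ℓ F) (ρ : G →* GL (Fin n) R) (Q : ℕ → CNL ℓ F) (q : ∀ k, R.Hom (Q k)),
    IsLift ρbar ρ → (∀ k, Function.Surjective (q k).toRingHom) →
    Antitone (fun k => RingHom.ker (q k).toRingHom) → ⨅ k, RingHom.ker (q k).toRingHom = ⊥ →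
    (∀ k, push (q k).toRingHom ρ ∈ C (Q k)) → ρ ∈ C R
  /-- Smoothness: members of `C (R ⧸ J)` lift to members of `C R` whenever `m_R J = 0`. -/
  P6 : ∀ (R Q : CNL ℓ F) (q : R.Hom Q) (ρ : G →* GL (Fin n) Q),
    Function.Surjective q.toRingHom → R.m * RingHom.ker q.toRingHom = ⊥ → ρ ∈ C Q →
    ∃ ρ' ∈ C R, push q.toRingHom ρ' = ρ
  /-- Tangent condition: if `m_R J = 0`, `ρ₁ ∈ C R` and `ρ₂` is a lift with `ρ₁ ≡ ρ₂ mod J`, then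
  `ρ₂ ∈ C R` if and only if `[ρ₂ - ρ₁] ∈ L ⊗ J`. -/
  P7 : ∀ (R : CNL ℓ F) (J : Ideal R) (ρ₁ ρ₂ : G →* GL (Fin n) R), R.m * J = ⊥ →
    ρ₁ ∈ C R → IsLift ρbar ρ₂ →
    push (Ideal.Quotient.mk J) ρ₁ = push (Ideal.Quotient.mk J) ρ₂ →
    (ρ₂ ∈ C R ↔ DiffClassMem ρbar L J ρ₁ ρ₂)

/-- The classes in `H¹(G, ad⁰)` of the cocycles `g ↦ (ρ(g) ρ₀(g)⁻¹ - 1) / ε`, where `ρ` runs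
through `C(F[ε])` and `ρ₀` is the trivial lift of `ρbar`. -/
def tangentClasses (ρbar : G →* GL (Fin n) F) (C : Collection ℓ F G n) : Set (H1 (ad0 ρbar)) :=
  {x | ∃ ρ ∈ C (CNL.dual ℓ F), ∃ c : Z1 (ad0 ρbar), H1.mk (ad0 ρbar) c = x ∧
    ∀ g, (ρ g).1 * ((push (CNL.dualInl ℓ F) ρbar g)⁻¹).1 - 1 =
      CNL.dualEps ℓ F • (c.1 g).1.map (CNL.dualInl ℓ F)}

/-- The subspace of `H¹(G, ad⁰)` spanned by the tangent classes of `C`. -/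
def tangentSpace (ρbar : G →* GL (Fin n) F) (C : Collection ℓ F G n) :
    Submodule F (H1 (ad0 ρbar)) :=
  Submodule.span F (tangentClasses ρbar C)

variable (ℓ) in
/-- The lifts `ρ` of `ρbar` with Teichmüller determinant such that reduction modulo `m_R` is an
isomorphism from `ρ(I)` onto `ρbar(I)`. -/
def minimalLifts (ρbar : G →* GL (Fin n) F) (I : Subgroup G) : Collection ℓ F G n := fun R =>
  {ρ | IsLift ρbar ρ ∧
    Set.BijOn (Matrix.GeneralLinearGroup.map R.residue) (I.map ρ : Set (GL (Fin n) R))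
      (I.map ρbar : Set (GL (Fin n) F))}

end Lifts

/-! ### Ramification groups and conductors -/

section Ramification

variable (K : Type v) [Field K] [ValuativeRel K]

/-- The ring of integers of `K`. -/
abbrev intRing : Subring K := (ValuativeRel.valuation K).integer

variable (L : Type w) [Field L] [Algebra K L]

/-- The integral closure of the ring of integers of `K` in `L`. -/
abbrev intClosure : Subalgebra (intRing K) L := integralClosure (intRing K) L

/-- The Jacobson radical of the integral closure. When `K` is a local field and `L` is algebraic
over `K`, the integral closure is a local ring and this is its maximal ideal. -/
abbrev radIdeal : Ideal (intClosure K L) := Ideal.jacobson ⊥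

variable {K L} in
/-- The action of `σ` on the integral closure. -/
def galInt (σ : L ≃ₐ[K] L) : intClosure K L ≃ₐ[intRing K] intClosure K L :=
  (σ.restrictScalars (intRing K)).mapIntegralClosure

variable {K L} in
theorem galInt_mul (σ τ : L ≃ₐ[K] L) (x : intClosure K L) :
    galInt (σ * τ) x = galInt σ (galInt τ x) := rfl

variable {K L} in
theorem galInt_one (x : intClosure K L) : galInt (1 : L ≃ₐ[K] L) x = x := rfl

variable {K L} in
theorem galInt_mem (σ : L ≃ₐ[K] L) (i : ℕ) (x : intClosure K L) (hx : x ∈ radIdeal K L ^ i) :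
    galInt σ x ∈ radIdeal K L ^ i := by
  have h : (radIdeal K L).map (galInt σ : intClosure K L →+* intClosure K L) ≤ radIdeal K L := by
    have := Ideal.map_jacobson_of_bijective
      (f := (galInt σ : intClosure K L →+* intClosure K L)) (I := ⊥) (galInt σ).bijective
    rw [radIdeal, this, Ideal.map_bot]
  have h2 := Ideal.mem_map_of_mem (galInt σ : intClosure K L →+* intClosure K L) hx
  rw [Ideal.map_pow] at h2
  exact Ideal.pow_right_mono h i h2

/-- The ramification group `{σ | σ x ≡ x mod 𝔪^i for all integral x}`; it is `G_{i-1}` in the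
lower numbering. -/
def ramGroup (i : ℕ) : Subgroup (L ≃ₐ[K] L) where
  carrier := {σ | ∀ x : intClosure K L, galInt σ x - x ∈ radIdeal K L ^ i}
  one_mem' x := by simp [galInt_one]
  mul_mem' {σ τ} hσ hτ x := by
    rw [galInt_mul]
    simpa using add_mem (hσ (galInt τ x)) (hτ x)
  inv_mem' {σ} hσ x := by
    have h := hσ (galInt σ⁻¹ x)
    rw [← galInt_mul, mul_inv_cancel, galInt_one] at h
    simpa using neg_mem h

instance ramGroup_normal (i : ℕ) : (ramGroup K L i).Normal where
  conj_mem σ hσ τ x := by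
    have h := galInt_mem τ i _ (hσ (galInt τ⁻¹ x))
    rw [map_sub, ← galInt_mul, ← galInt_mul, ← galInt_mul, mul_inv_cancel, galInt_one] at h
    exact h

/-- The lower numbering ramification group `G_t` for a real number `t ≥ -1`. -/
def lowerRam (t : ℝ) : Subgroup (L ≃ₐ[K] L) := ramGroup K L (⌈t⌉ + 1).toNat

/-- The Herbrand function `φ(t) = ∫₀ᵗ ds / (G₀ : G_s)` of a finite Galois extension `L / K`. -/
def herbrand (t : ℝ) : ℝ :=
  ∫ s in (0 : ℝ)..t, (Nat.card (lowerRam K L s) : ℝ) / (Nat.card (lowerRam K L 0) : ℝ)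

/-- The upper numbering ramification group of a finite Galois extension: `G^{φ(t)} = G_t`. -/
def upperRamFinite (x : ℝ) : Set (L ≃ₐ[K] L) :=
  {σ | ∃ t : ℝ, -1 ≤ t ∧ herbrand K L t = x ∧ σ ∈ lowerRam K L t}

/-- The absolute Galois group. -/
abbrev AbsGal : Type v := SeparableClosure K ≃ₐ[K] SeparableClosure K

/-- The inertia subgroup of the absolute Galois group. -/
abbrev inertia : Subgroup (AbsGal K) := ramGroup K (SeparableClosure K) 1

/-- The upper numbering ramification group `G_K^x` of the absolute Galois group: the elements whose
restriction to every finite Galois extension `E / K` lies in `Gal(E/K)^x`. -/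
def upperRam (x : ℝ) : Set (AbsGal K) :=
  {σ | ∀ (E : IntermediateField K (SeparableClosure K)) [FiniteDimensional K E] [Normal K E],
    AlgEquiv.restrictNormalHom E σ ∈ upperRamFinite K E x}

variable {K} {R : Type u} [CommRing R] {n : ℕ}

/-- The submodule of `R^n` of vectors fixed by all `ρ(σ)`, `σ ∈ H`. -/
def fixedVectors (ρ : AbsGal K →* GL (Fin n) R) (H : Set (AbsGal K)) :
    Submodule R (Fin n → R) where
  carrier := {a | ∀ σ ∈ H, (ρ σ).1 *ᵥ a = a}
  add_mem' ha hb σ hσ := by rw [Matrix.mulVec_add, ha σ hσ, hb σ hσ]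
  zero_mem' σ _ := Matrix.mulVec_zero _
  smul_mem' r a ha σ hσ := by rw [Matrix.mulVec_smul, ha σ hσ]

/-- The (Artin) conductor exponent `∫_{-1}^∞ (n - rank (R^n)^{G_K^x}) dx`; since `G_K^x` is the
inertia group for `-1 < x ≤ 0`, this is `n - rank (R^n)^I` plus the Swan conductor. -/
def conductor (ρ : AbsGal K →* GL (Fin n) R) : ℝ≥0∞ :=
  ∫⁻ x in Set.Ioi (-1 : ℝ), ((n - Module.finrank R (fixedVectors ρ (upperRam K x)) : ℕ) : ℝ≥0∞)

end Ramification

end LocalDef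

end

noncomputable section

namespace LocalDef

/-! ### Coefficient rings -/

namespace CNL

variable {ℓ : ℕ} [Fact ℓ.Prime] {F : Type u} [Field F]

/-! Write `N = I ∩ ker ρbar`, where `I` is inertia. For a lift `ρ`, the map `ρ(I) → ρbar(I)` is
always onto, so the minimality condition says exactly that `ρ` is trivial on `N`
(`mem_minimalLifts_iff`). This condition can be checked entry by entry, and P1, P2, P3 and P5 follow
at once. P4 reduces to showing that a fibre product of coefficient rings is again noetherian and
complete, and that its topology is the one seen in the two components. This rests on Artin–Rees
(`exists_mem_pow_of_jointly_injective`, `exists_fibre_cnl`).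

Tangent classes are the classes of cocycles vanishing on `N`. Since `N` acts trivially on `ad0`,
coboundaries vanish there too, so vanishing on `N` depends only on the class. Expanding `ρ₂ ρ₁⁻¹ -
1` in a basis of `J` then gives P7. Since `I / N ≅ ρbar(I)` has order prime to `ℓ`, averaging makes
such a cocycle a coboundary on `I`. Subtracting that coboundary gives a cocycle vanishing on `I`, so
`L` is the unramified subspace (`map_mk_Z1van_eq`, `H1unr_eq`).

The remaining arithmetic input is that `G / I` is free procyclic on a Frobenius `φ`
(`exists_isFreeGenerator_inertia`). In characteristic `p` the solutions of `a ^ p ^ m = a` represent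
the residue classes, so inertia is the stabilizer of all these constants (`mem_ramGroup_one_iff`),
and the quotient acts on them through powers of Frobenius. Evaluation at `φ` then identifies
cocycles vanishing on `I` with `M^I`, and coboundaries with `(φ - 1) M^I`. Rank–nullity gives `dim L
= h⁰`.

For P6, Schur–Zassenhaus lifts `ρ|I` without enlarging its image. A lift of `ρ(φ)` is corrected by
an averaged intertwiner so that it acts on the lifted inertia as `φ` should. Free generation then
extends these data continuously to `G` (`exists_minimalLift_of_generator`).

For conductors, the groups `G^x` with `x > -1` lie in `I`, so they act through finite groups of
invertible order. Their fixed vectors are the range of an averaging idempotent, which is free over a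
local ring and keeps its rank under reduction (`free_fixedVectors`). -/

theorem residue_str (R : CNL ℓ F) (w : WittVector ℓ F) :
    R.residue (R.str w) = WittVector.constantCoeff w :=
  DFunLike.congr_fun R.residue_comp_str w

theorem residue_teich (R : CNL ℓ F) (a : F) : R.residue (R.teich a) = a := by
  rw [teich, residue_str]
  exact WittVector.teichmuller_coeff_zero ℓ a

theorem residue_surjective (R : CNL ℓ F) : Function.Surjective R.residue :=
  fun a => ⟨R.teich a, R.residue_teich a⟩

theorem mem_m_iff (R : CNL ℓ F) {x : R} : x ∈ R.m ↔ R.residue x = 0 := by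
  have h : RingHom.ker R.residue = R.m :=
    IsLocalRing.eq_maximalIdeal (RingHom.ker_isMaximal_of_surjective _ R.residue_surjective)
  rw [← h, RingHom.mem_ker]

theorem isUnit_iff (R : CNL ℓ F) {x : R} : IsUnit x ↔ R.residue x ≠ 0 := by
  rw [Ne, ← R.mem_m_iff, IsLocalRing.mem_maximalIdeal, mem_nonunits_iff, not_not]

theorem teich_zero (R : CNL ℓ F) : R.teich 0 = 0 := by simp [teich]

theorem teich_one (R : CNL ℓ F) : R.teich 1 = 1 := by simp [teich]

theorem teich_mul (R : CNL ℓ F) (a b : F) : R.teich (a * b) = R.teich a * R.teich b := by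
  simp [teich]

theorem Hom.map_teich {R S : CNL ℓ F} (f : R.Hom S) (a : F) :
    f.toRingHom (R.teich a) = S.teich a :=
  DFunLike.congr_fun f.comp_str _

theorem Hom.residue_apply {R S : CNL ℓ F} (f : R.Hom S) (x : R) :
    S.residue (f.toRingHom x) = R.residue x :=
  DFunLike.congr_fun f.residue_comp x

theorem Hom.map_m_le {R S : CNL ℓ F} (f : R.Hom S) : R.m.map f.toRingHom ≤ S.m := by
  rw [Ideal.map_le_iff_le_comap]
  intro x hx
  rw [Ideal.mem_comap, S.mem_m_iff, f.residue_apply]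
  exact R.mem_m_iff.1 hx

theorem Hom.map_mem_pow {R S : CNL ℓ F} (f : R.Hom S) {k : ℕ} {x : R} (hx : x ∈ R.m ^ k) :
    f.toRingHom x ∈ S.m ^ k := by
  have h := Ideal.mem_map_of_mem f.toRingHom hx
  rw [Ideal.map_pow] at h
  exact Ideal.pow_right_mono f.map_m_le k h

theorem Hom.m_map_eq {R S : CNL ℓ F} (f : R.Hom S) (hf : Function.Surjective f.toRingHom) :
    R.m.map f.toRingHom = S.m := by
  refine le_antisymm f.map_m_le fun y hy => ?_
  obtain ⟨x, rfl⟩ := hf y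
  refine Ideal.mem_map_of_mem _ ?_
  rwa [R.mem_m_iff, ← f.residue_apply, ← S.mem_m_iff]

theorem Hom.exists_mem_pow {R S : CNL ℓ F} (f : R.Hom S) (hf : Function.Surjective f.toRingHom)
    {k : ℕ} {y : S} (hy : y ∈ S.m ^ k) : ∃ x ∈ R.m ^ k, f.toRingHom x = y := by
  rw [← f.m_map_eq hf, ← Ideal.map_pow] at hy
  exact (Ideal.mem_map_iff_of_surjective _ hf).1 hy

theorem exists_str_sub_mem (R : CNL ℓ F) (x : R) : ∃ w, x - R.str w ∈ R.m :=
  ⟨WittVector.teichmuller ℓ (R.residue x), by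
    rw [R.mem_m_iff, map_sub, sub_eq_zero]; exact (R.residue_teich _).symm⟩

theorem le_m (R : CNL ℓ F) {J : Ideal R} (hJ : J ≠ ⊤) : J ≤ R.m :=
  IsLocalRing.le_maximalIdeal hJ

theorem mul_eq_zero_of_mem (R : CNL ℓ F) {J : Ideal R} (h : R.m * J = ⊥) {x y : R}
    (hx : x ∈ R.m) (hy : y ∈ J) : x * y = 0 :=
  (Submodule.mem_bot R).1 (h ▸ Ideal.mul_mem_mul hx hy)

/-- An ideal killed by the maximal ideal meets a power of the maximal ideal trivially. -/
theorem exists_pow_inf_eq_bot (R : CNL ℓ F) {J : Ideal R} (h : R.m * J = ⊥) :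
    ∃ k, 1 ≤ k ∧ R.m ^ k ⊓ J = ⊥ := by
  obtain ⟨k, hk⟩ := Ideal.exists_pow_inf_eq_pow_smul R.m (M := R) J
  refine ⟨k + 1, by omega, ?_⟩
  -- One step beyond the Artin–Rees bound a factor of the maximal ideal splits off, and that factor
  -- kills `J`.
  have := hk (k + 1) (by omega)
  simp only [smul_eq_mul, Ideal.mul_top, Nat.add_sub_cancel_left, pow_one] at this
  rw [this, eq_bot_iff, ← h]
  exact Ideal.mul_mono_right inf_le_right

theorem natCast_mem_m [CharP F ℓ] (R : CNL ℓ F) : (ℓ : R) ∈ R.m := by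
  rw [R.mem_m_iff, map_natCast, CharP.cast_eq_zero]

theorem isUnit_natCast [CharP F ℓ] (R : CNL ℓ F) {N : ℕ} (h : N.Coprime ℓ) :
    IsUnit (N : R) := by
  rw [R.isUnit_iff, map_natCast, Ne, CharP.cast_eq_zero_iff F ℓ]
  intro hd
  exact (Fact.out : ℓ.Prime).one_lt.ne' (h.symm.eq_one_of_dvd hd)

end CNL

/-! ### Congruence subgroups -/

section Congruence

variable {R : Type*} [CommRing R] {n : ℕ}

/-- The matrices congruent to `1` modulo an ideal. -/
def congSubgroup (n : ℕ) (I : Ideal R) : Subgroup (GL (Fin n) R) :=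
  (Matrix.GeneralLinearGroup.map (Ideal.Quotient.mk I)).ker

instance (I : Ideal R) : (congSubgroup n I).Normal := by
  unfold congSubgroup; infer_instance

theorem map_eq_map_iff {S : Type*} [CommRing S] (f : R →+* S) {A B : GL (Fin n) R} :
    Matrix.GeneralLinearGroup.map f A = Matrix.GeneralLinearGroup.map f B ↔
      ∀ i j, f (A.1 i j - B.1 i j) = 0 := by
  rw [Matrix.GeneralLinearGroup.ext_iff]
  simp [sub_eq_zero]

theorem map_mk_eq_iff {I : Ideal R} {A B : GL (Fin n) R} :
    Matrix.GeneralLinearGroup.map (Ideal.Quotient.mk I) A =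
      Matrix.GeneralLinearGroup.map (Ideal.Quotient.mk I) B ↔
      ∀ i j, A.1 i j - B.1 i j ∈ I := by
  rw [map_eq_map_iff]
  simp only [Ideal.Quotient.eq_zero_iff_mem]

theorem mem_congSubgroup {I : Ideal R} {A : GL (Fin n) R} :
    A ∈ congSubgroup n I ↔ ∀ i j, A.1 i j - (1 : Matrix (Fin n) (Fin n) R) i j ∈ I := by
  rw [congSubgroup, MonoidHom.mem_ker, ← map_one (Matrix.GeneralLinearGroup.map
    (Ideal.Quotient.mk I)), map_mk_eq_iff]
  rfl

theorem one_apply_map {S : Type*} [CommRing S] (f : R →+* S) (i j : Fin n) :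
    f ((1 : Matrix (Fin n) (Fin n) R) i j) = (1 : Matrix (Fin n) (Fin n) S) i j := by
  rw [Matrix.one_apply, Matrix.one_apply]
  split_ifs
  · exact map_one f
  · exact map_zero f

theorem map_mem_congSubgroup {S : Type*} [CommRing S] {f : R →+* S} {I : Ideal R} {K : Ideal S}
    (h : ∀ x ∈ I, f x ∈ K) {A : GL (Fin n) R} (hA : A ∈ congSubgroup n I) :
    Matrix.GeneralLinearGroup.map f A ∈ congSubgroup n K := by
  rw [mem_congSubgroup] at hA ⊢
  intro i j
  have := h _ (hA i j)
  rwa [map_sub, one_apply_map] at this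

theorem mul_inv_mem_congSubgroup {I : Ideal R} {A B : GL (Fin n) R} :
    A * B⁻¹ ∈ congSubgroup n I ↔ ∀ i j, A.1 i j - B.1 i j ∈ I := by
  rw [congSubgroup, MonoidHom.mem_ker, map_mul, map_inv, mul_inv_eq_one, map_mk_eq_iff]

theorem map_mul_apply_mem {I : Ideal R} {A B C : Matrix (Fin n) (Fin n) R}
    (hB : ∀ i j, B i j ∈ I) (i j : Fin n) : (A * B * C) i j ∈ I := by
  rw [Matrix.mul_apply]
  refine Ideal.sum_mem _ fun k _ => Ideal.mul_mem_right _ _ ?_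
  rw [Matrix.mul_apply]
  exact Ideal.sum_mem _ fun l _ => Ideal.mul_mem_left _ _ (hB l k)

/-- To first order the determinant is the trace. -/
theorem det_one_add_eq {I : Ideal R} (hI : ∀ x ∈ I, ∀ y ∈ I, x * y = 0)
    {M : Matrix (Fin n) (Fin n) R} (hM : ∀ i j, M i j ∈ I) : (1 + M).det = 1 + M.trace := by
  rw [Matrix.det_apply, Finset.sum_eq_single (1 : Equiv.Perm (Fin n))]
  · simp only [Equiv.Perm.sign_one, one_smul, Equiv.Perm.coe_one, id_eq, Matrix.add_apply,
      Matrix.one_apply_eq, Matrix.trace, Matrix.diag_apply]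
    have key : ∀ s : Finset (Fin n),
        ∏ i ∈ s, (1 + M i i) = 1 + ∑ i ∈ s, M i i := by
      intro s
      induction s using Finset.induction_on with
      | empty => simp
      | insert a s ha ih =>
        rw [Finset.prod_insert ha, Finset.sum_insert ha, ih]
        have := hI _ (hM a a) _ (Ideal.sum_mem I (t := s) fun i _ => hM i i)
        linear_combination this
    exact key _
  · intro σ _ hσ
    obtain ⟨i, hi⟩ : ∃ i, σ i ≠ i := by
      by_contra! h
      exact hσ (Equiv.ext h)
    have hne : ∀ i, σ i ≠ i → (1 + M) (σ i) i ∈ I := fun i hi => by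
      rw [Matrix.add_apply, Matrix.one_apply_ne hi, zero_add]
      exact hM _ _
    -- A permutation other than the identity moves both `i` and `σ i`, so its term contains two
    -- off-diagonal entries, whose product is zero.
    have hj : σ (σ i) ≠ σ i := fun h => hi (σ.injective h)
    rw [← Finset.mul_prod_erase _ _ (Finset.mem_univ i),
      ← Finset.mul_prod_erase _ _ (Finset.mem_erase.2 ⟨hi, Finset.mem_univ (σ i)⟩),
      ← mul_assoc, hI _ (hne i hi) _ (hne _ hj), zero_mul, smul_zero]
  · exact fun h => absurd (Finset.mem_univ _) h

end Congruence

/-! ### Lifts -/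

section Lifts

variable {ℓ : ℕ} [Fact ℓ.Prime] {F : Type u} [Field F]
  {G : Type v} [Group G] {n : ℕ}

theorem push_apply {R S : Type*} [CommRing R] [CommRing S] (f : R →+* S) (ρ : G →* GL (Fin n) R)
    (g : G) : push f ρ g = Matrix.GeneralLinearGroup.map f (ρ g) := rfl

theorem push_push {R S T : Type*} [CommRing R] [CommRing S] [CommRing T] (f : R →+* S)
    (h : S →+* T) (ρ : G →* GL (Fin n) R) : push h (push f ρ) = push (h.comp f) ρ := by
  ext g i j
  rfl

/-- Invertible matrices lift along local homomorphisms. -/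
theorem exists_gl_map_eq {R S : Type*} [CommRing R] [CommRing S] (f : R →+* S) [IsLocalHom f]
    (B : GL (Fin n) S) (A : Matrix (Fin n) (Fin n) R) (hA : ∀ i j, f (A i j) = B.1 i j) :
    ∃ A' : GL (Fin n) R, A'.1 = A ∧ Matrix.GeneralLinearGroup.map f A' = B := by
  have h : A.map f = B.1 := by ext i j; exact hA i j
  have hdet : IsUnit A.det := by
    refine isUnit_of_map_unit f _ ?_
    rw [RingHom.map_det, RingHom.mapMatrix_apply, h]
    exact (Matrix.isUnit_iff_isUnit_det _).1 B.isUnit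
  obtain ⟨A', rfl⟩ := (Matrix.isUnit_iff_isUnit_det _).2 hdet
  exact ⟨A', rfl, Units.ext h⟩

instance (R S : CNL ℓ F) (f : R.Hom S) : IsLocalHom f.toRingHom :=
  ⟨fun x hx => by rwa [R.isUnit_iff, ← f.residue_apply, ← S.isUnit_iff]⟩

variable [TopologicalSpace G]

theorem isContinuousRep_iff {R : CNL ℓ F} {ρ : G →* GL (Fin n) R} :
    IsContinuousRep ρ ↔
      ∀ k, IsOpen (((congSubgroup n (R.m ^ k)).comap ρ : Subgroup G) : Set G) := by
  refine forall_congr' fun k => ?_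
  have : {g : G | ∀ i j, (ρ g).1 i j - (1 : Matrix (Fin n) (Fin n) R) i j ∈ R.m ^ k} =
      (((congSubgroup n (R.m ^ k)).comap ρ : Subgroup G) : Set G) := by
    ext g
    exact mem_congSubgroup.symm
  rw [this]

theorem IsLift.residue_apply {ρbar : G →* GL (Fin n) F} {R : CNL ℓ F} {ρ : G →* GL (Fin n) R}
    (h : IsLift ρbar ρ) (g : G) : Matrix.GeneralLinearGroup.map R.residue (ρ g) = ρbar g :=
  DFunLike.congr_fun h.reduction g

/-- Surjectivity onto `ρbar(I)` is automatic for a lift, and injectivity of a homomorphism is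
triviality of its kernel. All later arguments use this vanishing form of the condition. -/
theorem mem_minimalLifts_iff {ρbar : G →* GL (Fin n) F} {I : Subgroup G} {R : CNL ℓ F}
    {ρ : G →* GL (Fin n) R} :
    ρ ∈ minimalLifts ℓ ρbar I R ↔ IsLift ρbar ρ ∧ ∀ g ∈ I, ρbar g = 1 → ρ g = 1 := by
  refine and_congr_right fun hρ => ⟨fun h g hg h1 => ?_, fun h => ⟨?_, ?_, ?_⟩⟩
  · exact h.injOn ⟨g, hg, rfl⟩ (one_mem (I.map ρ)) (by rw [hρ.residue_apply, h1, map_one])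
  · rintro _ ⟨g, hg, rfl⟩
    exact ⟨g, hg, (hρ.residue_apply g).symm⟩
  · rintro _ ⟨g, hg, rfl⟩ _ ⟨g', hg', rfl⟩ he
    rw [hρ.residue_apply, hρ.residue_apply] at he
    have := h (g * g'⁻¹) (mul_mem hg (inv_mem hg')) (by rw [map_mul, map_inv, he, mul_inv_cancel])
    rwa [map_mul, map_inv, mul_inv_eq_one] at this
  · rintro _ ⟨g, hg, rfl⟩
    exact ⟨ρ g, ⟨g, hg, rfl⟩, hρ.residue_apply g⟩

section Topological

variable [IsTopologicalGroup G]

theorem isLift_self {ρbar : G →* GL (Fin n) F} (hcont : IsOpen (ρbar.ker : Set G)) :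
    IsLift (R := CNL.field ℓ F) ρbar ρbar where
  continuous := isContinuousRep_iff.2 fun k => by
    refine Subgroup.isOpen_mono (H₁ := ρbar.ker) (fun g hg => ?_) hcont
    rw [Subgroup.mem_comap, MonoidHom.mem_ker.1 hg]
    exact one_mem _
  reduction := by ext g i j; rfl
  det_eq g := (CNL.residue_teich (CNL.field ℓ F) _).symm

theorem IsLift.conj {ρbar : G →* GL (Fin n) F} {R : CNL ℓ F} {ρ : G →* GL (Fin n) R}
    (h : IsLift ρbar ρ) {A : GL (Fin n) R} (hA : A ∈ congSubgroup n R.m) :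
    IsLift ρbar ((MulAut.conj A).toMonoidHom.comp ρ) where
  continuous := isContinuousRep_iff.2 fun k => by
    refine Subgroup.isOpen_mono (fun g hg => ?_) (isContinuousRep_iff.1 h.continuous k)
    exact (inferInstance : (congSubgroup n (R.m ^ k)).Normal).conj_mem _ hg A
  reduction := by
    have h1 : Matrix.GeneralLinearGroup.map R.residue A = 1 := by
      rw [← map_one (Matrix.GeneralLinearGroup.map R.residue), map_eq_map_iff]
      exact fun i j => R.mem_m_iff.1 (mem_congSubgroup.1 hA i j)
    refine MonoidHom.ext fun g => ?_
    change Matrix.GeneralLinearGroup.map R.residue (A * ρ g * A⁻¹) = _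
    rw [map_mul, map_mul, map_inv, h1, h.residue_apply]
    simp
  det_eq g := by
    rw [← h.det_eq]
    change (A.1 * (ρ g).1 * (A⁻¹).1).det = _
    rw [Matrix.det_mul_right_comm, ← Units.val_mul, mul_inv_cancel, Units.val_one, one_mul]

theorem IsLift.push {ρbar : G →* GL (Fin n) F} {R S : CNL ℓ F} {ρ : G →* GL (Fin n) R}
    (h : IsLift ρbar ρ) (f : R.Hom S) : IsLift ρbar (push f.toRingHom ρ) where
  continuous := isContinuousRep_iff.2 fun k => by
    refine Subgroup.isOpen_mono (fun g hg => ?_) (isContinuousRep_iff.1 h.continuous k)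
    exact map_mem_congSubgroup (fun x hx => f.map_mem_pow hx) hg
  reduction := by rw [push_push, f.residue_comp, h.reduction]
  det_eq g := by
    rw [← f.map_teich, ← h.det_eq, RingHom.map_det]
    rfl

end Topological

end Lifts

/-! ### Fibre products of coefficient rings -/

section FibreProduct

/-- Every scalar of `B` comes from `A`, so the `A`-submodules of `B` are its ideals. -/
theorem isNoetherian_of_surjective_algebraMap {A B : Type*} [CommRing A] [CommRing B] [Algebra A B]
    [IsNoetherianRing B] (h : Function.Surjective (algebraMap A B)) : IsNoetherian A B := by
  refine ⟨fun s => ?_⟩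
  let t : Ideal B :=
    { s.toAddSubmonoid with
      smul_mem' := fun b x hx => by
        obtain ⟨a, rfl⟩ := h b
        rw [smul_eq_mul, ← Algebra.smul_def]
        exact s.smul_mem a hx }
  have ht : t.restrictScalars A = s := rfl
  rw [← ht]
  exact Submodule.FG.restrictScalars_of_surjective (IsNoetherian.noetherian t) h

variable {A R₁ R₂ : Type*} [CommRing A] [CommRing R₁] [CommRing R₂]

/-- `A` embeds as an `A`-submodule of the noetherian module `R₁ × R₂`. -/
theorem isNoetherianRing_of_jointly_injective [IsNoetherianRing R₁] [IsNoetherianRing R₂]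
    {p₁ : A →+* R₁} {p₂ : A →+* R₂} (h₁ : Function.Surjective p₁) (h₂ : Function.Surjective p₂)
    (hinj : Function.Injective fun a => (p₁ a, p₂ a)) : IsNoetherianRing A := by
  let := p₁.toAlgebra
  let := p₂.toAlgebra
  have : IsNoetherian A R₁ := isNoetherian_of_surjective_algebraMap h₁
  have : IsNoetherian A R₂ := isNoetherian_of_surjective_algebraMap h₂
  exact isNoetherian_of_injective ((Algebra.linearMap A R₁).prod (Algebra.linearMap A R₂)) hinj

/-- The Artin–Rees lemma for a ring embedded in a product of two of its quotients. -/
theorem exists_mem_pow_of_jointly_injective [IsNoetherianRing A] (I : Ideal A)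
    {p₁ : A →+* R₁} {p₂ : A →+* R₂} (h₁ : Function.Surjective p₁) (h₂ : Function.Surjective p₂)
    (hinj : Function.Injective fun a => (p₁ a, p₂ a)) :
    ∃ c : ℕ, ∀ n, ∀ x : A, p₁ x ∈ I.map p₁ ^ (n + c) → p₂ x ∈ I.map p₂ ^ (n + c) → x ∈ I ^ n := by
  let := p₁.toAlgebra
  let := p₂.toAlgebra
  have : Module.Finite A R₁ := Module.Finite.of_surjective (Algebra.linearMap A R₁) h₁
  have : Module.Finite A R₂ := Module.Finite.of_surjective (Algebra.linearMap A R₂) h₂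
  let f : A →ₗ[A] R₁ × R₂ := (Algebra.linearMap A R₁).prod (Algebra.linearMap A R₂)
  obtain ⟨c, hc⟩ := Ideal.exists_pow_inf_eq_pow_smul I (LinearMap.range f)
  refine ⟨c, fun n x hx₁ hx₂ => ?_⟩
  rw [← Ideal.map_pow] at hx₁ hx₂
  obtain ⟨y₁, hy₁, e₁⟩ := (Ideal.mem_map_iff_of_surjective _ h₁).1 hx₁
  obtain ⟨y₂, hy₂, e₂⟩ := (Ideal.mem_map_iff_of_surjective _ h₂).1 hx₂
  have hfx : f x ∈ (I ^ (n + c) • ⊤ : Submodule A (R₁ × R₂)) ⊓ LinearMap.range f := by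
    refine ⟨?_, x, rfl⟩
    have : f x = y₁ • (1, 0) + y₂ • (0, 1) := by
      rw [Prod.smul_mk, Prod.smul_mk, smul_zero, smul_zero, Prod.mk_add_mk, add_zero, zero_add,
        Algebra.smul_def, Algebra.smul_def, mul_one, mul_one]
      exact Prod.ext e₁.symm e₂.symm
    rw [this]
    exact add_mem (Submodule.smul_mem_smul hy₁ trivial) (Submodule.smul_mem_smul hy₂ trivial)
  rw [hc _ (by omega), Nat.add_sub_cancel] at hfx
  have h : f x ∈ I ^ n • LinearMap.range f := Submodule.smul_mono le_rfl inf_le_right hfx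
  rw [LinearMap.range_eq_map, ← Submodule.map_smul''] at h
  obtain ⟨y, hy, e⟩ := h
  rw [smul_eq_mul, Ideal.mul_top] at hy
  rwa [← hinj (show (p₁ y, p₂ y) = (p₁ x, p₂ x) from e)]

theorem map_mem_map_pow {S : Type*} [CommRing S] (p : A →+* S) {I : Ideal A} {k : ℕ} {x : A}
    (hx : x ∈ I ^ k) : p x ∈ I.map p ^ k := by
  rw [← Ideal.map_pow]
  exact Ideal.mem_map_of_mem p hx

/-- A fibre product of complete noetherian local rings over a common quotient is complete. -/
theorem isAdicComplete_of_jointly_injective [IsNoetherianRing A] [IsLocalRing A]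
    [IsNoetherianRing R₁] [IsNoetherianRing R₂] [IsLocalRing R₁] [IsLocalRing R₂]
    [IsAdicComplete (IsLocalRing.maximalIdeal R₁) R₁]
    [IsAdicComplete (IsLocalRing.maximalIdeal R₂) R₂]
    {p₁ : A →+* R₁} {p₂ : A →+* R₂} (h₁ : Function.Surjective p₁) (h₂ : Function.Surjective p₂)
    (hinj : Function.Injective fun a => (p₁ a, p₂ a))
    (hm₁ : (IsLocalRing.maximalIdeal A).map p₁ = IsLocalRing.maximalIdeal R₁)
    (hm₂ : (IsLocalRing.maximalIdeal A).map p₂ = IsLocalRing.maximalIdeal R₂)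
    (I : Ideal R₂) (hI : ∀ a, p₁ a = 0 → p₂ a ∈ I)
    (hrange : ∀ a, ∀ b ∈ I, ∃ c, p₁ c = p₁ a ∧ p₂ c = p₂ a + b) :
    IsAdicComplete (IsLocalRing.maximalIdeal A) A := by
  set m := IsLocalRing.maximalIdeal A
  obtain ⟨c, hc⟩ := exists_mem_pow_of_jointly_injective m h₁ h₂ hinj
  refine { prec' := fun f hf => ?_ }
  simp only [smul_eq_mul, Ideal.mul_top, SModEq.sub_mem] at hf ⊢
  obtain ⟨L₁, hL₁⟩ := IsPrecomplete.prec' (I := IsLocalRing.maximalIdeal R₁)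
    (fun k => p₁ (f k)) fun {i j} hij => by
      rw [smul_eq_mul, Ideal.mul_top, SModEq.sub_mem, ← map_sub, ← hm₁]
      exact map_mem_map_pow p₁ (hf hij)
  obtain ⟨L₂, hL₂⟩ := IsPrecomplete.prec' (I := IsLocalRing.maximalIdeal R₂)
    (fun k => p₂ (f k)) fun {i j} hij => by
      rw [smul_eq_mul, Ideal.mul_top, SModEq.sub_mem, ← map_sub, ← hm₂]
      exact map_mem_map_pow p₂ (hf hij)
  simp only [smul_eq_mul, Ideal.mul_top, SModEq.sub_mem, ← hm₁, ← hm₂] at hL₁ hL₂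
  obtain ⟨a, rfl⟩ := h₁ L₁
  -- The two component limits must be compatible. The quotient `R₂ ⧸ I` is Hausdorff, so it is
  -- enough to compare modulo every power. There `f k - a` differs from some `z ∈ m ^ k` by an
  -- element that `p₁` kills, hence that `p₂` sends into `I`.
  have hmem : L₂ - p₂ a ∈ I := by
    rw [← Ideal.Quotient.eq_zero_iff_mem]
    refine IsHausdorff.haus
      (inferInstance : IsHausdorff (IsLocalRing.maximalIdeal R₂) (R₂ ⧸ I)) _ fun k => ?_
    rw [SModEq.zero]
    have h := hL₁ k
    rw [← map_sub, ← Ideal.map_pow] at h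
    obtain ⟨z, hz, e⟩ := (Ideal.mem_map_iff_of_surjective _ h₁).1 h
    have h3 := hI (f k - a - z) (by rw [map_sub, e, sub_self])
    have h4 : Ideal.Quotient.mk I (L₂ - p₂ a) =
        Ideal.Quotient.mk I (p₂ z - (p₂ (f k) - L₂)) := by
      rw [Ideal.Quotient.eq]
      convert h3 using 1
      simp only [map_sub]
      ring
    have h5 : p₂ z - (p₂ (f k) - L₂) ∈ IsLocalRing.maximalIdeal R₂ ^ k := by
      rw [← hm₂]
      exact sub_mem (map_mem_map_pow p₂ hz) (hL₂ k)
    rw [h4, ← mul_one (p₂ z - (p₂ (f k) - L₂)), ← smul_eq_mul,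
      ← Ideal.Quotient.mkₐ_eq_mk R₂, map_smul]
    exact Submodule.smul_mem_smul h5 trivial
  obtain ⟨L, e₁, e₂⟩ := hrange a _ hmem
  refine ⟨L, fun k => ?_⟩
  -- The Artin–Rees shift `c` is absorbed by comparing the limit with a later term; the Cauchy
  -- property brings the estimate back to `f k`.
  have h3 : f (k + c) - L ∈ m ^ k := by
    refine hc k _ ?_ ?_
    · rw [map_sub, e₁]
      exact hL₁ _
    · rw [map_sub, e₂, add_sub_cancel]
      exact hL₂ _
  simpa using add_mem (hf (Nat.le_add_right k c)) h3

end FibreProduct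

/-! ### The fibre product as a coefficient ring, and gluing of minimal lifts. -/

section FibreCNL

variable {ℓ : ℕ} [Fact ℓ.Prime] {F : Type u} [Field F] {R₁ R₂ : CNL ℓ F} {I₁ : Ideal R₁}
  {I₂ : Ideal R₂}

/-- The ring of pairs with the same image in the common quotient. -/
def fibreSubring (φ : R₁ ⧸ I₁ ≃+* R₂ ⧸ I₂) : Subring (R₁ × R₂) :=
  RingHom.eqLocus ((φ.toRingHom.comp (Ideal.Quotient.mk I₁)).comp (RingHom.fst R₁ R₂))
    ((Ideal.Quotient.mk I₂).comp (RingHom.snd R₁ R₂))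

theorem mem_fibreSubring {φ : R₁ ⧸ I₁ ≃+* R₂ ⧸ I₂} {ab : R₁ × R₂} :
    ab ∈ fibreSubring φ ↔ φ (Ideal.Quotient.mk I₁ ab.1) = Ideal.Quotient.mk I₂ ab.2 := Iff.rfl

/-- The isomorphism is only known to respect `W(F)`, but Witt vectors already represent all
residues. With `a ≡ w`, a unit `b - w` would make `a - w` a unit modulo `I₁`, hence a unit. -/
theorem fibre_residue_eq (hI₁ : I₁ ≠ ⊤) (φ : R₁ ⧸ I₁ ≃+* R₂ ⧸ I₂)
    (hφ : ∀ w, φ (Ideal.Quotient.mk I₁ (R₁.str w)) = Ideal.Quotient.mk I₂ (R₂.str w))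
    {a : R₁} {b : R₂} (hab : φ (Ideal.Quotient.mk I₁ a) = Ideal.Quotient.mk I₂ b) :
    R₁.residue a = R₂.residue b := by
  obtain ⟨w, hw⟩ := R₁.exists_str_sub_mem a
  have h1 : R₁.residue a = WittVector.constantCoeff w := by
    rw [R₁.mem_m_iff, map_sub, sub_eq_zero, R₁.residue_str] at hw
    exact hw
  have h2 : b - R₂.str w ∈ R₂.m := by
    by_contra hnot
    have hu : IsUnit (b - R₂.str w) := by
      rwa [R₂.isUnit_iff, Ne, ← R₂.mem_m_iff]
    have hu2 := hu.map (Ideal.Quotient.mk I₂)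
    rw [map_sub, ← hab, ← hφ, ← map_sub, ← map_sub] at hu2
    have hu3 := (MulEquiv.isUnit_map φ).1 hu2
    have hI := R₁.le_m hI₁
    have := Ideal.Quotient.nontrivial_iff.2 hI₁
    have : IsLocalHom (Ideal.Quotient.mk I₁) :=
      IsLocalHom.of_surjective _ Ideal.Quotient.mk_surjective
    exact (IsLocalRing.mem_maximalIdeal _).1 hw ((isUnit_map_iff (Ideal.Quotient.mk I₁) _).1 hu3)
  rw [h1]
  rw [R₂.mem_m_iff, map_sub, sub_eq_zero, R₂.residue_str] at h2
  exact h2.symm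

/-- The fibre product of coefficient rings is a coefficient ring. -/
theorem exists_fibre_cnl (hI₁ : I₁ ≠ ⊤) (φ : R₁ ⧸ I₁ ≃+* R₂ ⧸ I₂)
    (hφ : ∀ w, φ (Ideal.Quotient.mk I₁ (R₁.str w)) = Ideal.Quotient.mk I₂ (R₂.str w)) :
    ∃ (R₃ : CNL ℓ F) (p₁ : R₃.Hom R₁) (p₂ : R₃.Hom R₂),
      Function.Surjective p₁.toRingHom ∧ Function.Surjective p₂.toRingHom ∧
      Function.Injective (fun c => (p₁.toRingHom c, p₂.toRingHom c)) ∧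
      Set.range (fun c => (p₁.toRingHom c, p₂.toRingHom c)) =
        {ab | φ (Ideal.Quotient.mk I₁ ab.1) = Ideal.Quotient.mk I₂ ab.2} := by
  let A := fibreSubring φ
  let p₁ : A →+* R₁ := (RingHom.fst R₁ R₂).comp A.subtype
  let p₂ : A →+* R₂ := (RingHom.snd R₁ R₂).comp A.subtype
  have hp : ∀ a : A, φ (Ideal.Quotient.mk I₁ (p₁ a)) = Ideal.Quotient.mk I₂ (p₂ a) := fun a => a.2
  have hres : ∀ a : A, R₁.residue (p₁ a) = R₂.residue (p₂ a) := fun a =>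
    fibre_residue_eq hI₁ φ hφ (hp a)
  have h₁ : Function.Surjective p₁ := fun a => by
    obtain ⟨b, hb⟩ := Ideal.Quotient.mk_surjective (φ (Ideal.Quotient.mk I₁ a))
    exact ⟨⟨(a, b), hb.symm⟩, rfl⟩
  have h₂ : Function.Surjective p₂ := fun b => by
    obtain ⟨a, ha⟩ := Ideal.Quotient.mk_surjective (φ.symm (Ideal.Quotient.mk I₂ b))
    exact ⟨⟨(a, b), by rw [mem_fibreSubring, ha, RingEquiv.apply_symm_apply]⟩, rfl⟩
  have hinj : Function.Injective fun a => (p₁ a, p₂ a) := fun a b h => Subtype.ext h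
  have hunit : ∀ a : A, IsUnit (p₁ a) → IsUnit a := by
    intro a ha
    have hb : IsUnit (p₂ a) := by
      rw [R₂.isUnit_iff, ← hres]
      exact R₁.isUnit_iff.1 ha
    obtain ⟨a', ha'⟩ := ha.exists_right_inv
    obtain ⟨b', hb'⟩ := hb.exists_right_inv
    have hc : (a', b') ∈ fibreSubring φ := by
      rw [mem_fibreSubring]
      have e1 := congrArg (fun x => φ (Ideal.Quotient.mk I₁ x)) ha'
      have e2 := congrArg (Ideal.Quotient.mk I₂) hb'
      simp only [map_mul, map_one, hp] at e1 e2
      calc φ (Ideal.Quotient.mk I₁ a')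
          = φ (Ideal.Quotient.mk I₁ a') *
            (Ideal.Quotient.mk I₂ (p₂ a) * Ideal.Quotient.mk I₂ b') := by rw [e2, mul_one]
        _ = (Ideal.Quotient.mk I₂ (p₂ a) * φ (Ideal.Quotient.mk I₁ a')) *
            Ideal.Quotient.mk I₂ b' := by ring
        _ = Ideal.Quotient.mk I₂ b' := by rw [e1, one_mul]
    refine .of_mul_eq_one ⟨(a', b'), hc⟩ (hinj ?_)
    exact Prod.ext ((map_mul p₁ _ _).trans (ha'.trans (map_one p₁).symm))
      ((map_mul p₂ _ _).trans (hb'.trans (map_one p₂).symm))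
  have : IsLocalHom p₁ := ⟨hunit⟩
  have : IsLocalRing A := p₁.domain_isLocalRing
  have : IsNoetherianRing A := isNoetherianRing_of_jointly_injective h₁ h₂ hinj
  have hmem : ∀ a : A, a ∈ IsLocalRing.maximalIdeal A ↔ R₁.residue (p₁ a) = 0 := fun a => by
    rw [IsLocalRing.mem_maximalIdeal, mem_nonunits_iff, ← R₁.mem_m_iff,
      IsLocalRing.mem_maximalIdeal, mem_nonunits_iff, not_iff_not]
    exact ⟨fun h => h.map p₁, hunit a⟩
  have hm₁ : (IsLocalRing.maximalIdeal A).map p₁ = R₁.m := by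
    refine le_antisymm (Ideal.map_le_iff_le_comap.2 fun a ha => ?_) fun x hx => ?_
    · exact R₁.mem_m_iff.2 ((hmem a).1 ha)
    · obtain ⟨a, rfl⟩ := h₁ x
      exact Ideal.mem_map_of_mem _ ((hmem a).2 (R₁.mem_m_iff.1 hx))
  have hm₂ : (IsLocalRing.maximalIdeal A).map p₂ = R₂.m := by
    refine le_antisymm (Ideal.map_le_iff_le_comap.2 fun a ha => ?_) fun x hx => ?_
    · exact R₂.mem_m_iff.2 ((hres a).symm.trans ((hmem a).1 ha))
    · obtain ⟨a, rfl⟩ := h₂ x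
      exact Ideal.mem_map_of_mem _ ((hmem a).2 ((hres a).trans (R₂.mem_m_iff.1 hx)))
  have : IsAdicComplete (IsLocalRing.maximalIdeal A) A := by
    refine isAdicComplete_of_jointly_injective h₁ h₂ hinj hm₁ hm₂ I₂ (fun a ha => ?_)
      fun a b hb => ?_
    · rw [← Ideal.Quotient.eq_zero_iff_mem, ← hp, ha, map_zero, map_zero]
    · refine ⟨⟨(p₁ a, p₂ a + b), ?_⟩, rfl, rfl⟩
      rw [mem_fibreSubring]
      simp only [map_add, hp, Ideal.Quotient.eq_zero_iff_mem.2 hb, add_zero]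
  let R₃ : CNL ℓ F :=
    { carrier := A
      str := (R₁.str.prod R₂.str).codRestrict A fun w => hφ w
      residue := R₁.residue.comp p₁
      residue_comp_str := by
        ext w
        exact R₁.residue_str w }
  refine ⟨R₃, ⟨p₁, rfl, rfl⟩, ⟨p₂, rfl, RingHom.ext fun a => (hres a).symm⟩, h₁, h₂, hinj, ?_⟩
  ext ab
  exact ⟨fun ⟨c, hc⟩ => hc ▸ c.2, fun h => ⟨⟨ab, h⟩, rfl⟩⟩

variable {G : Type v} [Group G] [TopologicalSpace G] [IsTopologicalGroup G] {n : ℕ}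

/-- Minimal lifts can be glued along fibre products. -/
theorem exists_minimalLift_fibre {R₃ : CNL ℓ F} {p₁ : R₃.Hom R₁} {p₂ : R₃.Hom R₂}
    (h₁ : Function.Surjective p₁.toRingHom) (h₂ : Function.Surjective p₂.toRingHom)
    (hinj : Function.Injective (fun c => (p₁.toRingHom c, p₂.toRingHom c)))
    {ρbar : G →* GL (Fin n) F} {I : Subgroup G} {ρ₁ : G →* GL (Fin n) R₁}
    {ρ₂ : G →* GL (Fin n) R₂} (hρ₁ : ρ₁ ∈ minimalLifts ℓ ρbar I R₁)
    (hρ₂ : ρ₂ ∈ minimalLifts ℓ ρbar I R₂)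
    (hex : ∀ g i j, ∃ c, p₁.toRingHom c = (ρ₁ g).1 i j ∧ p₂.toRingHom c = (ρ₂ g).1 i j) :
    ∃ ρ₃ ∈ minimalLifts ℓ ρbar I R₃, push p₁.toRingHom ρ₃ = ρ₁ ∧ push p₂.toRingHom ρ₃ = ρ₂ := by
  have hGL : ∀ {A B : GL (Fin n) R₃},
      Matrix.GeneralLinearGroup.map p₁.toRingHom A = Matrix.GeneralLinearGroup.map p₁.toRingHom B →
      Matrix.GeneralLinearGroup.map p₂.toRingHom A = Matrix.GeneralLinearGroup.map p₂.toRingHom B →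
      A = B := fun {A B} e₁ e₂ => by
    refine Matrix.GeneralLinearGroup.ext fun i j => hinj ?_
    exact Prod.ext (congrArg (fun C : GL (Fin n) R₁ => C.1 i j) e₁)
      (congrArg (fun C : GL (Fin n) R₂ => C.1 i j) e₂)
  choose X hX₁ hX₂ using hex
  have hA : ∀ g, ∃ A : GL (Fin n) R₃, Matrix.GeneralLinearGroup.map p₁.toRingHom A = ρ₁ g ∧
      Matrix.GeneralLinearGroup.map p₂.toRingHom A = ρ₂ g := fun g => by
    obtain ⟨A, hA, e⟩ := exists_gl_map_eq p₁.toRingHom (ρ₁ g) (fun i j => X g i j) (hX₁ g)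
    refine ⟨A, e, Matrix.GeneralLinearGroup.ext fun i j => ?_⟩
    change p₂.toRingHom (A.1 i j) = _
    rw [hA]
    exact hX₂ g i j
  choose A hA₁ hA₂ using hA
  let ρ₃ : G →* GL (Fin n) R₃ := MonoidHom.mk' A fun g h =>
    hGL (by rw [map_mul, hA₁, hA₁, hA₁, map_mul]) (by rw [map_mul, hA₂, hA₂, hA₂, map_mul])
  have e₁ : push p₁.toRingHom ρ₃ = ρ₁ := MonoidHom.ext hA₁
  have e₂ : push p₂.toRingHom ρ₃ = ρ₂ := MonoidHom.ext hA₂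
  rw [mem_minimalLifts_iff] at hρ₁ hρ₂
  refine ⟨ρ₃, mem_minimalLifts_iff.2 ⟨⟨isContinuousRep_iff.2 fun k => ?_, ?_, fun g => ?_⟩, ?_⟩,
    e₁, e₂⟩
  -- Artin–Rees compares topologies: elements deep enough in both components lie in a given power of
  -- the maximal ideal of `R₃`.
  · obtain ⟨c, hc⟩ := exists_mem_pow_of_jointly_injective R₃.m h₁ h₂ hinj
    refine Subgroup.isOpen_mono (H₁ := (congSubgroup n (R₁.m ^ (k + c))).comap ρ₁ ⊓
      (congSubgroup n (R₂.m ^ (k + c))).comap ρ₂) (fun g hg => ?_)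
      ((isContinuousRep_iff.1 hρ₁.1.continuous (k + c)).inter
        (isContinuousRep_iff.1 hρ₂.1.continuous (k + c)))
    rw [Subgroup.mem_comap, mem_congSubgroup]
    intro i j
    refine hc k _ ?_ ?_
    · rw [p₁.m_map_eq h₁, map_sub, one_apply_map]
      convert mem_congSubgroup.1 hg.1 i j using 2
      exact congrArg (fun C : GL (Fin n) R₁ => C.1 i j) (hA₁ g)
    · rw [p₂.m_map_eq h₂, map_sub, one_apply_map]
      convert mem_congSubgroup.1 hg.2 i j using 2
      exact congrArg (fun C : GL (Fin n) R₂ => C.1 i j) (hA₂ g)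
  · rw [← p₁.residue_comp, ← push_push, e₁, hρ₁.1.reduction]
  · refine hinj (Prod.ext ?_ ?_)
    · change p₁.toRingHom (ρ₃ g).1.det = p₁.toRingHom (R₃.teich (ρbar g).1.det)
      rw [p₁.map_teich, ← hρ₁.1.det_eq, RingHom.map_det, ← e₁]
      rfl
    · change p₂.toRingHom (ρ₃ g).1.det = p₂.toRingHom (R₃.teich (ρbar g).1.det)
      rw [p₂.map_teich, ← hρ₂.1.det_eq, RingHom.map_det, ← e₂]
      rfl
  · intro g hg h1
    refine hGL ?_ ?_
    · rw [map_one]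
      exact (hA₁ g).trans (hρ₁.2 g hg h1)
    · rw [map_one]
      exact (hA₂ g).trans (hρ₂.2 g hg h1)

end FibreCNL

/-! ### Cocycles vanishing on a subgroup -/

section Affine

variable {F : Type u} [Field F] {G : Type v} [Group G]
  {M : Type w} [AddCommGroup M] [Module F M]

/-- The permutation `x ↦ φ x + m`. -/
def affinePerm (r : Representation F G M) (φ : G) (m : M) : Equiv.Perm M where
  toFun x := r φ x + m
  invFun x := r φ⁻¹ (x - m)
  left_inv x := by simp
  right_inv x := by simp

/-- Since the linear part of the `j`-th power is `φ ^ j`, the function `φ ^ j ↦ (a ^ j) 0` formally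
obeys the cocycle rule, where `a` is the affine permutation. Negative exponents then need no
geometric sums. -/
theorem affinePerm_zpow (r : Representation F G M) (φ : G) (m : M) (j : ℤ) (x : M) :
    (affinePerm r φ m ^ j) x = r (φ ^ j) x + (affinePerm r φ m ^ j) 0 := by
  have hf : ∀ k : ℕ, ∀ x, (affinePerm r φ m ^ k) x = r (φ ^ k) x + (affinePerm r φ m ^ k) 0 := by
    intro k
    induction k with
    | zero => intro x; simp
    | succ k ih =>
      intro x
      rw [pow_succ, Equiv.Perm.mul_apply, Equiv.Perm.mul_apply, ih, ih (affinePerm r φ m 0),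
        ← add_assoc, pow_succ, map_mul, Module.End.mul_apply, ← map_add]
      simp [affinePerm]
  cases j with
  | ofNat k => simpa using hf k x
  | negSucc k =>
    rw [zpow_negSucc, zpow_negSucc, Equiv.Perm.inv_eq_iff_eq, hf, map_add, ← Module.End.mul_apply,
      ← map_mul, mul_inv_cancel, map_one, Module.End.one_apply, add_assoc,
      ← hf, ← Equiv.Perm.mul_apply, mul_inv_cancel, Equiv.Perm.one_apply, add_zero]

theorem mem_B1 {r : Representation F G M} {c : G → M} : c ∈ B1 r ↔ ∃ m, ∀ g, c g = r g m - m := by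
  constructor
  · rintro ⟨m, rfl⟩
    exact ⟨m, fun g => rfl⟩
  · rintro ⟨m, hm⟩
    exact ⟨m, funext fun g => (hm g).symm⟩

end Affine

/-! ### Averaging, unramified classes, and evaluation at a Frobenius. -/

section Cohomology

variable {F : Type u} [Field F] {G : Type v} [Group G] [TopologicalSpace G]
  {M : Type w} [AddCommGroup M] [Module F M] {r : Representation F G M}

theorem cocycle_mul (c : Z1 r) (g h : G) : c.1 (g * h) = c.1 g + r g (c.1 h) := c.2.2 g h

theorem cocycle_one (c : Z1 r) : c.1 1 = 0 := by
  simpa using cocycle_mul c 1 1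

theorem H1.mk_eq_zero_iff {c : Z1 r} : H1.mk r c = 0 ↔ ∃ m, ∀ g, c.1 g = r g m - m := by
  rw [H1.mk, Submodule.mkQ_apply, Submodule.Quotient.mk_eq_zero, Submodule.submoduleOf,
    Submodule.mem_comap, Submodule.subtype_apply]
  exact mem_B1

variable (r) in
/-- The cocycles vanishing on a subgroup. -/
def Z1van (N : Subgroup G) : Submodule F (Z1 r) where
  carrier := {c | ∀ g ∈ N, c.1 g = 0}
  add_mem' ha hb g hg := by
    change _ + _ = (0 : M)
    rw [ha g hg, hb g hg, add_zero]
  zero_mem' _ _ := rfl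
  smul_mem' a c hc g hg := by
    change a • _ = (0 : M)
    rw [hc g hg, smul_zero]

/-- If `N` acts trivially, then vanishing on `N` depends only on the cohomology class. -/
theorem mem_Z1van_of_mk_mem {N : Subgroup G} (hN : ∀ g ∈ N, r g = 1) {c : Z1 r}
    (h : H1.mk r c ∈ (Z1van r N).map (H1.mk r)) : c ∈ Z1van r N := by
  obtain ⟨d, hd, e⟩ := h
  rw [← sub_eq_zero, ← map_sub, H1.mk_eq_zero_iff] at e
  obtain ⟨m, hm⟩ := e
  intro g hg
  have h1 := hm g
  rw [hN g hg, Module.End.one_apply, sub_self] at h1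
  have h2 : d.1 g - c.1 g = 0 := h1
  rw [hd g hg, zero_sub, neg_eq_zero] at h2
  exact h2

/-- A cocycle for an action of `I` through a finite quotient of invertible order is a
coboundary. -/
theorem exists_eq_sub_of_coprime {Γ : Type*} [Group Γ] (f : G →* Γ) (I : Subgroup G)
    [Finite (I.map f)] (hI : (Nat.card (I.map f) : F) ≠ 0) {c : Z1 r}
    (hc : c ∈ Z1van r (I ⊓ f.ker)) : ∃ m, ∀ g ∈ I, c.1 g = r g m - m := by
  classical
  have := Fintype.ofFinite (I.map f)
  have hdep : ∀ g ∈ I, ∀ h ∈ I, f g = f h → c.1 g = c.1 h := by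
    intro g hg h hh e
    have h1 : g⁻¹ * h ∈ I ⊓ f.ker :=
      Subgroup.mem_inf.2 ⟨mul_mem (inv_mem hg) hh, by
        rw [MonoidHom.mem_ker, map_mul, map_inv, e, inv_mul_cancel]⟩
    have h2 := cocycle_mul c g (g⁻¹ * h)
    rw [hc _ h1, map_zero, add_zero, mul_inv_cancel_left] at h2
    exact h2.symm
  choose σ hσ hfσ using fun x : I.map f => x.2
  let S := ∑ x, c.1 (σ x)
  -- Translation by `f g` permutes the summands. The resulting identity exhibits `c g` as the
  -- coboundary of `-S` divided by the order of the image.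
  have key : ∀ g ∈ I, S = (Nat.card (I.map f) : F) • c.1 g + r g S := by
    intro g hg
    let y : I.map f := ⟨f g, g, hg, rfl⟩
    calc S = ∑ x, c.1 (σ (y * x)) := (Equiv.sum_comp (Equiv.mulLeft y) fun x => c.1 (σ x)).symm
      _ = ∑ x, (c.1 g + r g (c.1 (σ x))) := by
        refine Finset.sum_congr rfl fun x _ => ?_
        rw [← cocycle_mul]
        refine hdep _ (hσ _) _ (mul_mem hg (hσ _)) ?_
        rw [hfσ, map_mul, hfσ]
        rfl
      _ = _ := by
        rw [Finset.sum_add_distrib, Finset.sum_const, Finset.card_univ, ← Nat.card_eq_fintype_card,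
          map_sum, Nat.cast_smul_eq_nsmul]
  refine ⟨-((Nat.card (I.map f) : F)⁻¹ • S), fun g hg => ?_⟩
  have h := congrArg (fun z => (Nat.card (I.map f) : F)⁻¹ • z) (key g hg)
  simp only [smul_add, smul_smul, inv_mul_cancel₀ hI, one_smul] at h
  rw [map_neg, map_smul, sub_neg_eq_add, h]
  abel

/-- Coboundaries as continuous cocycles. -/
def cobound [IsTopologicalGroup G] {V : Subgroup G} (hV : IsOpen (V : Set G))
    (hr : ∀ g ∈ V, r g = 1) (m : M) : Z1 r :=
  ⟨fun g => r g m - m, (IsLocallyConstant.iff_exists_open _).2 fun g =>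
    ⟨(g⁻¹ * ·) ⁻¹' V, hV.preimage (continuous_const_mul g⁻¹), by simp, fun x hx => by
      have h := hr _ hx
      have : r x = r g := by
        rw [← mul_inv_cancel_left g x, map_mul, h, mul_one]
      rw [this]⟩, fun g h => by
      change r (g * h) m - m = (r g m - m) + r g (r h m - m)
      rw [map_mul, Module.End.mul_apply, map_sub]
      abel⟩

theorem mk_cobound [IsTopologicalGroup G] {V : Subgroup G} (hV : IsOpen (V : Set G))
    (hr : ∀ g ∈ V, r g = 1) (m : M) :
    H1.mk r (cobound hV hr m) = 0 := H1.mk_eq_zero_iff.2 ⟨m, fun _ => rfl⟩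

/-- On `I` the cocycle is a coboundary by averaging; subtracting the same coboundary on all of `G`
leaves the class unchanged and makes the cocycle vanish on `I`. -/
theorem map_mk_Z1van_eq [IsTopologicalGroup G] {Γ : Type*} [Group Γ] (f : G →* Γ) (I : Subgroup G)
    [Finite (I.map f)] (hI : (Nat.card (I.map f) : F) ≠ 0) (hf : IsOpen (f.ker : Set G))
    (hr : ∀ g ∈ f.ker, r g = 1) :
    (Z1van r (I ⊓ f.ker)).map (H1.mk r) = (Z1van r I).map (H1.mk r) := by
  refine le_antisymm ?_ (Submodule.map_mono fun c hc g hg => hc g hg.1)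
  rintro _ ⟨c, hc, rfl⟩
  obtain ⟨m, hm⟩ := exists_eq_sub_of_coprime f I hI hc
  refine ⟨c - cobound hf hr m, fun g hg => sub_eq_zero.2 (hm g hg), ?_⟩
  rw [map_sub, mk_cobound, sub_zero]

theorem apply_mem_invariants {I : Subgroup G} [hn : I.Normal] {c : Z1 r} (hc : c ∈ Z1van r I)
    (g : G) : c.1 g ∈ Representation.invariants (r.comp I.subtype) := by
  rintro ⟨i, hi⟩
  have h1 := cocycle_mul c i g
  rw [hc i hi, zero_add] at h1
  have h2 := cocycle_mul c g (g⁻¹ * i * g)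
  rw [hc (g⁻¹ * i * g) (by simpa using hn.conj_mem i hi g⁻¹), map_zero, add_zero, mul_assoc,
    mul_inv_cancel_left] at h2
  exact h1.symm.trans h2

/-- The equality already holds for cocycles: one that vanishes on `I` is constant on cosets and
takes `I`-invariant values, and local constancy passes to the quotient topology. -/
theorem H1unr_eq (I : Subgroup G) [I.Normal] : H1unr r I = (Z1van r I).map (H1.mk r) := by
  rw [H1unr]
  congr 1
  ext c
  rw [Submodule.submoduleOf, Submodule.mem_comap, Submodule.subtype_apply]
  constructor
  · rintro ⟨d, hd, e⟩ g hg
    rw [← e]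
    change ((d (QuotientGroup.mk g) : Representation.invariants (r.comp I.subtype)) : M) = 0
    rw [(QuotientGroup.eq_one_iff g).2 hg]
    exact congrArg Subtype.val (cocycle_one ⟨d, hd⟩)
  · intro hc
    have hwd : ∀ a b : G, QuotientGroup.leftRel I a b →
        (⟨c.1 a, apply_mem_invariants hc a⟩ : Representation.invariants (r.comp I.subtype)) =
          ⟨c.1 b, apply_mem_invariants hc b⟩ := by
      intro a b hab
      rw [QuotientGroup.leftRel_apply] at hab
      have h := cocycle_mul c a (a⁻¹ * b)
      rw [hc _ hab, map_zero, add_zero, mul_inv_cancel_left] at h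
      exact Subtype.ext h.symm
    refine ⟨fun x => Quotient.liftOn' x _ hwd, ⟨fun s => ?_, fun x y => ?_⟩, rfl⟩
    · rw [← isQuotientMap_quotient_mk'.isOpen_preimage]
      convert c.2.1 (Subtype.val '' s) using 1
      ext g
      constructor
      · exact fun h => ⟨_, h, rfl⟩
      · rintro ⟨y, hy, e⟩
        have : y = ⟨c.1 g, apply_mem_invariants hc g⟩ := Subtype.ext e
        rw [this] at hy
        exact hy
    · induction x using QuotientGroup.induction_on with | _ g
      induction y using QuotientGroup.induction_on with | _ h
      exact Subtype.ext (cocycle_mul c g h)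

/-- `φ` generates `G ⧸ I`, which is the free profinite group on it. -/
structure IsFreeGenerator (φ : G) (I : Subgroup G) : Prop where
  gen : ∀ U : Subgroup G, IsOpen (U : Set G) → I ≤ U → ∀ g, ∃ j : ℤ, (φ ^ j)⁻¹ * g ∈ U
  free : ∀ N : ℕ, 0 < N → ∃ U : Subgroup G, U.Normal ∧ IsOpen (U : Set G) ∧ I ≤ U ∧
    ∀ j : ℤ, φ ^ j ∈ U → (N : ℤ) ∣ j

variable {φ : G} {I : Subgroup G}

/-- The zero set of a continuous cocycle is an open subgroup. If it contains `I` and a topological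
generator modulo `I`, it is everything. -/
theorem IsFreeGenerator.eq_of_apply_eq (hφ : IsFreeGenerator φ I) {c : Z1 r}
    (hc : c ∈ Z1van r I) (h : c.1 φ = 0) : c = 0 := by
  let K : Subgroup G :=
    { carrier := {g | c.1 g = 0}
      one_mem' := cocycle_one c
      mul_mem' := fun {a b} (ha : c.1 a = 0) (hb : c.1 b = 0) => by
        change c.1 (a * b) = 0
        rw [cocycle_mul c, ha, hb, map_zero, add_zero]
      inv_mem' := fun {a} (ha : c.1 a = 0) => by
        have h1 := cocycle_mul c a⁻¹ a
        rw [ha, map_zero, add_zero, inv_mul_cancel, cocycle_one c] at h1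
        exact h1.symm }
  refine Subtype.ext (funext fun g => ?_)
  obtain ⟨j, hj⟩ := hφ.gen K (c.2.1 {0}) hc g
  have hg : g ∈ K := by
    rw [← mul_inv_cancel_left (φ ^ j) g]
    exact mul_mem (zpow_mem (show φ ∈ K from h) j) hj
  exact hg

/-- A cocycle vanishing on `I` can take any `I`-invariant value at a free generator. -/
theorem IsFreeGenerator.exists_apply_eq [IsTopologicalGroup G] [Finite M] [I.Normal]
    (hφ : IsFreeGenerator φ I)
    {V : Subgroup G} (hV : IsOpen (V : Set G)) (hr : ∀ g ∈ V, r g = 1) {m : M}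
    (hm : m ∈ Representation.invariants (r.comp I.subtype)) : ∃ c ∈ Z1van r I, c.1 φ = m := by
  let r' := r.toInvariants I
  -- The cocycle will send `φ ^ j` to `(a ^ j) 0`. As `M` is finite, `a` has finite order, and
  -- freeness supplies an open subgroup in which every power of `φ` has exponent divisible by that
  -- order; this makes the value well defined modulo `U`.
  let a := affinePerm r' φ ⟨m, hm⟩
  obtain ⟨U₀, hU₀n, hU₀o, hIU₀, hfree⟩ := hφ.free (orderOf a) (orderOf_pos a)
  let S : Subgroup G := MonoidHom.ker r'
  have hIS : I ≤ S := fun g hg => LinearMap.ext fun x => Subtype.ext (x.2 ⟨g, hg⟩)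
  have hSo : IsOpen (S : Set G) := Subgroup.isOpen_mono (H₁ := V) (fun g hg =>
    LinearMap.ext fun x => Subtype.ext (LinearMap.congr_fun (hr g hg) x.1)) hV
  let U := U₀ ⊓ S
  have hUo : IsOpen (U : Set G) := hU₀o.inter hSo
  have hIU : I ≤ U := le_inf hIU₀ hIS
  have hUn : U.Normal := inferInstance
  choose v hv using hφ.gen U hUo hIU
  have hindep : ∀ g (j : ℤ), (φ ^ j)⁻¹ * g ∈ U → a ^ j = a ^ v g := by
    intro g j hj
    have h1 := hfree (v g - j) (by
      have := mul_mem hj (inv_mem (hv g))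
      have h2 := hUn.mem_comm (show (φ ^ j)⁻¹ * (g * (g⁻¹ * φ ^ v g)) ∈ U by
        simpa [mul_assoc] using this)
      rw [mul_inv_cancel_left] at h2
      rw [zpow_sub]
      exact h2.1)
    rw [← orderOf_dvd_sub_iff_zpow_eq_zpow]
    simpa using dvd_neg.2 h1
  let c : G → Representation.invariants (r.comp I.subtype) := fun g => (a ^ v g) 0
  have hc : ∀ g h, c (g * h) = c g + r' g (c h) := by
    intro g h
    have h1 : (φ ^ (v g + v h))⁻¹ * (g * h) ∈ U := by
      have := mul_mem (hUn.conj_mem _ (hv g) (φ ^ v h)⁻¹) (hv h)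
      simpa [zpow_add, mul_assoc] using this
    have h2 : r' g = r' (φ ^ v g) := by
      rw [← mul_inv_cancel_left (φ ^ v g) g, map_mul, MonoidHom.mem_ker.1 (hv g).2, mul_one,
        mul_inv_cancel_left]
    rw [h2]
    change (a ^ v (g * h)) 0 = _
    rw [← hindep _ _ h1, zpow_add, Equiv.Perm.mul_apply, affinePerm_zpow, add_comm]
  have hcI : ∀ g ∈ U, c g = 0 := fun g hg => by
    have := hindep g 0 (by simpa using hg)
    change (a ^ v g) 0 = 0
    rw [← this, zpow_zero, Equiv.Perm.one_apply]
  refine ⟨⟨fun g => (c g : M), (IsLocallyConstant.iff_exists_open _).2 fun g =>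
    ⟨(g⁻¹ * ·) ⁻¹' U, hUo.preimage (continuous_const_mul g⁻¹), by simp, fun x hx => ?_⟩,
    fun g h => congrArg Subtype.val (hc g h)⟩,
    fun g hg => congrArg Subtype.val (hcI g (hIU hg)), ?_⟩
  · rw [← mul_inv_cancel_left g x, hc, hcI _ hx, map_zero, add_zero]
  · change ((a ^ v φ) 0).1 = m
    rw [← hindep φ 1 (by simp), zpow_one]
    simp [a, affinePerm]

/-- The dimension of `H¹_unr`. -/
theorem IsFreeGenerator.finrank_H1unr [IsTopologicalGroup G] [Finite M] [I.Normal]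
    (hφ : IsFreeGenerator φ I)
    {V : Subgroup G} (hV : IsOpen (V : Set G)) (hr : ∀ g ∈ V, r g = 1) :
    Module.Finite F (H1unr r I) ∧
      Module.finrank F (H1unr r I) = Module.finrank F (Representation.invariants r) := by
  have : Module.Finite F M := inferInstance
  let ev : Z1van r I →ₗ[F] Representation.invariants (r.comp I.subtype) :=
    { toFun := fun c => ⟨c.1.1 φ, apply_mem_invariants c.2 φ⟩
      map_add' := fun _ _ => rfl
      map_smul' := fun _ _ => rfl }
  have hev : Function.Bijective ev := by
    constructor
    · rw [injective_iff_map_eq_zero]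
      exact fun c hc => Subtype.ext (hφ.eq_of_apply_eq c.2 (congrArg Subtype.val hc))
    · rintro ⟨m, hm⟩
      obtain ⟨c, hc, e⟩ := hφ.exists_apply_eq hV hr hm
      exact ⟨⟨c, hc⟩, Subtype.ext e⟩
  let e := LinearEquiv.ofBijective ev hev
  -- `θ` maps `M^I` onto the unramified classes with kernel the range of `T = φ - 1`, while the
  -- kernel of `T` is `M^G`. Rank–nullity for both maps gives the dimension.
  let T : Module.End F (Representation.invariants (r.comp I.subtype)) := r.toInvariants I φ - 1
  let θ : Representation.invariants (r.comp I.subtype) →ₗ[F] H1 r :=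
    (H1.mk r).comp ((Z1van r I).subtype.comp e.symm.toLinearMap)
  have hrange : LinearMap.range θ = H1unr r I := by
    rw [H1unr_eq]
    ext x
    constructor
    · rintro ⟨m, rfl⟩
      exact ⟨_, (e.symm m).2, rfl⟩
    · rintro ⟨c, hc, rfl⟩
      exact ⟨e ⟨c, hc⟩, by simp [θ]⟩
  have hker : LinearMap.ker θ = LinearMap.range T := by
    ext m
    obtain ⟨c, rfl⟩ := e.surjective m
    have h1 : θ (e c) = H1.mk r c.1 := by simp [θ]
    rw [LinearMap.mem_ker, h1, H1.mk_eq_zero_iff]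
    constructor
    · rintro ⟨x, hx⟩
      refine ⟨⟨x, fun i => ?_⟩, Subtype.ext (hx φ).symm⟩
      have := hx i
      rw [c.2 i i.2] at this
      exact (sub_eq_zero.1 this.symm)
    · rintro ⟨x, hx⟩
      have h2 : (⟨cobound hV hr x.1, fun g hg => sub_eq_zero.2 (x.2 ⟨g, hg⟩)⟩ : Z1van r I) = c :=
        e.injective (by rw [← hx]; rfl)
      exact ⟨x.1, fun g => by rw [← h2]; rfl⟩
  have hT : LinearMap.ker T ≃ₗ[F] Representation.invariants r :=
    { toFun := fun x => ⟨x.1.1, fun g => by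
        let K : Subgroup G :=
          { carrier := {g | r g x.1.1 = x.1.1}
            one_mem' := by simp
            mul_mem' := fun {a b} (ha : r a _ = _) (hb : r b _ = _) => by
              change r (a * b) _ = _
              rw [map_mul, Module.End.mul_apply, hb, ha]
            inv_mem' := fun {a} (ha : r a _ = _) => by
              change r a⁻¹ _ = _
              conv_lhs => rw [← ha]
              rw [← Module.End.mul_apply, ← map_mul, inv_mul_cancel, map_one,
                Module.End.one_apply] }
        have hK : IsOpen (K : Set G) := Subgroup.isOpen_mono (H₁ := V) (fun g hg => by
          change r g _ = _
          rw [hr g hg, Module.End.one_apply]) hV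
        have hφK : φ ∈ K := congrArg Subtype.val (sub_eq_zero.1 (LinearMap.mem_ker.1 x.2))
        obtain ⟨j, hj⟩ := hφ.gen K hK (fun i hi => x.1.2 ⟨i, hi⟩) g
        have : g ∈ K := by
          rw [← mul_inv_cancel_left (φ ^ j) g]
          exact mul_mem (zpow_mem hφK j) hj
        exact this⟩
      map_add' := fun _ _ => rfl
      map_smul' := fun _ _ => rfl
      invFun := fun y => ⟨⟨y.1, fun i => y.2 i⟩, LinearMap.mem_ker.2 (Subtype.ext
        (sub_eq_zero.2 (y.2 φ)))⟩
      left_inv := fun _ => rfl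
      right_inv := fun _ => rfl }
  rw [← hrange, ← hT.finrank_eq]
  refine ⟨inferInstance, ?_⟩
  have h1 := LinearMap.finrank_range_add_finrank_ker θ
  have h2 := LinearMap.finrank_range_add_finrank_ker T
  rw [hker] at h1
  omega

end Cohomology

/-! ### The tangent space of the minimal lifts -/

section Tangent

variable {ℓ : ℕ} [Fact ℓ.Prime] {F : Type u} [Field F] {G : Type v} [Group G] {n : ℕ}

theorem ad0_apply (ρbar : G →* GL (Fin n) F) (g : G) (A : Traceless n F) :
    (ad0 ρbar g A).1 = (ρbar g).1 * A.1 * ((ρbar g)⁻¹).1 := rfl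

theorem ad0_eq_one {ρbar : G →* GL (Fin n) F} {g : G} (hg : ρbar g = 1) : ad0 ρbar g = 1 := by
  refine LinearMap.ext fun A => Subtype.ext ?_
  rw [ad0_apply, hg]
  simp

theorem CNL.dualEps_mul_dualInl {x : F} (h : CNL.dualEps ℓ F * CNL.dualInl ℓ F x = 0) :
    x = 0 := by
  have := congrArg (TrivSqZeroExt.snd : DualNumber F → F) h
  simpa [CNL.dualEps, CNL.dualInl] using this

theorem CNL.dualEps_mul_dualEps : CNL.dualEps ℓ F * CNL.dualEps ℓ F = 0 :=
  DualNumber.eps_mul_eps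

/-- The lift `(1 + ε c) ρbar` to the dual numbers. -/
def dualLift [TopologicalSpace G] (ℓ : ℕ) [Fact ℓ.Prime] {ρbar : G →* GL (Fin n) F}
    (c : Z1 (ad0 ρbar)) : G →* GL (Fin n) (CNL.dual ℓ F) :=
  let u : G → Matrix (Fin n) (Fin n) (CNL.dual ℓ F) := fun g =>
    CNL.dualEps ℓ F • (c.1 g).1.map (CNL.dualInl ℓ F)
  have hu : ∀ g A h, u g * A * u h = 0 := fun g A h => by
    simp only [u, Matrix.smul_mul, Matrix.mul_smul, smul_smul]
    exact (congrArg (· • _) CNL.dualEps_mul_dualEps).trans (zero_smul _ _)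
  have hu2 : ∀ g, u g * u g = 0 := fun g => by simpa using hu g 1 g
  MonoidHom.mk' (fun g => (⟨1 + u g, 1 - u g, by
    rw [show (1 + u g) * (1 - u g) = 1 - u g * u g by noncomm_ring, hu2, sub_zero], by
    rw [show (1 - u g) * (1 + u g) = 1 - u g * u g by noncomm_ring, hu2, sub_zero]⟩ :
      GL (Fin n) (CNL.dual ℓ F)) * push (CNL.dualInl ℓ F) ρbar g) fun g h => Units.ext (by
    set ρ₀ := push (CNL.dualInl ℓ F) ρbar
    change (1 + u (g * h)) * (ρ₀ (g * h)).1 = (1 + u g) * (ρ₀ g).1 * ((1 + u h) * (ρ₀ h).1)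
    have h1 : u (g * h) = u g + (ρ₀ g).1 * u h * ((ρ₀ g)⁻¹).1 := by
      simp only [u]
      rw [cocycle_mul, Submodule.coe_add, ad0_apply, Matrix.map_add _ (map_add _), smul_add,
        Matrix.map_mul, Matrix.map_mul, Matrix.mul_smul, Matrix.smul_mul]
      rfl
    have h2 : ((ρ₀ g)⁻¹).1 * (ρ₀ g).1 = 1 := by rw [← Units.val_mul, inv_mul_cancel, Units.val_one]
    rw [h1, map_mul, Units.val_mul]
    have h3 := hu g (ρ₀ g).1 h
    calc _ = ((1 + u g) * (ρ₀ g).1 + (ρ₀ g).1 * u h * (((ρ₀ g)⁻¹).1 * (ρ₀ g).1)) * (ρ₀ h).1 := by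
          noncomm_ring
      _ = ((1 + u g) * (ρ₀ g).1 + (ρ₀ g).1 * u h + u g * (ρ₀ g).1 * u h) * (ρ₀ h).1 := by
          rw [h2, h3, mul_one, add_zero]
      _ = _ := by noncomm_ring)

theorem dualLift_apply [TopologicalSpace G] {ρbar : G →* GL (Fin n) F} (c : Z1 (ad0 ρbar)) (g : G) :
    (dualLift ℓ c g).1 = (1 + CNL.dualEps ℓ F • (c.1 g).1.map (CNL.dualInl ℓ F)) *
      (push (CNL.dualInl ℓ F) ρbar g).1 := rfl

variable [TopologicalSpace G] [IsTopologicalGroup G]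

theorem dualLift_mem {ρbar : G →* GL (Fin n) F} (hcont : IsOpen (ρbar.ker : Set G))
    {I : Subgroup G} {c : Z1 (ad0 ρbar)} (hc : c ∈ Z1van (ad0 ρbar) (I ⊓ ρbar.ker)) :
    dualLift ℓ c ∈ minimalLifts ℓ ρbar I (CNL.dual ℓ F) := by
  have hone : ∀ g, ρbar g = 1 → c.1 g = 0 → dualLift ℓ c g = 1 := fun g h1 h2 => by
    refine Units.ext ?_
    rw [dualLift_apply, h2, push_apply, h1, map_one]
    simp
  rw [mem_minimalLifts_iff]
  refine ⟨⟨isContinuousRep_iff.2 fun k => ?_, ?_, fun g => ?_⟩, fun g hg h1 =>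
    hone g h1 (hc g ⟨hg, h1⟩)⟩
  -- The lift is trivial where `ρbar` is trivial and `c` vanishes, which is an open neighbourhood of
  -- `1`.
  · refine Subgroup.isOpen_of_mem_nhds _ (g := 1) (Filter.mem_of_superset
      ((hcont.inter (c.2.1 {0})).mem_nhds ⟨one_mem ρbar.ker, cocycle_one c⟩) fun g hg => ?_)
    rw [SetLike.mem_coe, Subgroup.mem_comap, hone g hg.1 hg.2]
    exact one_mem _
  · refine MonoidHom.ext fun g => Units.ext ?_
    change ((dualLift ℓ c g).1.map (CNL.dual ℓ F).residue) = _
    rw [dualLift_apply]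
    change (CNL.dual ℓ F).residue.mapMatrix (_ * _) = _
    rw [map_mul, map_add, map_one]
    have h0 : (CNL.dual ℓ F).residue.mapMatrix
        (CNL.dualEps ℓ F • (c.1 g).1.map (CNL.dualInl ℓ F)) = 0 := by
      ext i j
      exact ((CNL.dual ℓ F).residue.map_mul _ _).trans (zero_mul _)
    rw [h0, add_zero, one_mul]
    rfl
  · rw [dualLift_apply, Matrix.det_mul, det_one_add_eq (I := Ideal.span {CNL.dualEps ℓ F})]
    · have h0 : (CNL.dualEps ℓ F • (c.1 g).1.map (CNL.dualInl ℓ F)).trace = 0 := by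
        have h1 : ((c.1 g).1.map (CNL.dualInl ℓ F)).trace =
            CNL.dualInl ℓ F (c.1 g).1.trace := by
          simp [Matrix.trace]
        have h2 : (c.1 g).1.trace = 0 := (c.1 g).2
        rw [Matrix.trace_smul, h1, h2, map_zero, smul_zero]
      rw [h0, add_zero, one_mul]
      have h1 : (CNL.dual ℓ F).teich (ρbar g).1.det = CNL.dualInl ℓ F (ρbar g).1.det :=
        congrArg (CNL.dualInl ℓ F) (CNL.residue_teich (CNL.field ℓ F) (ρbar g).1.det)
      rw [h1, RingHom.map_det]
      rfl
    · intro x hx y hy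
      obtain ⟨a, rfl⟩ := Ideal.mem_span_singleton'.1 hx
      obtain ⟨b, rfl⟩ := Ideal.mem_span_singleton'.1 hy
      rw [mul_mul_mul_comm, CNL.dualEps_mul_dualEps, mul_zero]
    · exact fun i j => Ideal.mul_mem_right _ _ (Ideal.mem_span_singleton_self _)

/-- Where `ρbar` is trivial on `I`, both the minimal lift and the constant lift are `1`, so `ε c =
0` and hence `c = 0`. Conversely `(1 + ε c) ρbar` is a minimal lift. The classes thus already form a
subspace before taking spans. -/
theorem tangentClasses_minimalLifts {ρbar : G →* GL (Fin n) F}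
    (hcont : IsOpen (ρbar.ker : Set G)) (I : Subgroup G) :
    tangentClasses ρbar (minimalLifts ℓ ρbar I) =
      ((Z1van (ad0 ρbar) (I ⊓ ρbar.ker)).map (H1.mk (ad0 ρbar)) : Set (H1 (ad0 ρbar))) := by
  ext x
  constructor
  · rintro ⟨ρ, hρ, c, rfl, hc⟩
    refine ⟨c, fun g hg => ?_, rfl⟩
    have h := hc g
    rw [(mem_minimalLifts_iff.1 hρ).2 g hg.1 hg.2, push_apply, MonoidHom.mem_ker.1 hg.2] at h
    simp only [map_one, inv_one, Units.val_one, mul_one, sub_self] at h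
    refine Subtype.ext (Matrix.ext fun i j => ?_)
    exact CNL.dualEps_mul_dualInl (congrFun (congrFun h.symm i) j)
  · rintro ⟨c, hc, rfl⟩
    refine ⟨dualLift ℓ c, dualLift_mem hcont hc, c, rfl, fun g => ?_⟩
    rw [dualLift_apply, mul_assoc, ← Units.val_mul, mul_inv_cancel, Units.val_one, mul_one,
      add_sub_cancel_left]

theorem tangentSpace_minimalLifts {ρbar : G →* GL (Fin n) F}
    (hcont : IsOpen (ρbar.ker : Set G)) (I : Subgroup G) :
    tangentSpace ρbar (minimalLifts ℓ ρbar I) =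
      (Z1van (ad0 ρbar) (I ⊓ ρbar.ker)).map (H1.mk (ad0 ρbar)) := by
  rw [tangentSpace, tangentClasses_minimalLifts hcont, Submodule.span_eq]

end Tangent

/-! ### The tangent condition -/

namespace CNL

variable {ℓ : ℕ} [Fact ℓ.Prime] {F : Type u} [Field F]

theorem mul_eq_of_residue_eq (R : CNL ℓ F) {J : Ideal R} (h : R.m * J = ⊥) {r s x : R}
    (hrs : R.residue r = R.residue s) (hx : x ∈ J) : r * x = s * x := by
  rw [← sub_eq_zero, ← sub_mul]
  exact R.mul_eq_zero_of_mem h (R.mem_m_iff.2 (by rw [map_sub, hrs, sub_self])) hx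

/-- An ideal killed by the maximal ideal is a vector space over the residue field. -/
abbrev killedModule (R : CNL ℓ F) {J : Ideal R} (h : R.m * J = ⊥) : Module F J where
  smul a x := ⟨R.teich a * x, J.mul_mem_left _ x.2⟩
  one_smul x := Subtype.ext (by
    change R.teich 1 * x.1 = x.1
    rw [teich_one, one_mul])
  mul_smul a b x := Subtype.ext (by
    change R.teich (a * b) * x.1 = R.teich a * (R.teich b * x.1)
    rw [teich_mul, mul_assoc])
  smul_zero a := Subtype.ext (mul_zero _)
  smul_add a x y := Subtype.ext (mul_add _ _ _)
  add_smul a b x := Subtype.ext (by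
    change R.teich (a + b) * x.1 = R.teich a * x.1 + R.teich b * x.1
    rw [← add_mul]
    exact R.mul_eq_of_residue_eq h (by simp [residue_teich]) x.2)
  zero_smul x := Subtype.ext (by
    change R.teich 0 * x.1 = 0
    rw [teich_zero, zero_mul])

theorem finite_killedModule (R : CNL ℓ F) {J : Ideal R} (h : R.m * J = ⊥) :
    letI := R.killedModule h
    Module.Finite F J := by
  let := R.killedModule h
  obtain ⟨S, hS⟩ := IsNoetherian.noetherian (⊤ : Submodule R J)
  refine ⟨⟨S, eq_top_iff.2 fun x _ => ?_⟩⟩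
  have hx : x ∈ Submodule.span R (S : Set J) := hS ▸ trivial
  induction hx using Submodule.span_induction with
  | mem x hx => exact Submodule.subset_span hx
  | zero => exact zero_mem _
  | add x y _ _ hx hy => exact add_mem (hx trivial) (hy trivial)
  | smul r x _ hx =>
    have : r • x = R.residue r • x := Subtype.ext
      (R.mul_eq_of_residue_eq h (R.residue_teich _).symm x.2)
    rw [this]
    exact Submodule.smul_mem _ _ (hx trivial)

/-- Coordinates on an ideal killed by the maximal ideal. -/
theorem exists_coords (R : CNL ℓ F) {J : Ideal R} (h : R.m * J = ⊥) :
    ∃ (k : ℕ) (x : Fin k → R) (f : Fin k → R → F), (∀ a, x a ∈ J) ∧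
      (∀ a, ∀ y ∈ J, ∀ z ∈ J, f a (y + z) = f a y + f a z) ∧
      (∀ a r, ∀ y ∈ J, f a (r * y) = R.residue r * f a y) ∧
      ∀ y ∈ J, y = ∑ a, x a * R.teich (f a y) := by
  classical
  let := R.killedModule h
  have := R.finite_killedModule h
  let b := Module.finBasis F J
  -- The coordinates take the default value `0` off `J`; their properties are asserted only on `J`.
  obtain ⟨f, hf⟩ : ∃ f : Fin _ → R → F, ∀ a y (hy : y ∈ J), f a y = b.repr ⟨y, hy⟩ a :=
    ⟨fun a y => if hy : y ∈ J then b.repr ⟨y, hy⟩ a else 0, fun a y hy => dif_pos hy⟩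
  refine ⟨_, fun a => b a, f, fun a => (b a).2, fun a y hy z hz => ?_, fun a r y hy => ?_,
    fun y hy => ?_⟩
  · rw [hf a y hy, hf a z hz, hf a _ (add_mem hy hz)]
    exact congrArg (fun q => q a) (map_add b.repr ⟨y, hy⟩ ⟨z, hz⟩)
  · rw [hf a y hy, hf a _ (J.mul_mem_left r hy)]
    have e : (⟨r * y, J.mul_mem_left r hy⟩ : J) = R.residue r • ⟨y, hy⟩ := Subtype.ext
      (R.mul_eq_of_residue_eq h (R.residue_teich _).symm hy)
    rw [e, map_smul]
    rfl
  · have := congrArg (fun z : J => (z : R)) (b.sum_repr ⟨y, hy⟩)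
    simp only [AddSubmonoidClass.coe_finsetSum] at this
    refine this.symm.trans (Finset.sum_congr rfl fun a _ => ?_)
    rw [hf a y hy, mul_comm]
    rfl

end CNL

section Difference

variable {ℓ : ℕ} [Fact ℓ.Prime] {F : Type u} [Field F] {G : Type v} [Group G]
  [TopologicalSpace G] {n : ℕ} {ρbar : G →* GL (Fin n) F} {I : Subgroup G}
  {R : CNL ℓ F} {J : Ideal R} {ρ₁ ρ₂ : G →* GL (Fin n) R}

/-- The coordinates of `ρ₂ ρ₁⁻¹ - 1` in a basis of the ideal are `ad0`-valued cocycles, and they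
vanish on `I ∩ ker ρbar` because both lifts are trivial there. No coboundary term is needed, so `B =
0`. -/
theorem diffClassMem_of_mem [IsTopologicalGroup G] (hJ : R.m * J = ⊥)
    (h₁ : ρ₁ ∈ minimalLifts ℓ ρbar I R)
    (h₂ : ρ₂ ∈ minimalLifts ℓ ρbar I R)
    (he : push (Ideal.Quotient.mk J) ρ₁ = push (Ideal.Quotient.mk J) ρ₂) :
    DiffClassMem ρbar ((Z1van (ad0 ρbar) (I ⊓ ρbar.ker)).map (H1.mk (ad0 ρbar))) J ρ₁ ρ₂ := by
  rw [mem_minimalLifts_iff] at h₁ h₂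
  -- `J` may be the unit ideal when `R` is a field; intersecting with the maximal ideal makes
  -- products of two entries vanish in every case.
  let K := J ⊓ R.m
  have hK : R.m * K = ⊥ := eq_bot_iff.2 (hJ ▸ Ideal.mul_mono_right inf_le_left)
  have hKK : ∀ x ∈ K, ∀ y ∈ K, x * y = 0 := fun x hx y hy => R.mul_eq_zero_of_mem hK hx.2 hy
  let u : G → Matrix (Fin n) (Fin n) R := fun g => (ρ₂ g).1 * ((ρ₁ g)⁻¹).1 - 1
  have hu : ∀ g i j, u g i j ∈ K := fun g i j => by
    have hJ' : ρ₂ g * (ρ₁ g)⁻¹ ∈ congSubgroup n J := mul_inv_mem_congSubgroup.2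
      (map_mk_eq_iff.1 (DFunLike.congr_fun he g).symm)
    have hm' : ρ₂ g * (ρ₁ g)⁻¹ ∈ congSubgroup n R.m := mul_inv_mem_congSubgroup.2 fun i j =>
      R.mem_m_iff.2 ((map_eq_map_iff R.residue).1
        ((h₂.1.residue_apply g).trans (h₁.1.residue_apply g).symm) i j)
    exact ⟨mem_congSubgroup.1 hJ' i j, mem_congSubgroup.1 hm' i j⟩
  have htr : ∀ g, (u g).trace = 0 := fun g => by
    have h := det_one_add_eq hKK (hu g)
    have hdet : (1 + u g).det = 1 := by
      simp only [u]
      rw [add_sub_cancel, Matrix.det_mul, h₂.1.det_eq, ← h₁.1.det_eq, ← Matrix.det_mul,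
        ← Units.val_mul, mul_inv_cancel, Units.val_one, Matrix.det_one]
    rw [hdet] at h
    exact left_eq_add.1 h
  have hmul : ∀ g h, u (g * h) = u g + (ρ₁ g).1 * u h * ((ρ₁ g)⁻¹).1 := fun g h => by
    have h1 : ∀ g, (ρ₂ g).1 = (1 + u g) * (ρ₁ g).1 := fun g => by
      simp only [u]
      rw [add_sub_cancel, mul_assoc, ← Units.val_mul, inv_mul_cancel, Units.val_one, mul_one]
    have h2 : (ρ₁ h).1 * ((ρ₁ h)⁻¹).1 = 1 := by
      rw [← Units.val_mul, mul_inv_cancel, Units.val_one]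
    have h3 : (ρ₁ g).1 * ((ρ₁ g)⁻¹).1 = 1 := by
      rw [← Units.val_mul, mul_inv_cancel, Units.val_one]
    have h4 : u g * ((ρ₁ g).1 * u h * ((ρ₁ g)⁻¹).1) = 0 := by
      ext i j
      rw [Matrix.mul_apply]
      exact Finset.sum_eq_zero fun l _ => hKK _ (hu g i l) _ (map_mul_apply_mem (hu h) l j)
    calc u (g * h) = (ρ₂ g).1 * (ρ₂ h).1 * (((ρ₁ h)⁻¹).1 * ((ρ₁ g)⁻¹).1) - 1 := by
          simp only [u]
          rw [map_mul, map_mul, mul_inv_rev, Units.val_mul, Units.val_mul]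
      _ = (1 + u g) * (ρ₁ g).1 * ((1 + u h) * ((ρ₁ h).1 * ((ρ₁ h)⁻¹).1)) * ((ρ₁ g)⁻¹).1 - 1 := by
          rw [h1 g, h1 h]
          noncomm_ring
      _ = (1 + u g) * ((ρ₁ g).1 * ((ρ₁ g)⁻¹).1) + (ρ₁ g).1 * u h * ((ρ₁ g)⁻¹).1 +
            u g * ((ρ₁ g).1 * u h * ((ρ₁ g)⁻¹).1) - 1 := by
          rw [h2]
          noncomm_ring
      _ = _ := by
          rw [h3, h4]
          noncomm_ring
  obtain ⟨k, x, f, hx, hfadd, hfmul, hfx⟩ := R.exists_coords hK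
  have hf0 : ∀ a, f a 0 = 0 := fun a => by simpa using hfmul a 0 0 (zero_mem _)
  have hfsum : ∀ a {ι : Type} (s : Finset ι) (y : ι → R), (∀ i, y i ∈ K) →
      f a (∑ i ∈ s, y i) = ∑ i ∈ s, f a (y i) := by
    intro a ι s y hy
    classical
    induction s using Finset.induction_on with
    | empty => simpa using hf0 a
    | insert i s hi ih =>
      rw [Finset.sum_insert hi, Finset.sum_insert hi,
        hfadd a _ (hy i) _ (Ideal.sum_mem _ fun i _ => hy i), ih]
  have hfconj : ∀ a (A B : GL (Fin n) R) (M : Matrix (Fin n) (Fin n) R), (∀ i j, M i j ∈ K) →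
      (A.1 * M * B.1).map (f a) = A.1.map R.residue * M.map (f a) * B.1.map R.residue := by
    intro a A B M hM
    ext i j
    simp only [Matrix.map_apply, Matrix.mul_apply, Finset.sum_mul]
    rw [hfsum a _ _ fun l => Ideal.sum_mem _ fun l' _ =>
      K.mul_mem_right _ (K.mul_mem_left _ (hM _ _))]
    refine Finset.sum_congr rfl fun l _ => ?_
    rw [hfsum a _ _ fun l' => K.mul_mem_right _ (K.mul_mem_left _ (hM _ _))]
    refine Finset.sum_congr rfl fun l' _ => ?_
    rw [mul_assoc, hfmul _ _ _ (K.mul_mem_right _ (hM _ _)), mul_comm (M _ _), hfmul _ _ _ (hM _ _),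
      mul_comm (R.residue (B.1 _ _)), mul_assoc]
  let c : Fin k → G → Traceless n F := fun a g => ⟨(u g).map (f a), by
    rw [LinearMap.mem_ker, Matrix.traceLinearMap_apply]
    have := hfsum a Finset.univ (fun i => u g i i) fun i => hu g i i
    exact this.symm.trans ((congrArg (f a) (htr g)).trans (hf0 a))⟩
  have hcmul : ∀ a g h, c a (g * h) = c a g + ad0 ρbar g (c a h) := by
    intro a g h
    refine Subtype.ext ?_
    rw [Submodule.coe_add, ad0_apply]
    have e := hfconj a (ρ₁ g) (ρ₁ g)⁻¹ (u h) (hu h)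
    have hr : (ρ₁ g).1.map R.residue = (ρbar g).1 := congrArg Units.val (h₁.1.residue_apply g)
    have hr' : ((ρ₁ g)⁻¹).1.map R.residue = ((ρbar g)⁻¹).1 := by
      have := h₁.1.residue_apply g⁻¹
      rw [map_inv ρ₁, map_inv ρbar] at this
      exact congrArg Units.val this
    rw [hr, hr'] at e
    change (u (g * h)).map (f a) = (u g).map (f a) + _ * (u h).map (f a) * _
    rw [← e, hmul]
    ext i j
    exact hfadd a _ (hu g i j) _ (map_mul_apply_mem (hu h) i j)
  have hc0 : ∀ a g, u g = 0 → c a g = 0 := fun a g h => Subtype.ext (Matrix.ext fun i j => by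
    change f a (u g i j) = 0
    rw [h]
    exact hf0 a)
  -- Continuity of the coordinate cocycles: where both lifts are `1` modulo `m ^ N`, the entries of
  -- `u` lie in `m ^ N ⊓ K = ⊥`.
  obtain ⟨N, -, hN⟩ := R.exists_pow_inf_eq_bot hK
  let V : Subgroup G := (congSubgroup n (R.m ^ N)).comap ρ₁ ⊓ (congSubgroup n (R.m ^ N)).comap ρ₂
  have hV : IsOpen (V : Set G) := (isContinuousRep_iff.1 h₁.1.continuous N).inter
    (isContinuousRep_iff.1 h₂.1.continuous N)
  have hVu : ∀ g ∈ V, u g = 0 := fun g hg => Matrix.ext fun i j => by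
    have : ρ₂ g * (ρ₁ g)⁻¹ ∈ congSubgroup n (R.m ^ N) := mul_mem hg.2 (inv_mem hg.1)
    have h3 : u g i j ∈ R.m ^ N ⊓ K := ⟨mem_congSubgroup.1 this i j, hu g i j⟩
    rw [hN] at h3
    exact h3
  refine ⟨k, x, fun a => ⟨c a, (IsLocallyConstant.iff_exists_open _).2 fun g =>
    ⟨(g⁻¹ * ·) ⁻¹' V, hV.preimage (continuous_const_mul g⁻¹), by simp, fun y hy => ?_⟩, hcmul a⟩,
    0, fun a => (hx a).1, fun a => ⟨_, fun g hg => hc0 a g ?_, rfl⟩, fun _ _ => zero_mem _,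
    Matrix.trace_zero _ _, fun g => ?_⟩
  · rw [← mul_inv_cancel_left g y, hcmul, hc0 a _ (hVu _ hy), map_zero, add_zero]
  · simp only [u]
    rw [h₁.2 g hg.1 hg.2, h₂.2 g hg.1 hg.2]
    simp
  · simp only [mul_zero, zero_mul, sub_self, add_zero]
    ext i j
    rw [Matrix.sum_apply]
    exact hfx _ (hu g i j)

/-- At `g ∈ I` with `ρbar g = 1` the coboundary term drops out since `ρ₁ g = 1`, and each cocycle
vanishes since its class lies in `L` and `g` acts trivially on `ad0`. -/
theorem mem_of_diffClassMem (h₁ : ρ₁ ∈ minimalLifts ℓ ρbar I R) (h₂ : IsLift ρbar ρ₂)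
    (h : DiffClassMem ρbar ((Z1van (ad0 ρbar) (I ⊓ ρbar.ker)).map (H1.mk (ad0 ρbar))) J ρ₁ ρ₂) :
    ρ₂ ∈ minimalLifts ℓ ρbar I R := by
  rw [mem_minimalLifts_iff] at h₁ ⊢
  refine ⟨h₂, fun g hg h1 => Units.ext ?_⟩
  obtain ⟨k, x, c, B, -, hc, -, -, hB⟩ := h
  have := hB g
  have hc' : ∀ a, (c a).1 g = 0 := fun a =>
    mem_Z1van_of_mk_mem (N := I ⊓ ρbar.ker) (fun g hg => ad0_eq_one hg.2) (hc a) g ⟨hg, h1⟩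
  rw [h₁.2 g hg h1] at this
  simp only [hc', inv_one, Units.val_one, mul_one, one_mul, sub_self, add_zero, sub_eq_iff_eq_add]
    at this
  rw [this, Units.val_one, add_eq_right]
  refine Finset.sum_eq_zero fun a _ => ?_
  ext i j
  simp [CNL.teich_zero]

end Difference

/-! ### Lifting minimal lifts -/

section Smoothness

variable {ℓ : ℕ} [Fact ℓ.Prime] {F : Type u} [Field F] {n : ℕ} {R Q : CNL ℓ F}

/-- The invertible matrices whose determinant is a Teichmüller lift. -/
def teichDet (n : ℕ) (R : CNL ℓ F) : Subgroup (GL (Fin n) R) :=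
  MonoidHom.eqLocus (Matrix.detMonoidHom.comp (Units.coeHom _))
    ((R.str : WittVector ℓ F →* R).comp ((WittVector.teichmuller ℓ).comp
      ((R.residue : R →* F).comp (Matrix.detMonoidHom.comp (Units.coeHom _)))))

theorem mem_teichDet {A : GL (Fin n) R} :
    A ∈ teichDet n R ↔ A.1.det = R.teich (Matrix.GeneralLinearGroup.map R.residue A).1.det := by
  have : (Matrix.GeneralLinearGroup.map R.residue A).1.det = R.residue A.1.det :=
    (RingHom.map_det _ _).symm
  rw [this]
  rfl

theorem map_residue_map (q : R.Hom Q) (A : GL (Fin n) R) :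
    Matrix.GeneralLinearGroup.map Q.residue (Matrix.GeneralLinearGroup.map q.toRingHom A) =
      Matrix.GeneralLinearGroup.map R.residue A :=
  Units.ext (Matrix.ext fun _ _ => q.residue_apply _)

/-- An arbitrary lift has the wrong determinant only by a unit that maps to `1` in `Q`; rescaling
the first row repairs it. This requires a row, so `n = 0` is separate. -/
theorem exists_mem_teichDet (q : R.Hom Q) (hq : Function.Surjective q.toRingHom)
    {B : GL (Fin n) Q} (hB : B ∈ teichDet n Q) :
    ∃ A ∈ teichDet n R, Matrix.GeneralLinearGroup.map q.toRingHom A = B := by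
  choose X hX using fun i j => hq (B.1 i j)
  obtain ⟨A₀, -, hA₀⟩ := exists_gl_map_eq q.toRingHom B (Matrix.of X) hX
  rcases n with - | n
  · refine ⟨A₀, ?_, hA₀⟩
    rw [mem_teichDet, Matrix.det_isEmpty, Matrix.det_isEmpty, R.teich_one]
  set d := (Matrix.GeneralLinearGroup.map R.residue A₀).1.det
  have hu : IsUnit A₀.1.det := (Matrix.isUnit_iff_isUnit_det _).1 A₀.isUnit
  obtain ⟨e, he⟩ := hu.exists_left_inv
  have hqd : q.toRingHom A₀.1.det = Q.teich d := by
    rw [mem_teichDet, ← hA₀, map_residue_map] at hB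
    rw [← hB, RingHom.map_det]
    rfl
  have hr : q.toRingHom (R.teich d * e) = 1 := by
    rw [map_mul, q.map_teich, ← hqd, ← map_mul, mul_comm, he, map_one]
  obtain ⟨A, hA, hqA⟩ := exists_gl_map_eq q.toRingHom B
    (A₀.1.updateRow 0 ((R.teich d * e) • A₀.1 0)) fun i j => by
      have h0 : q.toRingHom (A₀.1 i j) = B.1 i j :=
        congrArg (fun C : GL (Fin (n + 1)) Q => C.1 i j) hA₀
      rw [Matrix.updateRow_apply]
      split_ifs with hi
      · rw [Pi.smul_apply, smul_eq_mul, map_mul, hr, one_mul, ← hi, h0]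
      · exact h0
  refine ⟨A, ?_, hqA⟩
  have : Matrix.GeneralLinearGroup.map R.residue A =
      Matrix.GeneralLinearGroup.map R.residue A₀ := by
    rw [← map_residue_map q, hqA, ← map_residue_map q, hA₀]
  rw [mem_teichDet, this, hA, Matrix.det_updateRow_smul, Matrix.updateRow_eq_self, mul_assoc, he,
    mul_one]

theorem CNL.Hom.ker_le_m (q : R.Hom Q) : RingHom.ker q.toRingHom ≤ R.m := fun x hx => by
  rw [R.mem_m_iff, ← q.residue_apply, (RingHom.mem_ker).1 hx, map_zero]

theorem map_eq_map_iff_ker (q : R.Hom Q) {A B : GL (Fin n) R} :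
    Matrix.GeneralLinearGroup.map q.toRingHom A = Matrix.GeneralLinearGroup.map q.toRingHom B ↔
      A * B⁻¹ ∈ congSubgroup n (RingHom.ker q.toRingHom) := by
  rw [map_eq_map_iff, mul_inv_mem_congSubgroup]
  rfl

/-- Matrices congruent to `1` modulo an ideal killed by `m` form an `ℓ`-group. -/
theorem isPGroup_congSubgroup [CharP F ℓ] {J : Ideal R} (hJ : R.m * J = ⊥) (hJm : J ≤ R.m) :
    IsPGroup ℓ (congSubgroup n J) := by
  rintro ⟨A, hA⟩
  refine ⟨1, Subtype.ext (Units.ext ?_)⟩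
  rw [pow_one]
  obtain ⟨M, hM⟩ : ∃ M, A.1 = 1 + M := ⟨A.1 - 1, by abel⟩
  have hMJ : ∀ i j, M i j ∈ J := fun i j => by
    have := mem_congSubgroup.1 hA i j
    rwa [hM, Matrix.add_apply, add_sub_cancel_left] at this
  have hMM : M * M = 0 := by
    ext i j
    rw [Matrix.mul_apply]
    exact Finset.sum_eq_zero fun l _ => R.mul_eq_zero_of_mem hJ (hJm (hMJ i l)) (hMJ l j)
  have hpow : ∀ k : ℕ, A.1 ^ k = 1 + (k : R) • M := by
    intro k
    induction k with
    | zero => simp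
    | succ k ih =>
      rw [pow_succ, ih, hM, Nat.cast_succ, add_smul, one_smul, mul_add, mul_one, add_mul, one_mul,
        Matrix.smul_mul, hMM, smul_zero, add_zero, add_assoc]
  change A.1 ^ ℓ = 1
  rw [hpow, add_eq_left]
  ext i j
  exact R.mul_eq_zero_of_mem hJ R.natCast_mem_m (hMJ i j)

theorem finite_congSubgroup [Finite F] {J : Ideal R} (hJ : R.m * J = ⊥) :
    Finite (congSubgroup n J) := by
  have : Finite J := by
    let := R.killedModule hJ
    have := R.finite_killedModule hJ
    exact Module.finite_of_finite F
  refine Finite.of_injective (β := Fin n → Fin n → J)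
    (fun A i j => ⟨_, mem_congSubgroup.1 A.2 i j⟩) fun A B h => ?_
  refine Subtype.ext (Units.ext (Matrix.ext fun i j => ?_))
  have := congrArg Subtype.val (congrFun (congrFun h i) j)
  exact sub_left_injective this

variable {G : Type v} [Group G]

/-- Schur–Zassenhaus: a representation of `I` with finite image of order prime to `ℓ` lifts. -/
theorem exists_lift_of_coprime [Finite F] [CharP F ℓ] (q : R.Hom Q)
    (hq : Function.Surjective q.toRingHom) (hJ : R.m * RingHom.ker q.toRingHom = ⊥)
    (ρ : G →* GL (Fin n) Q) (hcard : (Nat.card ρ.range).Coprime ℓ)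
    (hdet : ∀ g, ρ g ∈ teichDet n Q) :
    ∃ s : G →* GL (Fin n) R, (∀ g, Matrix.GeneralLinearGroup.map q.toRingHom (s g) = ρ g) ∧
      (∀ g, s g ∈ teichDet n R) ∧ ∀ g, ρ g = 1 → s g = 1 := by
  let π := Matrix.GeneralLinearGroup.map (n := Fin n) q.toRingHom
  -- Imposing Teichmüller determinants on the extension itself means that any complement to the
  -- `ℓ`-group `πE.ker` gives a lift with the right determinant.
  let E : Subgroup (GL (Fin n) R) := ρ.range.comap π ⊓ teichDet n R
  let πE : E →* GL (Fin n) Q := π.comp E.subtype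
  have hker : ∀ x : πE.ker, (x : E).1 ∈ congSubgroup n (RingHom.ker q.toRingHom) := fun x => by
    have h : π x.1.1 = π 1 := (MonoidHom.mem_ker.1 x.2).trans (map_one π).symm
    simpa using (map_eq_map_iff_ker q).1 h
  let ι : πE.ker → congSubgroup n (RingHom.ker q.toRingHom) := fun x => ⟨x.1.1, hker x⟩
  have hι : Function.Injective ι := fun x y h => Subtype.ext (Subtype.ext (congrArg (·.1) h))
  have := finite_congSubgroup (n := n) hJ
  have : Finite πE.ker := Finite.of_injective ι hι
  have hp : IsPGroup ℓ πE.ker := fun x => by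
    obtain ⟨k, hk⟩ := isPGroup_congSubgroup (n := n) hJ q.ker_le_m (ι x)
    exact ⟨k, Subtype.ext (Subtype.ext (congrArg (·.1) hk))⟩
  obtain ⟨a, ha⟩ := IsPGroup.iff_card.1 hp
  have hidx : πE.ker.index ∣ Nat.card ρ.range := by
    rw [Subgroup.index_ker]
    refine Subgroup.card_dvd_of_le ?_
    rintro _ ⟨x, rfl⟩
    exact x.2.1
  have hcop : (Nat.card πE.ker).Coprime πE.ker.index := by
    rw [ha]
    exact Nat.Coprime.pow_left _ (Nat.Coprime.coprime_dvd_right hidx hcard.symm)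
  obtain ⟨C, hC⟩ := Subgroup.exists_right_complement'_of_coprime hcop
  have hinj : ∀ x ∈ C, ∀ y ∈ C, πE x = πE y → x = y := fun x hx y hy h => by
    have h1 : x * y⁻¹ ∈ πE.ker := by
      rw [MonoidHom.mem_ker, map_mul, map_inv, h, mul_inv_cancel]
    exact mul_inv_eq_one.1 (Subgroup.disjoint_def.1 hC.disjoint h1 (mul_mem hx (inv_mem hy)))
  have hex : ∀ g, ∃ x ∈ C, πE x = ρ g := fun g => by
    obtain ⟨A, hA, e⟩ := exists_mem_teichDet q hq (hdet g)
    let x : E := ⟨A, ⟨g, e.symm⟩, hA⟩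
    obtain ⟨⟨y, z⟩, hyz⟩ := hC.2 x
    refine ⟨z, z.2, ?_⟩
    have h1 := congrArg πE hyz
    change πE (y.1 * z.1) = _ at h1
    rw [map_mul, MonoidHom.mem_ker.1 y.2, one_mul] at h1
    exact h1.trans e
  choose s hsC hs using hex
  let s' : G →* E := MonoidHom.mk' s fun g h =>
    hinj _ (hsC _) _ (mul_mem (hsC _) (hsC _)) (by rw [hs, map_mul, map_mul, hs, hs])
  refine ⟨E.subtype.comp s', hs, fun g => (s g).2.2, fun g hg => ?_⟩
  have : s g = 1 := hinj _ (hsC _) _ (one_mem _) (by rw [hs, hg, map_one])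
  exact congrArg Subtype.val this

/-- Two such lifts are conjugate. -/
theorem exists_conj_of_coprime [CharP F ℓ] {J : Ideal R} (hJ : R.m * J = ⊥)
    (hJm : J ≤ R.m) {Γ : Type*} [Group Γ] (f : G →* Γ) [Finite f.range]
    (hcard : (Nat.card f.range).Coprime ℓ)
    {s t : G →* GL (Fin n) R} (hst : ∀ g, t g * (s g)⁻¹ ∈ congSubgroup n J)
    (hdet : ∀ g, (t g).1.det = (s g).1.det) (hs : ∀ g, f g = 1 → s g = 1)
    (ht : ∀ g, f g = 1 → t g = 1) :
    ∃ U ∈ congSubgroup n J, U.1.det = 1 ∧ ∀ g, t g * U = U * s g := by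
  classical
  have := Fintype.ofFinite f.range
  have hJJ : ∀ x ∈ J, ∀ y ∈ J, x * y = 0 := fun x hx y hy =>
    R.mul_eq_zero_of_mem hJ (hJm hx) hy
  obtain ⟨e, he⟩ := (R.isUnit_natCast hcard).exists_left_inv
  choose σ hσ using fun x : f.range => x.2
  let w : G → Matrix (Fin n) (Fin n) R := fun g => (t g).1 * ((s g)⁻¹).1
  have hw : ∀ g i j, (w g - 1) i j ∈ J := fun g i j => mem_congSubgroup.1 (hst g) i j
  have hwtr : ∀ g, (w g - 1).trace = 0 := fun g => by
    have h := det_one_add_eq hJJ (hw g)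
    have hd : (1 + (w g - 1)).det = 1 := by
      rw [add_sub_cancel, Matrix.det_mul, hdet, ← Matrix.det_mul, ← Units.val_mul, mul_inv_cancel,
        Units.val_one, Matrix.det_one]
    rw [hd] at h
    exact left_eq_add.1 h
  have hdep : ∀ g h, f g = f h → w g = w h := fun g h e => by
    have h1 : f (g⁻¹ * h) = 1 := by rw [map_mul, map_inv, e, inv_mul_cancel]
    have h2 := hs _ h1
    have h3 := ht _ h1
    rw [map_mul, map_inv, inv_mul_eq_one] at h2 h3
    simp only [w]
    rw [h2, h3]
  have hwmul : ∀ g h, (t g).1 * w h = w (g * h) * (s g).1 := fun g h => by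
    have h1 : ((s g)⁻¹).1 * (s g).1 = 1 := by
      rw [← Units.val_mul, inv_mul_cancel, Units.val_one]
    simp only [w]
    rw [map_mul, map_mul, mul_inv_rev, Units.val_mul, Units.val_mul]
    simp only [mul_assoc]
    rw [h1, mul_one]
  -- `1 + N` is the average of `t * s⁻¹` over the finite quotient, the usual intertwiner. In this
  -- form it is visibly congruent to `1`, and its determinant is `1 + trace N = 1`.
  let N : Matrix (Fin n) (Fin n) R := e • ∑ x, (w (σ x) - 1)
  have hN : ∀ i j, N i j ∈ J := fun i j => by
    refine J.mul_mem_left _ ?_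
    rw [Matrix.sum_apply]
    exact Ideal.sum_mem _ fun x _ => hw _ i j
  have hNtr : N.trace = 0 := by
    simp only [N]
    rw [Matrix.trace_smul, Matrix.trace_sum]
    simp [hwtr]
  have hdetU : (1 + N).det = 1 := by rw [det_one_add_eq hJJ hN, hNtr, add_zero]
  have hNw : 1 + N = e • ∑ x, w (σ x) := by
    simp only [N]
    rw [Finset.sum_sub_distrib, smul_sub, Finset.sum_const, Finset.card_univ,
      ← Nat.card_eq_fintype_card, ← Nat.cast_smul_eq_nsmul R, smul_smul, he, one_smul,
      add_sub_cancel]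
  obtain ⟨U, hU⟩ : IsUnit (1 + N) := (Matrix.isUnit_iff_isUnit_det _).2 (hdetU ▸ isUnit_one)
  refine ⟨U, mem_congSubgroup.2 fun i j => ?_, hU ▸ hdetU, fun g => Units.ext ?_⟩
  · rw [hU, Matrix.add_apply, add_sub_cancel_left]
    exact hN i j
  · rw [Units.val_mul, Units.val_mul, hU, hNw, Matrix.mul_smul, Matrix.smul_mul, Finset.mul_sum,
      Finset.sum_mul]
    congr 1
    let y : f.range := ⟨f g, g, rfl⟩
    rw [← Equiv.sum_comp (Equiv.mulLeft y) fun x => w (σ x) * (s g).1]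
    refine Finset.sum_congr rfl fun x _ => ?_
    rw [hwmul]
    congr 1
    refine hdep _ _ ?_
    rw [map_mul, hσ]
    exact (hσ (y * x)).symm

end Smoothness

/-- The pairs in `G × H` whose conjugation actions are compatible with `s` form a subgroup, so `(φ,
Φ)` brings all its powers along. -/
theorem conj_zpow_eq {H : Type*} [Group H] {G : Type*} [Group G] {I : Subgroup G} [I.Normal]
    (s : I →* H) (φ : G) (Φ : H)
    (h : ∀ i, Φ * s i * Φ⁻¹ = s (MulAut.conjNormal φ i)) (j : ℤ) (i : I) :
    Φ ^ j * s i * (Φ ^ j)⁻¹ = s (MulAut.conjNormal (φ ^ j) i) := by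
  let S : Subgroup (G × H) :=
    { carrier := {x | ∀ i, x.2 * s i * x.2⁻¹ = s (MulAut.conjNormal x.1 i)}
      one_mem' := by simp
      mul_mem' := fun {a b} ha hb i => by
        rw [Prod.fst_mul, map_mul, MulAut.mul_apply, ← ha, ← hb, Prod.snd_mul]
        group
      inv_mem' := fun {a} ha i => by
        have := ha (MulAut.conjNormal a.1⁻¹ i)
        rw [← MulAut.mul_apply, ← map_mul, mul_inv_cancel, map_one, MulAut.one_apply] at this
        rw [Prod.fst_inv, Prod.snd_inv, ← this]
        group }
  exact (zpow_mem (show (φ, Φ) ∈ S from h) j : (φ, Φ) ^ j ∈ S) i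

/-! ### Extending from inertia and a Frobenius to the whole group. -/

section Extension

variable {ℓ : ℕ} [Fact ℓ.Prime] {F : Type u} [Field F] {n : ℕ} {R Q : CNL ℓ F}

/-- The residue field is finite and the maximal ideal finitely generated. This gives the image of
the Frobenius matrix finite order modulo each power. -/
theorem finite_gl_quotient [Finite F] (R : CNL ℓ F) (k : ℕ) :
    Finite (GL (Fin n) (R ⧸ R.m ^ k)) := by
  have h1 : RingHom.ker R.residue = R.m := Ideal.ext fun x => R.mem_m_iff.symm
  have : Finite (R ⧸ R.m) := by
    rw [← h1]
    exact Finite.of_injective _ (RingHom.kerLift_injective R.residue)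
  have := Ideal.finite_quotient_pow (IsNoetherian.noetherian R.m) k
  infer_instance

/-- Matrices are determined by their images modulo `m ^ k` and in `Q`, if `m ^ k` meets the kernel
trivially. -/
theorem gl_eq_of_map_eq {q : R.Hom Q} {k : ℕ} (hk : R.m ^ k ⊓ RingHom.ker q.toRingHom = ⊥)
    {A B : GL (Fin n) R}
    (h₁ : Matrix.GeneralLinearGroup.map (Ideal.Quotient.mk (R.m ^ k)) A =
      Matrix.GeneralLinearGroup.map (Ideal.Quotient.mk (R.m ^ k)) B)
    (h₂ : Matrix.GeneralLinearGroup.map q.toRingHom A =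
      Matrix.GeneralLinearGroup.map q.toRingHom B) : A = B := by
  refine Units.ext (Matrix.ext fun i j => sub_eq_zero.1 ?_)
  have h : A.1 i j - B.1 i j ∈ R.m ^ k ⊓ RingHom.ker q.toRingHom :=
    ⟨map_mk_eq_iff.1 h₁ i j, (map_eq_map_iff q.toRingHom).1 h₂ i j⟩
  rwa [hk] at h

/-- Lift `q x` to `y ∈ m ^ l`; then `x - y` lies in `m ^ k ⊓ ker q = ⊥`. Beyond level `k`,
continuity over `R` can thus be tested over `Q`. -/
theorem mem_pow_of_map_mem {q : R.Hom Q} (hq : Function.Surjective q.toRingHom) {k l : ℕ}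
    (hk : R.m ^ k ⊓ RingHom.ker q.toRingHom = ⊥) (hkl : k ≤ l) {x : R} (hx : x ∈ R.m ^ k)
    (hqx : q.toRingHom x ∈ Q.m ^ l) : x ∈ R.m ^ l := by
  obtain ⟨y, hy, e⟩ := q.exists_mem_pow hq hqx
  have h : x - y ∈ R.m ^ k ⊓ RingHom.ker q.toRingHom :=
    ⟨sub_mem hx (Ideal.pow_le_pow_right hkl hy), by
      rw [SetLike.mem_coe, RingHom.mem_ker, map_sub, e, sub_self]⟩
  rw [hk, Submodule.mem_bot, sub_eq_zero] at h
  rwa [h]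

variable {G : Type v} [Group G] [TopologicalSpace G] [IsTopologicalGroup G]
  {ρbar : G →* GL (Fin n) F} {I : Subgroup G} [I.Normal] {φ : G}

/-- A lift of a minimal lift, from compatible lifts of its restriction to `I` and of the image of a
free generator. -/
theorem exists_minimalLift_of_generator [Finite F] (hcont : IsOpen (ρbar.ker : Set G))
    (hφ : IsFreeGenerator φ I)
    (q : R.Hom Q) (hq : Function.Surjective q.toRingHom)
    (hJ : R.m * RingHom.ker q.toRingHom = ⊥) {ρ : G →* GL (Fin n) Q} (hρ : IsLift ρbar ρ)
    {s : I →* GL (Fin n) R} {Φ : GL (Fin n) R}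
    (hqs : ∀ i, Matrix.GeneralLinearGroup.map q.toRingHom (s i) = ρ i)
    (hqΦ : Matrix.GeneralLinearGroup.map q.toRingHom Φ = ρ φ)
    (hsd : ∀ i, s i ∈ teichDet n R) (hΦd : Φ ∈ teichDet n R)
    (hs : ∀ i : I, ρbar i = 1 → s i = 1)
    (hconj : ∀ i, Φ * s i * Φ⁻¹ = s (MulAut.conjNormal φ i)) :
    ∃ ρ' ∈ minimalLifts ℓ ρbar I R, push q.toRingHom ρ' = ρ := by
  obtain ⟨k, hk1, hk⟩ := R.exists_pow_inf_eq_bot hJ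
  let κ := Matrix.GeneralLinearGroup.map (n := Fin n) (Ideal.Quotient.mk (R.m ^ k))
  let q' := Matrix.GeneralLinearGroup.map (n := Fin n) q.toRingHom
  have := finite_gl_quotient (n := n) R k
  -- With this product of orders, the class of `φ ^ j` modulo `U₀` determines both `Φ ^ j` modulo `m
  -- ^ k` and `ρbar (φ ^ j)`.
  obtain ⟨U₀, hU₀n, hU₀o, hIU₀, hfree⟩ := hφ.free (orderOf (κ Φ) * orderOf (ρbar φ))
    (Nat.mul_pos (orderOf_pos _) (orderOf_pos _))
  let U : Subgroup G := U₀ ⊓ (ρbar.ker ⊓ (congSubgroup n (Q.m ^ k)).comap ρ)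
  have hUo : IsOpen (U : Set G) :=
    hU₀o.inter (hcont.inter (isContinuousRep_iff.1 hρ.continuous k))
  have hUn : U.Normal := inferInstance
  let π := QuotientGroup.mk' U
  have hπ : ∀ a b : G, π a = π b ↔ a⁻¹ * b ∈ U := fun a b => QuotientGroup.eq
  have hπU : ∀ y ∈ U, π y = 1 := fun y hy => (QuotientGroup.eq_one_iff y).2 hy
  have hwd : ∀ (j j' : ℤ) (i i' : I), π (φ ^ j * i) = π (φ ^ j' * i') →
      κ (Φ ^ j * s i) = κ (Φ ^ j' * s i') := by
    intro j j' i i' h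
    rw [hπ] at h
    have h1 : φ ^ (-j + j') ∈ U₀ := by
      have := mul_mem (mul_mem (hIU₀ i.2) h.1) (inv_mem (hIU₀ i'.2))
      convert this using 1
      group
    have h2 := hfree _ h1
    have hΦ : κ (Φ ^ j) = κ (Φ ^ j') := by
      rw [map_zpow, map_zpow, ← orderOf_dvd_sub_iff_zpow_eq_zpow, ← dvd_neg, neg_sub,
        sub_eq_neg_add]
      exact (Int.natCast_dvd_natCast.2 (dvd_mul_right _ _)).trans h2
    have hφ' : ρbar (φ ^ j) = ρbar (φ ^ j') := by
      rw [map_zpow, map_zpow, ← orderOf_dvd_sub_iff_zpow_eq_zpow, ← dvd_neg, neg_sub,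
        sub_eq_neg_add]
      exact (Int.natCast_dvd_natCast.2 (dvd_mul_left _ _)).trans h2
    have h3 := MonoidHom.mem_ker.1 h.2.1
    rw [map_mul, map_inv, map_mul, map_mul, hφ', inv_mul_eq_one, mul_right_inj] at h3
    have h4 : s (i⁻¹ * i') = 1 := hs _ (by
      rw [Subgroup.coe_mul, Subgroup.coe_inv, map_mul, map_inv, h3, inv_mul_cancel])
    rw [map_mul, map_inv, inv_mul_eq_one] at h4
    rw [map_mul, map_mul, hΦ, h4]
  -- Since `m ^ k ⊓ ker q = ⊥`, a matrix over `R` is pinned down by its image in `Q` and its class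
  -- modulo `m ^ k`. The former is prescribed by `ρ`, the latter by any word `φ ^ j * i`
  -- representing `g` modulo `U`, so no limit over powers of `φ` is required.
  let Rel : G → GL (Fin n) R → Prop := fun g A =>
    q' A = ρ g ∧ ∃ (j : ℤ) (i : I), π g = π (φ ^ j * i) ∧ κ A = κ (Φ ^ j * s i)
  have huniq : ∀ g A A', Rel g A → Rel g A' → A = A' := by
    rintro g A A' ⟨h1, j, i, h2, h3⟩ ⟨h1', j', i', h2', h3'⟩
    refine gl_eq_of_map_eq hk ?_ (h1.trans h1'.symm)
    exact h3.trans ((hwd j j' i i' (h2.symm.trans h2')).trans h3'.symm)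
  have hmul : ∀ g h A B, Rel g A → Rel h B → Rel (g * h) (A * B) := by
    rintro g h A B ⟨h1, j, i, h2, h3⟩ ⟨h1', j', i', h2', h3'⟩
    refine ⟨by rw [map_mul, map_mul, h1, h1'], j + j', MulAut.conjNormal (φ ^ (-j')) i * i', ?_, ?_⟩
    · rw [map_mul, h2, h2', ← map_mul, Subgroup.coe_mul, MulAut.conjNormal_apply]
      congr 1
      group
    · rw [map_mul, h3, h3', ← map_mul, map_mul s, ← conj_zpow_eq s φ Φ hconj]
      congr 1
      group
  have hex : ∀ g, ∃ A, Rel g A := by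
    intro g
    have hIU : IsOpen ((I ⊔ U : Subgroup G) : Set G) := Subgroup.isOpen_mono le_sup_right hUo
    obtain ⟨j, hj⟩ := hφ.gen _ hIU le_sup_left g
    obtain ⟨i, hi, y, hy, e⟩ := Subgroup.mem_sup_of_normal_right.1 hj
    have hg : g = φ ^ j * i * y := by rw [mul_assoc, e, mul_inv_cancel_left]
    -- The error term `y ∈ U` has `ρ y ≡ 1` modulo the `k`-th power, so `ρ y` lifts to a matrix `C ≡
    -- 1` modulo `m ^ k`, which corrects the image in `Q` only.
    have hy' := mem_congSubgroup.1 (Subgroup.mem_comap.1 hy.2.2)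
    choose X hX hqX using fun a b => q.exists_mem_pow hq (hy' a b)
    obtain ⟨C, hC, hqC⟩ := exists_gl_map_eq q.toRingHom (ρ y) (1 + Matrix.of X) fun a b => by
      rw [Matrix.add_apply, map_add, one_apply_map, Matrix.of_apply, hqX, add_sub_cancel]
    have hκC : κ C = 1 := MonoidHom.mem_ker.1 (mem_congSubgroup.2 fun a b => by
      rw [hC, Matrix.add_apply, add_sub_cancel_left]
      exact hX a b)
    refine ⟨Φ ^ j * s ⟨i, hi⟩ * C, ?_, j, ⟨i, hi⟩, ?_, ?_⟩
    · rw [map_mul, map_mul, map_zpow, hg, map_mul, map_mul, map_zpow]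
      exact congrArg₂ _ (congrArg₂ _ (congrArg (· ^ j) hqΦ) (hqs _)) hqC
    · rw [hg, map_mul π, hπU y hy, mul_one]
    · rw [map_mul, hκC, mul_one]
  choose A hA using hex
  let ρ' : G →* GL (Fin n) R := MonoidHom.mk' A fun g h =>
    huniq _ _ _ (hA _) (hmul _ _ _ _ (hA g) (hA h))
  have hqρ' : push q.toRingHom ρ' = ρ := MonoidHom.ext fun g => (hA g).1
  have hres : ∀ g, Matrix.GeneralLinearGroup.map R.residue (ρ' g) = ρbar g := fun g => by
    rw [← map_residue_map q, ← hρ.residue_apply, ← hqρ']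
    rfl
  refine ⟨ρ', mem_minimalLifts_iff.2 ⟨⟨isContinuousRep_iff.2 fun l => ?_, MonoidHom.ext hres,
    fun g => ?_⟩, fun g hg h1 => ?_⟩, hqρ'⟩
  · refine Subgroup.isOpen_mono (H₁ := U ⊓ (congSubgroup n (Q.m ^ (max k l))).comap ρ)
      (fun g hg => ?_) (hUo.inter (isContinuousRep_iff.1 hρ.continuous _))
    rw [Subgroup.mem_comap]
    obtain ⟨h1, j, i, h2, h3⟩ := hA g
    have h4 := hwd j 0 i 1 (by
      rw [← h2, hπU g hg.1]
      simp)
    have h5 : A g ∈ congSubgroup n (R.m ^ k) := by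
      change κ (A g) = 1
      rw [h3, h4]
      simp
    rw [mem_congSubgroup] at h5 ⊢
    have h6 := mem_congSubgroup.1 (Subgroup.mem_comap.1 hg.2)
    intro a b
    refine Ideal.pow_le_pow_right (le_max_right k l)
      (mem_pow_of_map_mem hq hk (le_max_left k l) (h5 a b) ?_)
    rw [map_sub, one_apply_map]
    have h7 : q.toRingHom ((A g).1 a b) = (ρ g).1 a b :=
      congrArg (fun C : GL (Fin n) Q => C.1 a b) h1
    change q.toRingHom ((A g).1 a b) - _ ∈ _
    rw [h7]
    exact h6 a b
  · obtain ⟨-, j, i, h2, h3⟩ := hA g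
    have hB : Φ ^ j * s i ∈ teichDet n R := mul_mem (zpow_mem hΦd j) (hsd i)
    have hAB : ∀ a b, (A g).1 a b - (Φ ^ j * s i).1 a b ∈ R.m ^ k := map_mk_eq_iff.1 h3
    have hB' : Matrix.GeneralLinearGroup.map R.residue (Φ ^ j * s i) = ρbar g := by
      rw [← hres g]
      exact ((map_eq_map_iff R.residue).2 fun a b =>
        R.mem_m_iff.1 (Ideal.pow_le_self (by omega) (hAB a b))).symm
    rw [mem_teichDet, hB'] at hB
    refine sub_eq_zero.1 ?_
    have hmem : (A g).1.det - R.teich (ρbar g).1.det ∈ R.m ^ k ⊓ RingHom.ker q.toRingHom := by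
      refine ⟨?_, ?_⟩
      · rw [← hB, SetLike.mem_coe, ← Ideal.Quotient.eq, RingHom.map_det, RingHom.map_det]
        exact congrArg (fun C => Matrix.det (Units.val C)) h3
      · rw [SetLike.mem_coe, RingHom.mem_ker, map_sub, sub_eq_zero, q.map_teich, ← hρ.det_eq,
          RingHom.map_det]
        exact congrArg (fun C => Matrix.det (Units.val C)) (hA g).1
    rw [hk] at hmem
    exact hmem
  · refine huniq g _ _ (hA g) ⟨?_, 0, ⟨g, hg⟩, ?_, ?_⟩
    · rw [map_one, ← hqs ⟨g, hg⟩, hs ⟨g, hg⟩ h1, map_one]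
    · simp
    · rw [hs ⟨g, hg⟩ h1]
      simp

omit [IsTopologicalGroup G] [I.Normal] in
-- A minimal lift has the same kernel on `I` as `ρbar`; this transfers coprimality with `ℓ` to its
-- image.
theorem card_range_comp_subtype {ρ : G →* GL (Fin n) Q} (hρ : ρ ∈ minimalLifts ℓ ρbar I Q) :
    Nat.card (ρ.comp I.subtype).range = Nat.card (I.map ρbar) := by
  have h1 : (ρbar.comp I.subtype).range = I.map ρbar := by
    rw [MonoidHom.range_comp, Subgroup.range_subtype]
  rw [mem_minimalLifts_iff] at hρ
  rw [← h1, ← Subgroup.index_ker, ← Subgroup.index_ker]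
  congr 1
  ext i
  rw [MonoidHom.mem_ker, MonoidHom.mem_ker]
  refine ⟨fun h => ?_, fun h => hρ.2 i i.2 h⟩
  rw [MonoidHom.comp_apply, ← hρ.1.residue_apply]
  exact (congrArg _ h).trans (map_one _)

omit [IsTopologicalGroup G] in
theorem IsLift.mem_teichDet {ρ : G →* GL (Fin n) Q} (hρ : IsLift ρbar ρ) (g : G) :
    ρ g ∈ teichDet n Q := by
  rw [LocalDef.mem_teichDet, hρ.residue_apply, hρ.det_eq]

/-- The minimal lifts form a smooth functor. -/
theorem exists_minimalLift_map_eq [Finite F] [CharP F ℓ] (hcont : IsOpen (ρbar.ker : Set G))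
    (hφ : IsFreeGenerator φ I) (hI : (Nat.card (I.map ρbar)).Coprime ℓ)
    (q : R.Hom Q) (hq : Function.Surjective q.toRingHom)
    (hJ : R.m * RingHom.ker q.toRingHom = ⊥) {ρ : G →* GL (Fin n) Q}
    (hρ : ρ ∈ minimalLifts ℓ ρbar I Q) :
    ∃ ρ' ∈ minimalLifts ℓ ρbar I R, push q.toRingHom ρ' = ρ := by
  obtain ⟨s, hqs, hsd, hs⟩ := exists_lift_of_coprime q hq hJ (ρ.comp I.subtype)
    (by rwa [card_range_comp_subtype hρ]) fun i => ((mem_minimalLifts_iff.1 hρ).1.mem_teichDet _)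
  obtain ⟨hlift, hker⟩ := mem_minimalLifts_iff.1 hρ
  obtain ⟨Φ₀, hΦ₀d, hqΦ₀⟩ := exists_mem_teichDet q hq (hlift.mem_teichDet φ)
  let f : I →* GL (Fin n) F := ρbar.comp I.subtype
  have hs' : ∀ i, f i = 1 → s i = 1 := fun i hi => hs i (hker i i.2 hi)
  -- Over `Q`, `ρ φ` conjugates `ρ|I` as `φ` does, so `s` and its twist `t` lift the same
  -- representation. The matrix `U` conjugating one to the other turns `Φ₀` into the required `Φ₀ *
  -- U`.
  let t : I →* GL (Fin n) R :=
    (MulAut.conj Φ₀⁻¹).toMonoidHom.comp (s.comp (MulAut.conjNormal φ).toMonoidHom)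
  have ht : ∀ i, t i = Φ₀⁻¹ * s (MulAut.conjNormal φ i) * Φ₀ := fun i => by
    simp [t]
  have htd : ∀ i, t i ∈ teichDet n R := fun i => by
    rw [ht]
    exact mul_mem (mul_mem (inv_mem hΦ₀d) (hsd _)) hΦ₀d
  have hqt : ∀ i, Matrix.GeneralLinearGroup.map q.toRingHom (t i) =
      Matrix.GeneralLinearGroup.map q.toRingHom (s i) := fun i => by
    rw [ht, map_mul, map_mul, map_inv, hqs, hqs, hqΦ₀]
    simp only [MonoidHom.comp_apply, Subgroup.subtype_apply, MulAut.conjNormal_apply, map_mul,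
      map_inv]
    group
  have : Finite f.range := inferInstance
  have hfr : f.range = I.map ρbar := by
    rw [MonoidHom.range_comp, Subgroup.range_subtype]
  obtain ⟨U, hU, hUdet, hconj⟩ := exists_conj_of_coprime hJ q.ker_le_m f (by rwa [hfr])
    (s := s) (t := t) (fun i => (map_eq_map_iff_ker q).1 (hqt i)) (fun i => by
      rw [mem_teichDet.1 (htd i), mem_teichDet.1 (hsd i), ← map_residue_map q, hqt,
        map_residue_map]) hs' fun i hi => by
      rw [ht, hs' _ ?_]
      · group
      · have : ρbar i = 1 := hi
        change ρbar (MulAut.conjNormal φ i : I) = 1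
        rw [MulAut.conjNormal_apply, map_mul, map_mul, this, mul_one, map_inv, mul_inv_cancel]
  have hqU : Matrix.GeneralLinearGroup.map q.toRingHom U = 1 := by
    rw [← map_one (Matrix.GeneralLinearGroup.map q.toRingHom), map_eq_map_iff_ker]
    simpa using hU
  refine exists_minimalLift_of_generator hcont hφ q hq hJ hlift (s := s) (Φ := Φ₀ * U) hqs
    (by rw [map_mul, hqΦ₀, hqU, mul_one]) hsd (mul_mem hΦ₀d ?_) hs' fun i => ?_
  · rw [mem_teichDet, hUdet, ← map_residue_map q, hqU, map_one, Units.val_one, Matrix.det_one,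
      R.teich_one]
  · have h := hconj i
    rw [ht] at h
    rw [mul_assoc Φ₀, ← h]
    group

end Extension

/-! ### The integral closure of the ring of integers is local -/

section IntegralClosure

open Polynomial

/-- If the norm of `x` exceeds `1`, the leading term dominates a monic equation over `O`.
Conversely, norm at most `1` bounds every coefficient of the minimal polynomial, which therefore has
coefficients in `O`. -/
theorem mem_integralClosure_iff_spectralNorm_le_one {K : Type*} [NontriviallyNormedField K]
    [IsUltrametricDist K] [CompleteSpace K] (O : Subring K) (hO : ∀ x, x ∈ O ↔ ‖x‖ ≤ 1)
    {L : Type*} [Field L] [Algebra K L] [Algebra.IsAlgebraic K L] (x : L) :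
    x ∈ integralClosure O L ↔ spectralNorm K L x ≤ 1 := by
  constructor
  · rintro ⟨f, hf, hx⟩
    have h1 : ∀ y : L, spectralNorm K L y = spectralMulAlgNorm K L y := fun _ => rfl
    by_contra! hlt
    have hpos : 0 < spectralNorm K L x := zero_lt_one.trans hlt
    let g : O →+* L := algebraMap O L
    have hg : ∀ a : O, spectralNorm K L (g a) ≤ 1 := fun a => by
      have : g a = algebraMap K L a := rfl
      rw [this, spectralNorm_extends]
      exact (hO a).1 a.2
    have hna := isNonarchimedean_spectralNorm (K := K) (L := L)
    rw [eval₂_eq_sum_range, Finset.sum_range_succ, hf.coeff_natDegree, map_one, one_mul] at hx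
    have hsum : ∀ d ≤ f.natDegree, 0 < d →
        spectralNorm K L (∑ i ∈ Finset.range d, g (f.coeff i) * x ^ i) ≤
          spectralNorm K L x ^ (d - 1) := by
      intro d
      induction d with
      | zero => intro _ h; omega
      | succ d ih =>
        intro hd _
        rw [Finset.sum_range_succ]
        have hterm : spectralNorm K L (g (f.coeff d) * x ^ d) ≤ spectralNorm K L x ^ d := by
          rw [h1, map_mul, map_pow, ← h1, ← h1]
          exact mul_le_of_le_one_left (pow_nonneg hpos.le _) (hg _)
        rcases d with - | d
        · simpa using hterm
        · refine (hna _ _).trans (max_le ((ih (by omega) (by omega)).trans ?_) hterm)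
          exact pow_le_pow_right₀ hlt.le (by omega)
    rcases Nat.eq_zero_or_pos f.natDegree with h0 | h0
    · rw [h0] at hx
      simp at hx
    · have h2 : spectralNorm K L x ^ f.natDegree ≤ spectralNorm K L x ^ (f.natDegree - 1) := by
        have h3 := hsum _ le_rfl h0
        rw [eq_neg_of_add_eq_zero_left hx, h1, map_neg_eq_map, map_pow, ← h1] at h3
        exact h3
      exact absurd h2 (not_le.2 (pow_lt_pow_right₀ hlt (by omega)))
  · intro h
    have hmon := minpoly.monic (Algebra.IsIntegral.isIntegral (R := K) x)
    have hc := (spectralValue_le_one_iff hmon).1 h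
    have hl : minpoly K x ∈ lifts O.subtype := by
      rw [lifts_iff_coeff_lifts]
      exact fun i => ⟨⟨_, (hO _).2 (hc i)⟩, rfl⟩
    obtain ⟨f, hf, -, hfm⟩ := lifts_and_natDegree_eq_and_monic hl hmon
    refine ⟨f, hfm, ?_⟩
    have h2 := minpoly.aeval K x
    rw [← hf, aeval_def, eval₂_map] at h2
    exact h2

/-- The spectral norm is multiplicative, so the nonunits are the elements of norm below `1`; the
ultrametric inequality closes them under addition. -/
theorem isLocalRing_integralClosure_of_norm {K : Type*} [NontriviallyNormedField K]
    [IsUltrametricDist K] [CompleteSpace K] (O : Subring K) (hO : ∀ x, x ∈ O ↔ ‖x‖ ≤ 1)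
    (L : Type*) [Field L] [Algebra K L] [Algebra.IsAlgebraic K L] :
    IsLocalRing (integralClosure O L) := by
  have hmem := mem_integralClosure_iff_spectralNorm_le_one O hO (L := L)
  have h1 : ∀ y : L, spectralNorm K L y = spectralMulAlgNorm K L y := fun _ => rfl
  have hunit : ∀ x : integralClosure O L, IsUnit x ↔ ¬ spectralNorm K L x.1 < 1 := by
    intro x
    constructor
    · intro hx hlt
      obtain ⟨y, hy⟩ := hx.exists_right_inv
      have h2 := congrArg (fun z : integralClosure O L => spectralNorm K L z.1) hy
      have h3 : spectralNorm K L x.1 * spectralNorm K L y.1 = 1 := by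
        rw [h1, h1, ← map_mul]
        exact h2.trans spectralNorm_one
      have h4 := (hmem _).1 y.2
      exact h3.not_lt (mul_lt_one_of_nonneg_of_lt_one_left
        (apply_nonneg (spectralMulAlgNorm K L) x.1) hlt h4)
    · intro hx
      have h2 : spectralNorm K L x.1 = 1 := le_antisymm ((hmem _).1 x.2) (not_lt.1 hx)
      have hx0 : x.1 ≠ 0 := fun h0 => by
        rw [h0, spectralNorm_zero] at h2
        exact zero_ne_one h2
      have h3 : spectralNorm K L x.1⁻¹ = 1 := by
        rw [h1, map_inv₀, ← h1, h2, inv_one]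
      exact .of_mul_eq_one ⟨x.1⁻¹, (hmem _).2 h3.le⟩ (Subtype.ext (mul_inv_cancel₀ hx0))
  refine IsLocalRing.of_nonunits_add fun a b ha hb => ?_
  rw [mem_nonunits_iff, hunit, not_not] at *
  exact (isNonarchimedean_spectralNorm a.1 b.1).trans_lt (max_lt ha hb)

variable (K : Type v) [Field K] [ValuativeRel K] [TopologicalSpace K]
  [IsNonarchimedeanLocalField K]

open ValuativeRel in
theorem isLocalRing_intClosure (L : Type w) [Field L] [Algebra K L] [Algebra.IsAlgebraic K L] :
    IsLocalRing (intClosure K L) := by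
  let := IsTopologicalAddGroup.rightUniformSpace K
  have := isUniformAddGroup_of_addCommGroup (G := K)
  -- A real embedding of the value group turns the valuation into a norm; all that is used of it is
  -- that its unit ball is the ring of integers.
  let : (Valued.v (R := K)).RankOne :=
    { hom' := IsRankLeOne.nonempty.some.emb (R := K).comp MonoidWithZeroHom.ValueGroup₀.embedding
      strictMono' := IsRankLeOne.nonempty.some.strictMono.comp
        MonoidWithZeroHom.ValueGroup₀.embedding_strictMono }
  open scoped Valued in
  exact isLocalRing_integralClosure_of_norm (intRing K)
    (fun x => by
      rw [Valued.toNormedField.norm_le_one_iff, Valuation.mem_integer_iff,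
        IsValuativeTopology.v_eq_valuation]) L

end IntegralClosure

/-! ### Constants and Frobenius elements -/

section Constants

open Polynomial

/-- The elements with `a ^ (p ^ m) = a`. -/
def constField (p : ℕ) (L : Type*) [Field L] [ExpChar L p] (m : ℕ) : Subfield L :=
  RingHom.eqLocusField (iterateFrobenius L p m) (RingHom.id L)

theorem mem_constField {p : ℕ} {L : Type*} [Field L] [ExpChar L p] {m : ℕ} {a : L} :
    a ∈ constField p L m ↔ a ^ p ^ m = a := Iff.rfl

variable {p : ℕ} [hp : Fact p.Prime]

omit hp in
theorem constField_le {L : Type*} [Field L] [ExpChar L p] {m m' : ℕ} (h : m ∣ m') :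
    constField p L m ≤ constField p L m' := by
  obtain ⟨k, rfl⟩ := h
  intro a ha
  rw [mem_constField] at *
  induction k with
  | zero => simp
  | succ k ih => rw [Nat.mul_succ, pow_add, pow_mul, ih, ha]

/-- `X ^ p ^ m - X` is separable, so over a separably closed field it has as many roots as its
degree. -/
theorem card_constField {L : Type*} [Field L] [CharP L p] [IsSepClosed L] {m : ℕ} (hm : 0 < m) :
    Nat.card (constField p L m) = p ^ m := by
  have hdvd : p ∣ p ^ m := dvd_pow_self p hm.ne'
  have hsep : (X ^ p ^ m - X : L[X]).Separable := galois_poly_separable p _ hdvd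
  have h1 : 1 < p ^ m := Nat.one_lt_pow hm.ne' hp.out.one_lt
  have hcard := card_rootSet_eq_natDegree (K := L) hsep
    (by
        rw [Algebra.algebraMap_self, Polynomial.map_id]
        exact IsSepClosed.splits_of_separable _ hsep)
  rw [FiniteField.X_pow_card_sub_X_natDegree_eq L h1, ← Nat.card_eq_fintype_card] at hcard
  rw [← hcard]
  refine Nat.card_congr (Equiv.setCongr ?_)
  ext a
  rw [mem_rootSet, SetLike.mem_coe, mem_constField]
  simp [sub_eq_zero, FiniteField.X_pow_card_sub_X_ne_zero L h1]

theorem finite_constField {L : Type*} [Field L] [CharP L p] [IsSepClosed L] {m : ℕ} (hm : 0 < m) :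
    Finite (constField p L m) := by
  refine Nat.finite_of_card_ne_zero ?_
  rw [card_constField hm]
  exact (pow_pos hp.out.pos m).ne'

/-- Over a finite field with `q` elements, all solutions of `y ^ q = y` are constants. -/
theorem exists_map_eq_of_pow_card_eq {E : Type*} [Field E] [Finite E] {κ : Type*} [Field κ]
    (f : E →+* κ) {y : κ} (hy : y ^ Nat.card E = y) : ∃ a, f a = y := by
  classical
  have := Fintype.ofFinite E
  have h1 : 1 < Nat.card E := Finite.one_lt_card
  have hne := FiniteField.X_pow_card_sub_X_ne_zero κ h1
  have hroot : ∀ z : κ, z ∈ (X ^ Nat.card E - X : κ[X]).roots.toFinset ↔ z ^ Nat.card E = z := by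
    intro z
    rw [Multiset.mem_toFinset, mem_roots hne]
    simp [sub_eq_zero]
  have hsub : Finset.univ.image f ⊆ (X ^ Nat.card E - X : κ[X]).roots.toFinset := by
    intro z hz
    obtain ⟨a, -, rfl⟩ := Finset.mem_image.1 hz
    rw [hroot, ← map_pow, Nat.card_eq_fintype_card, FiniteField.pow_card]
  have heq := Finset.eq_of_subset_of_card_le hsub (by
    rw [Finset.card_image_of_injective _ f.injective, Finset.card_univ, ← Nat.card_eq_fintype_card]
    refine (Multiset.toFinset_card_le _).trans ((card_roots' _).trans ?_)
    rw [FiniteField.X_pow_card_sub_X_natDegree_eq κ h1])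
  have hy' := (hroot y).2 hy
  rw [← heq] at hy'
  obtain ⟨a, -, ha⟩ := Finset.mem_image.1 hy'
  exact ⟨a, ha⟩

theorem exists_generator {E : Type*} [Field E] [Finite E] :
    ∃ ζ : E, ∀ x, x = 0 ∨ ∃ i : ℕ, x = ζ ^ i := by
  obtain ⟨g, hg⟩ := IsCyclic.exists_monoid_generator (α := Eˣ)
  refine ⟨g, fun x => ?_⟩
  rcases eq_or_ne x 0 with h | h
  · exact Or.inl h
  · obtain ⟨i, hi⟩ := hg (Units.mk0 x h)
    exact Or.inr ⟨i, by rw [← Units.val_pow_eq_pow_val]; exact (congrArg Units.val hi).symm⟩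

variable {K : Type*} [Field K] {L : Type*} [Field L] [Algebra K L] [CharP L p]
  [IsSepClosed L]

omit [IsSepClosed L] in
theorem apply_mem_constField (σ : L ≃ₐ[K] L) {m : ℕ} {a : L} (ha : a ∈ constField p L m) :
    σ a ∈ constField p L m := by
  rw [mem_constField] at *
  rw [← map_pow, ha]

theorem exists_constField_generator {m : ℕ} (hm : 0 < m) :
    ∃ ζ ∈ constField p L m, ∀ x ∈ constField p L m, x = 0 ∨ ∃ i : ℕ, x = ζ ^ i := by
  have := finite_constField (p := p) (L := L) hm
  obtain ⟨ζ, hζ⟩ := exists_generator (E := constField p L m)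
  refine ⟨ζ, ζ.2, fun x hx => ?_⟩
  rcases hζ ⟨x, hx⟩ with h | ⟨i, h⟩
  · exact Or.inl (congrArg Subtype.val h)
  · exact Or.inr ⟨i, congrArg Subtype.val h⟩

variable {r : ℕ}

/-- An automorphism acting as the `q`-power map on a given finite field of constants. -/
theorem exists_algEquiv_apply_eq_pow [Normal K L]
    (hK : ∀ c : K, ∀ m, 0 < m → c ^ p ^ m = c → c ^ p ^ r = c) {m : ℕ} (hm : 0 < m) :
    ∃ σ : L ≃ₐ[K] L, ∀ x ∈ constField p L m, σ x = x ^ p ^ r := by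
  obtain ⟨ζ, hζ, hgen⟩ := exists_constField_generator (p := p) (L := L) hm
  have hint : IsIntegral K ζ := Normal.isIntegral inferInstance ζ
  have h1 : 1 < p ^ m := Nat.one_lt_pow hm.ne' hp.out.one_lt
  set P := minpoly K ζ
  have hdvd : P ∣ X ^ p ^ m - X := minpoly.dvd _ _ (by simp [mem_constField.1 hζ])
  have hroots : ∀ a ∈ (P.map (algebraMap K L)).roots, a ^ p ^ m = a := by
    intro a ha
    have h2 := (mem_roots'.1 ha).2
    rw [IsRoot.def, eval_map_algebraMap] at h2
    have h3 := aeval_eq_zero_of_dvd_aeval_eq_zero hdvd h2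
    simpa [sub_eq_zero] using h3
  have hsplit : (P.map (algebraMap K L)).Splits := Normal.splits inferInstance ζ
  -- All roots of `P` are constants, so its coefficients are constants of `K` and are fixed by the
  -- `p ^ r`-power map. Hence `ζ ^ p ^ r` is again a root, and conjugacy of roots yields the
  -- automorphism.
  have hfix : (P.map (algebraMap K L)).map (iterateFrobenius L p m) = P.map (algebraMap K L) := by
    have hmon : (P.map (algebraMap K L)).Monic := (minpoly.monic hint).map _
    conv_lhs => rw [hsplit.eq_prod_roots_of_monic hmon]
    conv_rhs => rw [hsplit.eq_prod_roots_of_monic hmon]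
    rw [Polynomial.map_multiset_prod, Multiset.map_map]
    congr 1
    refine Multiset.map_congr rfl fun a ha => ?_
    simp only [Function.comp_apply, Polynomial.map_sub, map_X, map_C, iterateFrobenius_def,
      hroots a ha]
  have hcoeff : ∀ i, (P.coeff i) ^ p ^ r = P.coeff i := by
    intro i
    refine hK _ m hm ((algebraMap K L).injective ?_)
    have := congrArg (fun Q => Polynomial.coeff Q i) hfix
    simpa only [coeff_map, iterateFrobenius_def, ← map_pow] using this
  have hroot : aeval (ζ ^ p ^ r) P = 0 := by
    have h2 : (iterateFrobenius L p r) (eval₂ (algebraMap K L) ζ P) = 0 := by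
      rw [← aeval_def, minpoly.aeval, map_zero]
    rw [hom_eval₂, eval₂_eq_sum_range] at h2
    rw [aeval_def, eval₂_eq_sum_range, ← h2]
    refine Finset.sum_congr rfl fun i _ => ?_
    rw [RingHom.comp_apply, iterateFrobenius_def, iterateFrobenius_def, ← map_pow, hcoeff]
  obtain ⟨σ, hσ⟩ := minpoly.exists_algEquiv_of_root hint.isAlgebraic hroot
  refine ⟨σ.symm, fun x hx => ?_⟩
  have h2 : σ.symm ζ = ζ ^ p ^ r := (AlgEquiv.symm_apply_eq σ).2 hσ.symm
  rcases hgen x hx with rfl | ⟨i, rfl⟩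
  · rw [map_zero, zero_pow (pow_pos hp.out.pos r).ne']
  · rw [map_pow, h2, ← pow_mul, ← pow_mul, mul_comm]

/-- Every automorphism acts on a given finite field of constants as an iterate of the `q`-power
map. -/
theorem exists_apply_eq_pow_pow (hL : ∀ x : L, x ^ p ^ r = x → ∃ c : K, algebraMap K L c = x)
    {m : ℕ} (hm : 0 < m) (σ : L ≃ₐ[K] L) :
    ∃ j : ℕ, ∀ x ∈ constField p L m, σ x = x ^ (p ^ r) ^ j := by
  obtain ⟨ζ, hζ, hgen⟩ := exists_constField_generator (p := p) (L := L) hm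
  -- The roots of `P` run through the Frobenius orbit of `ζ`, which closes up after `m` steps. So
  -- `P` has coefficients in `K`, and `σ` must send `ζ` to another root.
  let P : L[X] := ∏ j ∈ Finset.range m, (X - C (ζ ^ (p ^ r) ^ j))
  have hζm : ζ ^ (p ^ r) ^ m = ζ := by
    rw [← pow_mul]
    exact constField_le (dvd_mul_left m r) hζ
  have hfix : P.map (iterateFrobenius L p r) = P := by
    have h1 : P.map (iterateFrobenius L p r) =
        ∏ j ∈ Finset.range m, (X - C (ζ ^ (p ^ r) ^ (j + 1))) := by
      simp only [P]
      rw [Polynomial.map_prod]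
      refine Finset.prod_congr rfl fun j _ => ?_
      rw [Polynomial.map_sub, map_X, map_C, iterateFrobenius_def, ← pow_mul, ← pow_succ]
    have h2 := (Finset.prod_range_succ' (fun j => (X - C (ζ ^ (p ^ r) ^ j) : L[X])) m).symm.trans
      (Finset.prod_range_succ (fun j => (X - C (ζ ^ (p ^ r) ^ j) : L[X])) m)
    rw [hζm, pow_zero, pow_one] at h2
    rw [h1]
    exact mul_right_cancel₀ (X_sub_C_ne_zero ζ) h2
  have hσ : P.map (σ : L →+* L) = P := by
    ext i
    have h1 := congrArg (fun Q => Polynomial.coeff Q i) hfix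
    rw [coeff_map, iterateFrobenius_def] at h1
    obtain ⟨c, hc⟩ := hL _ h1
    rw [coeff_map, ← hc]
    exact σ.commutes c
  have h0 : eval ζ P = 0 := by
    simp only [P]
    rw [eval_prod]
    exact Finset.prod_eq_zero (Finset.mem_range.2 hm) (by simp)
  have h1 : eval (σ ζ) P = 0 := by
    have := congrArg σ h0
    rw [map_zero] at this
    rw [← this]
    conv_lhs => rw [← hσ]
    exact eval_map_apply (σ : L →+* L) ζ
  simp only [P] at h1
  rw [eval_prod, Finset.prod_eq_zero_iff] at h1
  obtain ⟨j, -, hj⟩ := h1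
  simp only [eval_sub, eval_X, eval_C, sub_eq_zero] at hj
  refine ⟨j, fun x hx => ?_⟩
  rcases hgen x hx with rfl | ⟨i, rfl⟩
  · rw [map_zero, zero_pow (pow_pos (pow_pos hp.out.pos r) j).ne']
  · rw [map_pow, hj, ← pow_mul ζ, ← pow_mul ζ, mul_comm]

variable (p K L) in
/-- The pointwise stabilizer of a finite field of constants. -/
def constStab (m : ℕ) : Subgroup (L ≃ₐ[K] L) where
  carrier := {σ | ∀ x ∈ constField p L m, σ x = x}
  one_mem' _ _ := rfl
  mul_mem' {σ τ} hσ hτ x hx := by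
    rw [AlgEquiv.mul_apply, hτ x hx, hσ x hx]
  inv_mem' {σ} hσ x hx := by
    conv_lhs => rw [← hσ x hx]
    rw [← AlgEquiv.mul_apply, inv_mul_cancel, AlgEquiv.one_apply]

instance (m : ℕ) : (constStab p K L m).Normal where
  conj_mem σ hσ τ x hx := by
    rw [AlgEquiv.mul_apply, AlgEquiv.mul_apply, hσ _ (apply_mem_constField τ⁻¹ hx),
      ← AlgEquiv.mul_apply, mul_inv_cancel, AlgEquiv.one_apply]

omit [IsSepClosed L] in
theorem constStab_anti {m m' : ℕ} (h : m ∣ m') : constStab p K L m' ≤ constStab p K L m :=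
  fun _ hσ x hx => hσ x (constField_le h hx)

theorem isOpen_constStab [Algebra.IsAlgebraic K L] {m : ℕ} (hm : 0 < m) :
    IsOpen (constStab p K L m : Set (L ≃ₐ[K] L)) := by
  have := finite_constField (p := p) (L := L) hm
  let S : Set L := constField p L m
  have : Finite S := this
  have := IntermediateField.finiteDimensional_adjoin (K := K) (S := S)
    fun x _ => Algebra.IsIntegral.isIntegral x
  refine Subgroup.isOpen_mono (fun σ hσ x hx => ?_)
    (IntermediateField.adjoin K S).fixingSubgroup_isOpen
  exact (IntermediateField.mem_fixingSubgroup_iff _ _).1 hσ x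
    (IntermediateField.subset_adjoin _ _ hx)

omit [IsSepClosed L] in
theorem pow_apply_eq_pow_pow {φ : L ≃ₐ[K] L} {q : ℕ} (hφ : ∀ m, 0 < m → ∀ x ∈ constField p L m,
    φ x = x ^ q) {m : ℕ} (hm : 0 < m) (j : ℕ) {x : L} (hx : x ∈ constField p L m) :
    (φ ^ j) x = x ^ q ^ j := by
  induction j with
  | zero => simp
  | succ j ih =>
    rw [pow_succ', AlgEquiv.mul_apply, ih, map_pow, hφ m hm x hx, ← pow_mul, pow_succ']

/-- Compactness glues Frobenius elements on the finite constant fields into one `φ`. It also shows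
that an open subgroup containing `I` contains the stabilizer of a single constant field, where every
automorphism acts as a power of `φ`. Freeness is a count of constants. -/
theorem exists_isFreeGenerator [Normal K L] [CompactSpace (L ≃ₐ[K] L)]
    (hr : 0 < r) (hK : ∀ c : K, ∀ m, 0 < m → c ^ p ^ m = c → c ^ p ^ r = c)
    (hL : ∀ x : L, x ^ p ^ r = x → ∃ c : K, algebraMap K L c = x)
    {I : Subgroup (L ≃ₐ[K] L)} (hI : ∀ σ, σ ∈ I ↔ ∀ m, 0 < m → σ ∈ constStab p K L m) :
    ∃ φ, IsFreeGenerator φ I := by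
  have halg : Algebra.IsAlgebraic K L := inferInstance
  have : Nonempty {m : ℕ // 0 < m} := ⟨⟨1, one_pos⟩⟩
  have hclosed : ∀ m : {m : ℕ // 0 < m}, IsClosed (constStab p K L m : Set (L ≃ₐ[K] L)) :=
    fun m => Subgroup.isClosed_of_isOpen _ (isOpen_constStab m.2)
  obtain ⟨φ, hφ⟩ : ∃ φ : L ≃ₐ[K] L, ∀ m, 0 < m → ∀ x ∈ constField p L m, φ x = x ^ p ^ r := by
    let V : {m : ℕ // 0 < m} → Set (L ≃ₐ[K] L) := fun m =>
      {σ | ∀ x ∈ constField p L m, σ x = x ^ p ^ r}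
    have hVc : ∀ m, IsClosed (V m) := fun m => by
      obtain ⟨τ, hτ⟩ := exists_algEquiv_apply_eq_pow (L := L) hK m.2
      convert (hclosed m).preimage (continuous_const_mul τ⁻¹) using 1
      ext σ
      refine forall₂_congr fun x hx => ?_
      rw [AlgEquiv.mul_apply, ← hτ x hx]
      exact (AlgEquiv.symm_apply_eq τ).symm
    obtain ⟨φ, hφ⟩ := IsCompact.nonempty_iInter_of_directed_nonempty_isCompact_isClosed V
      (fun m m' => ⟨⟨m * m', Nat.mul_pos m.2 m'.2⟩,
        fun σ hσ x hx => hσ x (constField_le (dvd_mul_right _ _) hx),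
        fun σ hσ x hx => hσ x (constField_le (dvd_mul_left _ _) hx)⟩)
      (fun m => exists_algEquiv_apply_eq_pow (L := L) hK m.2) (fun m => (hVc m).isCompact) hVc
    rw [Set.mem_iInter] at hφ
    exact ⟨φ, fun m hm => hφ ⟨m, hm⟩⟩
  refine ⟨φ, fun U hU hIU g => ?_, fun N hN => ?_⟩
  · obtain ⟨⟨m, hm⟩, hmU⟩ := exists_subset_nhds_of_compactSpace
      (V := fun m : {m : ℕ // 0 < m} => (constStab p K L m : Set (L ≃ₐ[K] L)))
      (fun m m' => ⟨⟨m * m', Nat.mul_pos m.2 m'.2⟩, constStab_anti (dvd_mul_right _ _),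
        constStab_anti (dvd_mul_left _ _)⟩) hclosed (U := U) fun σ hσ => by
          refine hU.mem_nhds (hIU ((hI σ).2 fun m hm => ?_))
          exact Set.mem_iInter.1 hσ ⟨m, hm⟩
    obtain ⟨j, hj⟩ := exists_apply_eq_pow_pow hL hm g
    refine ⟨j, hmU fun x hx => ?_⟩
    rw [AlgEquiv.mul_apply, hj x hx, zpow_natCast, ← pow_apply_eq_pow_pow hφ hm j hx,
      ← AlgEquiv.mul_apply, inv_mul_cancel, AlgEquiv.one_apply]
  · have hrN : 0 < r * N := Nat.mul_pos hr hN
    refine ⟨constStab p K L (r * N), inferInstance, isOpen_constStab hrN,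
      fun σ hσ => (hI σ).1 hσ _ hrN, fun j hj => ?_⟩
    have hN' : φ ^ N ∈ constStab p K L (r * N) := fun x hx => by
      rw [pow_apply_eq_pow_pow hφ hrN N hx, ← pow_mul]
      exact hx
    have hmod : φ ^ (j % N).toNat ∈ constStab p K L (r * N) := by
      have h1 : φ ^ (j % N).toNat = φ ^ j * ((φ ^ N) ^ (j / N))⁻¹ := by
        rw [← zpow_natCast, Int.toNat_of_nonneg (Int.emod_nonneg _ (by omega)), ← zpow_natCast φ N,
          ← zpow_mul, ← zpow_neg, ← zpow_add]
        congr 1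
        rw [Int.emod_def]
        ring
      rw [h1]
      exact mul_mem hj (inv_mem (zpow_mem hN' _))
    set i := (j % N).toNat
    have hiN : i < N := by
      have := Int.emod_lt_of_pos j (show (0 : ℤ) < N by omega)
      omega
    rcases Nat.eq_zero_or_pos i with hi | hi
    · have := Int.emod_nonneg j (show (N : ℤ) ≠ 0 by omega)
      exact Int.dvd_of_emod_eq_zero (by omega)
    -- If `φ ^ i` with `0 < i < N` fixed the larger constant field, that field would lie in one with
    -- fewer elements.
    · have hle : constField p L (r * N) ≤ constField p L (r * i) := fun x hx => by
        have := pow_apply_eq_pow_pow hφ hrN i hx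
        rw [hmod x hx, ← pow_mul] at this
        exact this.symm
      have hri : 0 < r * i := Nat.mul_pos hr hi
      have := finite_constField (p := p) (L := L) hri
      have h2 := Nat.card_mono (Set.toFinite _) (show (constField p L (r * N) : Set L) ⊆ _ from hle)
      have h3 : p ^ (r * N) ≤ p ^ (r * i) := by
        rwa [← card_constField (p := p) (L := L) hrN, ← card_constField (p := p) (L := L) hri]
      have h4 := (Nat.pow_le_pow_iff_right hp.out.one_lt).1 h3
      exact absurd (Nat.le_of_mul_le_mul_left h4 hr) (not_le.2 hiN)

end Constants

/-! ### Inertia of a local field of characteristic `p` -/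

section Inertia

open ValuativeRel

variable (K : Type v) [Field K] [ValuativeRel K] (L : Type w) [Field L] [Algebra K L]

theorem mem_radIdeal_iff [IsLocalRing (intClosure K L)] {x : intClosure K L} :
    x ∈ radIdeal K L ↔ ¬ IsUnit x := by
  rw [radIdeal, IsLocalRing.jacobson_eq_maximalIdeal _ bot_ne_top, IsLocalRing.mem_maximalIdeal,
    mem_nonunits_iff]

theorem mem_intClosure_of_pow_eq {a : L} {k : ℕ} (hk : 1 < k) (ha : a ^ k = a) :
    a ∈ intClosure K L := by
  refine ⟨Polynomial.X ^ k - Polynomial.X, ?_, by simp [ha]⟩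
  exact Polynomial.monic_X_pow_sub (by rw [Polynomial.degree_X]; exact_mod_cast hk)

variable {K L} in
theorem exists_pow_pow_eq_of_isIntegral {A κ : Type*} [Field A] [Finite A] [Field κ] [Algebra A κ]
    {p : ℕ} [Fact p.Prime] [CharP A p] {y : κ} (hy : IsIntegral A y) :
    ∃ m, 0 < m ∧ y ^ p ^ m = y := by
  have := IntermediateField.adjoin.finiteDimensional hy
  have : Finite (IntermediateField.adjoin A {y}) := Module.finite_of_finite A
  have := Fintype.ofFinite (IntermediateField.adjoin A {y})
  have : CharP (IntermediateField.adjoin A {y}) p :=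
    charP_of_injective_algebraMap (algebraMap A _).injective p
  obtain ⟨m, -, hm⟩ := FiniteField.card (IntermediateField.adjoin A {y}) p
  refine ⟨m, m.pos, ?_⟩
  have h := FiniteField.pow_card (⟨y, IntermediateField.mem_adjoin_simple_self A y⟩ :
    IntermediateField.adjoin A {y})
  rw [hm] at h
  exact congrArg Subtype.val h

variable [TopologicalSpace K] [IsNonarchimedeanLocalField K] {p : ℕ} [hp : Fact p.Prime]
  [CharP K p]

/-- The constants of `K` are integral and embed in the finite residue field, so they form a field
with `p ^ r` elements, which already exhausts the roots of `X ^ p ^ r - X` in `L`. -/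
theorem exists_constants_exponent [Algebra.IsAlgebraic K L] [IsSepClosed L] : ∃ r, 0 < r ∧
    (∀ c : K, ∀ m, 0 < m → c ^ p ^ m = c → c ^ p ^ r = c) ∧
    ∀ x : L, x ^ p ^ r = x → ∃ c : K, algebraMap K L c = x := by
  let E : Subfield K :=
    { carrier := {c | ∃ m, 0 < m ∧ c ∈ constField p K m}
      mul_mem' := by
        rintro a b ⟨m, hm, ha⟩ ⟨m', hm', hb⟩
        exact ⟨m * m', Nat.mul_pos hm hm', mul_mem (constField_le (dvd_mul_right _ _) ha)
          (constField_le (dvd_mul_left _ _) hb)⟩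
      one_mem' := ⟨1, one_pos, one_mem _⟩
      add_mem' := by
        rintro a b ⟨m, hm, ha⟩ ⟨m', hm', hb⟩
        exact ⟨m * m', Nat.mul_pos hm hm', add_mem (constField_le (dvd_mul_right _ _) ha)
          (constField_le (dvd_mul_left _ _) hb)⟩
      zero_mem' := ⟨1, one_pos, zero_mem _⟩
      neg_mem' := by
        rintro a ⟨m, hm, ha⟩
        exact ⟨m, hm, neg_mem ha⟩
      inv_mem' := by
        rintro a ⟨m, hm, ha⟩
        exact ⟨m, hm, inv_mem ha⟩ }
  have hint : ∀ c ∈ E, c ∈ (valuation K).integer := by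
    rintro c ⟨m, hm, hc⟩
    rw [Valuation.mem_integer_iff]
    by_contra! h
    have h1 := lt_self_pow₀ h (Nat.one_lt_pow hm.ne' hp.out.one_lt)
    rw [← map_pow, mem_constField.1 hc] at h1
    exact lt_irrefl _ h1
  let g : E →+* 𝓀[K] := (IsLocalRing.residue 𝒪[K]).comp
    ((SubringClass.subtype E).codRestrict 𝒪[K] fun c => hint c c.2)
  have : Finite E := Finite.of_injective g g.injective
  have := Fintype.ofFinite E
  have : CharP E p := (E.subtype.charP_iff E.subtype.injective p).2 inferInstance
  obtain ⟨r, -, hr⟩ := FiniteField.card E p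
  refine ⟨r, r.pos, fun c m hm hc => ?_, fun x hx => ?_⟩
  · have h := FiniteField.pow_card (⟨c, m, hm, hc⟩ : E)
    rw [hr] at h
    exact congrArg Subtype.val h
  · obtain ⟨c, hc⟩ := exists_map_eq_of_pow_card_eq ((algebraMap K L).comp E.subtype) (y := x)
      (by rw [Nat.card_eq_fintype_card, hr]; exact hx)
    exact ⟨c, hc⟩

/-- A nonzero difference of two constants is a unit, so an automorphism trivial on residues fixes
constants. Conversely the residue of `x` is algebraic over a finite field, hence is the residue of a
constant `b`, and `σ x - x = σ (x - b) - (x - b)`. -/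
theorem mem_ramGroup_one_iff [Algebra.IsAlgebraic K L] [IsSepClosed L] [CharP L p]
    (σ : L ≃ₐ[K] L) :
    σ ∈ ramGroup K L 1 ↔ ∀ m, 0 < m → σ ∈ constStab p K L m := by
  have := isLocalRing_intClosure K L
  constructor
  · intro hσ m hm a ha
    have h1 : 1 < p ^ m := Nat.one_lt_pow hm.ne' hp.out.one_lt
    have hb : σ a - a ∈ constField p L m := sub_mem (apply_mem_constField σ ha) ha
    by_contra hne
    have hne' : σ a - a ≠ 0 := sub_ne_zero.2 hne
    have h := hσ ⟨a, mem_intClosure_of_pow_eq K L h1 ha⟩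
    rw [pow_one, mem_radIdeal_iff] at h
    refine h (.of_mul_eq_one ⟨(σ a - a)⁻¹, mem_intClosure_of_pow_eq K L h1 (inv_mem hb)⟩ ?_)
    exact Subtype.ext (mul_inv_cancel₀ hne')
  · intro hσ x
    rw [pow_one]
    let κ := IsLocalRing.ResidueField (intClosure K L)
    have : CharP 𝓀[K] p := by
      refine (CharP.charP_iff_prime_eq_zero hp.out).2 ?_
      have h0 : ((p : 𝒪[K]) : K) = 0 := by
        rw [show ((p : 𝒪[K]) : K) = (p : K) from map_natCast (SubringClass.subtype 𝒪[K]) p]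
        exact CharP.cast_eq_zero K p
      rw [← map_natCast (IsLocalRing.residue 𝒪[K]), show (p : 𝒪[K]) = 0 from Subtype.ext h0]
      exact map_zero _
    have : FaithfulSMul (intRing K) (intClosure K L) := by
      refine (faithfulSMul_iff_algebraMap_injective _ _).2 fun a b hab => Subtype.ext ?_
      exact (algebraMap K L).injective (congrArg Subtype.val hab)
    have : IsLocalHom (algebraMap 𝒪[K] (intClosure K L)) :=
      Algebra.IsIntegral.isLocalHom (R := intRing K) (S := intClosure K L)
    let : Algebra 𝓀[K] κ :=
      (IsLocalRing.ResidueField.map (algebraMap 𝒪[K] (intClosure K L))).toAlgebra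
    have hy : IsIntegral 𝓀[K] (IsLocalRing.residue (intClosure K L) x) := by
      obtain ⟨P, hP, hx⟩ := Algebra.IsIntegral.isIntegral (R := intRing K) x
      refine ⟨P.map (IsLocalRing.residue 𝒪[K]), hP.map _, ?_⟩
      rw [Polynomial.eval₂_map]
      have := congrArg (IsLocalRing.residue (intClosure K L)) hx
      rw [Polynomial.hom_eval₂, map_zero] at this
      exact this
    obtain ⟨m, hm, hym⟩ := exists_pow_pow_eq_of_isIntegral (p := p) hy
    have h1 : 1 < p ^ m := Nat.one_lt_pow hm.ne' hp.out.one_lt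
    have := finite_constField (p := p) (L := L) hm
    let g : constField p L m →+* κ := (IsLocalRing.residue (intClosure K L)).comp
      ((SubringClass.subtype (constField p L m)).codRestrict (intClosure K L)
        fun c => mem_intClosure_of_pow_eq K L h1 c.2)
    obtain ⟨a, ha⟩ := exists_map_eq_of_pow_card_eq g (y := IsLocalRing.residue _ x)
      (by rw [card_constField hm, hym])
    let b : intClosure K L := ⟨a, mem_intClosure_of_pow_eq K L h1 a.2⟩
    have hxb : x - b ∈ radIdeal K L := by
      rw [radIdeal, IsLocalRing.jacobson_eq_maximalIdeal _ bot_ne_top,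
        ← IsLocalRing.residue_eq_zero_iff, map_sub, ← ha, sub_eq_zero]
      rfl
    have h2 := galInt_mem σ 1 _ ((pow_one (radIdeal K L)).symm ▸ hxb)
    have h3 : galInt σ b = b := Subtype.ext (hσ m hm a a.2)
    rw [pow_one, map_sub, h3] at h2
    simpa using sub_mem h2 hxb

theorem exists_isFreeGenerator_inertia (p : ℕ) [Fact p.Prime] [CharP K p] :
    ∃ φ, IsFreeGenerator φ (inertia K) := by
  have : CharP (SeparableClosure K) p :=
    charP_of_injective_algebraMap (algebraMap K _).injective p
  obtain ⟨r, hr, hK, hL⟩ := exists_constants_exponent K (SeparableClosure K) (p := p)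
  exact exists_isFreeGenerator hr hK hL (mem_ramGroup_one_iff K (SeparableClosure K))

end Inertia

/-! ### Upper ramification groups lie in the inertia group -/

section UpperRamification

variable (K : Type v) [Field K] [ValuativeRel K]

theorem ramGroup_anti (L : Type w) [Field L] [Algebra K L] {i j : ℕ} (h : i ≤ j) :
    ramGroup K L j ≤ ramGroup K L i :=
  fun _ hσ x => Ideal.pow_le_pow_right h (hσ x)

theorem lowerRam_le_ramGroup_one (L : Type w) [Field L] [Algebra K L] {t : ℝ} (ht : -1 < t) :
    lowerRam K L t ≤ ramGroup K L 1 := by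
  refine ramGroup_anti K L ?_
  have : (-1 : ℤ) < ⌈t⌉ := Int.lt_ceil.2 (by exact_mod_cast ht)
  omega

/-- On `(-1, 0]` the ceiling is `0`, so the integrand is `1`. This excludes the parameter `t = -1`
when the upper index exceeds `-1`, without monotonicity of the Herbrand function. -/
theorem herbrand_neg_one (L : Type w) [Field L] [Algebra K L] [FiniteDimensional K L] :
    herbrand K L (-1) = -1 := by
  rw [herbrand, intervalIntegral.integral_symm,
    intervalIntegral.integral_congr_ae (g := fun _ => (1 : ℝ))]
  · simp
  · refine Filter.Eventually.of_forall fun s hs => ?_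
    rw [Set.uIoc_of_le (by norm_num)] at hs
    have h1 : ⌈s⌉ = ⌈(0 : ℝ)⌉ := by
      rw [Int.ceil_zero, Int.ceil_eq_zero_iff]
      exact hs
    rw [lowerRam, lowerRam, h1]
    exact div_self (Nat.cast_ne_zero.2 Nat.card_pos.ne')

theorem upperRamFinite_subset (L : Type w) [Field L] [Algebra K L] [FiniteDimensional K L] {x : ℝ}
    (hx : -1 < x) : upperRamFinite K L x ⊆ ramGroup K L 1 := by
  rintro σ ⟨t, ht, rfl, hσ⟩
  refine lowerRam_le_ramGroup_one K L (lt_of_le_of_ne ht ?_) hσ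
  rintro rfl
  exact hx.ne (herbrand_neg_one K L).symm

variable [TopologicalSpace K] [IsNonarchimedeanLocalField K]

/-- If `z` were a unit, its inverse would be integral and lie in `E`, making `y` a unit. -/
theorem algebraMap_mem_radIdeal (L : Type w) [Field L] [Algebra K L] [Algebra.IsAlgebraic K L]
    (E : IntermediateField K L) {y : intClosure K E} (hy : y ∈ radIdeal K E)
    {z : intClosure K L} (hz : z.1 = y.1.1) : z ∈ radIdeal K L := by
  have := isLocalRing_intClosure K L
  have := isLocalRing_intClosure K E
  rw [mem_radIdeal_iff] at hy ⊢
  intro hu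
  obtain ⟨b, hb⟩ := hu.exists_right_inv
  have hb' : y.1.1 * b.1 = 1 := by
    rw [← hz]
    exact congrArg Subtype.val hb
  have hbE : ((y.1⁻¹ : E) : L) = b.1 := by
    rw [IntermediateField.coe_inv]
    exact (eq_inv_of_mul_eq_one_right hb').symm
  refine hy (.of_mul_eq_one ⟨y.1⁻¹, ?_⟩ (Subtype.ext (mul_inv_cancel₀ fun h0 => ?_)))
  · refine (isIntegral_algHom_iff (E.val.restrictScalars (intRing K)) Subtype.val_injective).1 ?_
    change IsIntegral (intRing K) ((y.1⁻¹ : E) : L)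
    rw [hbE]
    exact b.2
  · rw [h0] at hb'
    simp at hb'

/-- Each integral element lies in a finite Galois subextension, where the finite-level statement
applies. -/
theorem upperRam_subset_inertia {x : ℝ} (hx : -1 < x) :
    upperRam K x ⊆ (inertia K : Set (AbsGal K)) := by
  intro σ hσ z
  rw [pow_one]
  let E := FiniteGaloisIntermediateField.adjoin K {z.1}
  have hzE : z.1 ∈ E.toIntermediateField :=
    FiniteGaloisIntermediateField.subset_adjoin K _ (Set.mem_singleton _)
  have hint : IsIntegral (intRing K) (⟨z.1, hzE⟩ : E.toIntermediateField) :=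
    (isIntegral_algHom_iff (E.toIntermediateField.val.restrictScalars (intRing K))
      Subtype.val_injective).1 z.2
  have h := upperRamFinite_subset K E.toIntermediateField hx (hσ E.toIntermediateField)
    ⟨⟨z.1, hzE⟩, hint⟩
  rw [pow_one] at h
  refine algebraMap_mem_radIdeal K _ E.toIntermediateField h ?_
  change σ z.1 - z.1 = ((AlgEquiv.restrictNormalHom E.toIntermediateField σ ⟨z.1, hzE⟩ :
    E.toIntermediateField) : SeparableClosure K) - z.1
  congr 1
  exact (AlgEquiv.restrictNormal_commutes σ E.toIntermediateField ⟨z.1, hzE⟩).symm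

end UpperRamification

/-! ### Ranks of invariants -/

section Ranks

open Matrix

variable {n : ℕ}

/-- An idempotent splits `R^n` into two projective summands, which are free because `R` is local. -/
theorem finrank_range_add_finrank_range {R : Type*} [CommRing R] [IsLocalRing R]
    {E : Matrix (Fin n) (Fin n) R} (hE : IsIdempotentElem E) :
    Module.Free R (LinearMap.range E.mulVecLin) ∧
      Module.finrank R (LinearMap.range E.mulVecLin) +
        Module.finrank R (LinearMap.range (1 - E).mulVecLin) = n := by
  have key : ∀ {E : Matrix (Fin n) (Fin n) R}, IsIdempotentElem E →
      Module.Free R (LinearMap.range E.mulVecLin) := by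
    intro E hE
    have h : (E.mulVecLin.rangeRestrict).comp (LinearMap.range E.mulVecLin).subtype =
        LinearMap.id := by
      ext ⟨_, v, rfl⟩ i
      simp [hE.eq]
    have := Module.Projective.of_split _ _ h
    exact Module.free_of_flat_of_isLocalRing
  have h1 := key hE
  have h2 := key hE.one_sub
  have hc : IsCompl (LinearMap.range E.mulVecLin) (LinearMap.range (1 - E).mulVecLin) := by
    have hidem : IsIdempotentElem E.mulVecLin := by
      rw [IsIdempotentElem, Module.End.mul_eq_comp, ← Matrix.mulVecLin_mul, hE.eq]
    convert LinearMap.IsIdempotentElem.isCompl hidem using 1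
    rw [LinearMap.IsIdempotentElem.ker_eq_range hidem]
    congr 1
    ext
    simp
  refine ⟨h1, ?_⟩
  rw [← Module.finrank_prod, (Submodule.prodEquivOfIsCompl _ _ hc).finrank_eq,
    Module.finrank_fin_fun]

theorem finrank_range_map_le {R S : Type*} [CommRing R] [IsLocalRing R] [Field S] {f : R →+* S}
    (hf : Function.Surjective f) {E : Matrix (Fin n) (Fin n) R} (hE : IsIdempotentElem E) :
    Module.finrank S (LinearMap.range (E.map f).mulVecLin) ≤
      Module.finrank R (LinearMap.range E.mulVecLin) := by
  have := (finrank_range_add_finrank_range hE).1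
  let b := Module.finBasis R (LinearMap.range E.mulVecLin)
  have hle : LinearMap.range (E.map f).mulVecLin ≤
      Submodule.span S (Set.range fun i => f ∘ (b i).1) := by
    rintro _ ⟨v, rfl⟩
    obtain ⟨u, rfl⟩ := hf.comp_left v
    have h1 := b.sum_repr ⟨E *ᵥ u, u, rfl⟩
    have h2 : (E.map f).mulVecLin (f ∘ u) = f ∘ (E *ᵥ u) := by
      rw [mulVecLin_apply]
      ext i
      exact (RingHom.map_mulVec f E u i).symm
    have h3 : f ∘ (E *ᵥ u) = ∑ i, f (b.repr ⟨E *ᵥ u, u, rfl⟩ i) • (f ∘ (b i).1) := by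
      have h4 := congrArg Subtype.val h1
      rw [Submodule.coe_sum] at h4
      conv_lhs => rw [← show _ = E *ᵥ u from h4]
      ext j
      simp
    rw [h2, h3]
    exact Submodule.sum_mem _ fun i _ =>
      Submodule.smul_mem _ _ (Submodule.subset_span ⟨i, rfl⟩)
  refine (Submodule.finrank_mono hle).trans ((finrank_range_le_card _).trans ?_)
  rw [Fintype.card_fin]

/-- Reduction cannot raise the rank of `E` or of `1 - E`, and both before and after reduction the
two ranks add up to `n`. -/
theorem finrank_range_map_eq {R S : Type*} [CommRing R] [IsLocalRing R] [Field S] {f : R →+* S}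
    (hf : Function.Surjective f) {E : Matrix (Fin n) (Fin n) R} (hE : IsIdempotentElem E) :
    Module.finrank S (LinearMap.range (E.map f).mulVecLin) =
      Module.finrank R (LinearMap.range E.mulVecLin) := by
  have hE' : IsIdempotentElem (E.map f) := by
    rw [IsIdempotentElem, ← Matrix.map_mul, hE.eq]
  have h1 := finrank_range_map_le hf hE
  have h2 := finrank_range_map_le hf hE.one_sub
  have h3 := (finrank_range_add_finrank_range hE).2
  have h4 := (finrank_range_add_finrank_range hE').2
  have h5 : (1 - E).map f = 1 - E.map f := by
    rw [Matrix.map_sub _ (map_sub f), Matrix.map_one _ (map_zero f) (map_one f)]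
  rw [h5] at h2
  omega

/-- The projector onto the vectors fixed by a finite group of invertible order. -/
theorem exists_projector {R : Type u} [CommRing R] (H : Subgroup (GL (Fin n) R)) [Finite H]
    (hH : IsUnit (Nat.card H : R)) : ∃ E : Matrix (Fin n) (Fin n) R,
      (∀ h ∈ H, h.1 * E = E) ∧ ∀ (A : Type u) [CommRing A] (f : R →+* A) (v : Fin n → A),
        (∀ h ∈ H, h.1.map f *ᵥ v = v) → E.map f *ᵥ v = v := by
  have := Fintype.ofFinite H
  obtain ⟨c, hc⟩ := hH.exists_left_inv
  refine ⟨c • ∑ h : H, h.1.1, fun h hh => ?_, fun A _ f v hv => ?_⟩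
  · rw [Matrix.mul_smul, Finset.mul_sum]
    congr 1
    exact Fintype.sum_equiv (Equiv.mulLeft ⟨h, hh⟩) _ _ fun x => rfl
  · have h1 : (c • ∑ h : H, h.1.1).map f = f c • ∑ h : H, h.1.1.map f := by
      ext i j
      simp [Matrix.sum_apply]
    rw [h1, smul_mulVec, sum_mulVec, Finset.sum_congr rfl fun h _ => hv h.1 h.2, Finset.sum_const,
      Finset.card_univ, ← Nat.card_eq_fintype_card, ← Nat.cast_smul_eq_nsmul A, smul_smul,
      ← map_natCast f, ← map_mul, hc, map_one, one_smul]

end Ranks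

/-! ### Conductors of minimal lifts. -/

section Conductor

variable {ℓ : ℕ} [Fact ℓ.Prime] {F : Type u} [Field F] [CharP F ℓ]
  {K : Type v} [Field K] [ValuativeRel K] {n : ℕ} {ρbar : AbsGal K →* GL (Fin n) F}
  {I : Subgroup (AbsGal K)} {R : CNL ℓ F} {ρ : AbsGal K →* GL (Fin n) R}

omit [ValuativeRel K] in
-- One averaging projector `E` over `R` computes the fixed vectors both of `ρ` and, after reduction,
-- of `ρbar`. It is formed from the subgroup generated by `S`, since `S` is merely a set.
theorem free_fixedVectors (hI : (Nat.card (I.map ρbar)).Coprime ℓ)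
    (hρ : ρ ∈ minimalLifts ℓ ρbar I R)
    {S : Set (AbsGal K)} (hS : S ⊆ I) :
    Module.Free R (fixedVectors ρ S) ∧
      Module.finrank R (fixedVectors ρ S) = Module.finrank F (fixedVectors ρbar S) := by
  have hcard : Nat.card (I.map ρ) = Nat.card (I.map ρbar) := by
    rw [← card_range_comp_subtype hρ, MonoidHom.range_comp, Subgroup.range_subtype]
  have hfin : Finite (I.map ρ) := by
    refine Nat.finite_of_card_ne_zero fun h0 => ?_
    rw [← hcard, h0, Nat.coprime_zero_left] at hI
    exact (Fact.out : ℓ.Prime).ne_one hI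
  have hle : (Subgroup.closure S).map ρ ≤ I.map ρ :=
    Subgroup.map_mono ((Subgroup.closure_le I).2 hS)
  have : Finite ((Subgroup.closure S).map ρ) := Finite.Set.subset _ hle
  obtain ⟨E, hE, hfix⟩ := exists_projector ((Subgroup.closure S).map ρ)
    (R.isUnit_natCast (Nat.Coprime.coprime_dvd_left (hcard ▸ Subgroup.card_dvd_of_le hle) hI))
  have hmem : ∀ (A : Type u) [CommRing A] (f : R →+* A) (v : Fin n → A),
      v ∈ fixedVectors (push f ρ) S → E.map f *ᵥ v = v := by
    intro A _ f v hv
    refine hfix A f v ?_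
    rintro _ ⟨g, hg, rfl⟩
    have h1 : g ∈ (Subgroup.closure S) := hg
    clear hg
    induction h1 using Subgroup.closure_induction with
    | mem g hg => exact hv g hg
    | one => simp
    | mul a b _ _ ha hb =>
      rw [map_mul, Units.val_mul, Matrix.map_mul, ← Matrix.mulVec_mulVec, hb, ha]
    | inv a _ ha =>
      conv_lhs => rw [← ha]
      rw [Matrix.mulVec_mulVec, ← Matrix.map_mul, ← Units.val_mul, map_inv, inv_mul_cancel]
      simp
  have hrange : ∀ (A : Type u) [CommRing A] (f : R →+* A),
      fixedVectors (push f ρ) S = LinearMap.range (E.map f).mulVecLin := by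
    intro A _ f
    refine le_antisymm (fun v hv => ⟨v, hmem A f v hv⟩) ?_
    rintro _ ⟨v, rfl⟩ σ hσ
    change (ρ σ).1.map f *ᵥ (E.map f *ᵥ v) = E.map f *ᵥ v
    rw [Matrix.mulVec_mulVec, ← Matrix.map_mul, hE _ ⟨σ, Subgroup.subset_closure hσ, rfl⟩]
  have hid : push (RingHom.id R) ρ = ρ := by
    ext
    rfl
  have hidE : E.map (RingHom.id R) = E := rfl
  have hrangeR := hrange R (RingHom.id R)
  have hmemR := hmem R (RingHom.id R)
  rw [hid, hidE] at hrangeR hmemR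
  have hidem : IsIdempotentElem E := by
    refine Matrix.mulVec_injective ?_
    ext1 v
    rw [← Matrix.mulVec_mulVec]
    exact hmemR _ (hrangeR ▸ ⟨v, rfl⟩)
  rw [← (mem_minimalLifts_iff.1 hρ).1.reduction, hrange F R.residue, hrangeR,
    finrank_range_map_eq R.residue_surjective hidem]
  exact ⟨(finrank_range_add_finrank_range hidem).1, rfl⟩

variable [TopologicalSpace K] [IsNonarchimedeanLocalField K]

theorem conductor_eq (hI : (Nat.card ((inertia K).map ρbar)).Coprime ℓ)
    (hρ : ρ ∈ minimalLifts ℓ ρbar (inertia K) R) : conductor ρ = conductor ρbar := by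
  refine MeasureTheory.setLIntegral_congr_fun measurableSet_Ioi fun x hx => ?_
  rw [(free_fixedVectors hI hρ (upperRam_subset_inertia K hx)).2]

end Conductor

/-! ### Admissibility of the minimal lifts -/

section Admissible

variable {ℓ : ℕ} [Fact ℓ.Prime] {F : Type u} [Field F] [Finite F] [CharP F ℓ]
  {G : Type v} [Group G] [TopologicalSpace G] [IsTopologicalGroup G] {n : ℕ}
  {ρbar : G →* GL (Fin n) F} {I : Subgroup G} [I.Normal] {φ : G}

theorem admissible_minimalLifts (hcont : IsOpen (ρbar.ker : Set G)) (hφ : IsFreeGenerator φ I)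
    (hI : (Nat.card (I.map ρbar)).Coprime ℓ) :
    Admissible ρbar (minimalLifts ℓ ρbar I) (tangentSpace ρbar (minimalLifts ℓ ρbar I)) where
  isLift _ _ h := (mem_minimalLifts_iff.1 h).1
  P1 := mem_minimalLifts_iff.2 ⟨isLift_self hcont, fun _ _ h => h⟩
  P2 R ρ A h hA := by
    rw [mem_minimalLifts_iff] at h ⊢
    refine ⟨h.1.conj (mem_congSubgroup.2 hA), fun g hg h1 => ?_⟩
    rw [MonoidHom.comp_apply, h.2 g hg h1, map_one]
  P3 R S f ρ h := by
    rw [mem_minimalLifts_iff] at h ⊢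
    refine ⟨h.1.push f, fun g hg h1 => ?_⟩
    rw [push_apply, h.2 g hg h1, map_one]
  P4 R₁ R₂ I₁ I₂ χ ρ₁ ρ₂ hI₁ _ hχ h₁ h₂ he := by
    obtain ⟨R₃, p₁, p₂, hp₁, hp₂, hinj, hrange⟩ := exists_fibre_cnl hI₁ χ hχ
    refine ⟨R₃, p₁, p₂, hinj, hrange, exists_minimalLift_fibre hp₁ hp₂ hinj h₁ h₂ ?_⟩
    intro g i j
    have hmem : ((ρ₁ g).1 i j, (ρ₂ g).1 i j) ∈
        Set.range (fun c => (p₁.toRingHom c, p₂.toRingHom c)) := by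
      rw [hrange]
      exact congrArg (fun r => (r g).1 i j) he
    obtain ⟨c, hc⟩ := hmem
    exact ⟨c, congrArg Prod.fst hc, congrArg Prod.snd hc⟩
  P5 R ρ Q q h _ _ hbot hq := by
    rw [mem_minimalLifts_iff]
    refine ⟨h, fun g hg h1 => Matrix.GeneralLinearGroup.ext fun i j => sub_eq_zero.1 ?_⟩
    rw [← Ideal.mem_bot, ← hbot, Ideal.mem_iInf]
    intro k
    have hk := (mem_minimalLifts_iff.1 (hq k)).2 g hg h1
    rw [push_apply, ← map_one (Matrix.GeneralLinearGroup.map (q k).toRingHom)] at hk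
    rw [RingHom.mem_ker, map_sub, sub_eq_zero]
    exact congrArg (fun A : GL (Fin n) (Q k) => A.1 i j) hk
  P6 R Q q ρ hq hJ h := exists_minimalLift_map_eq hcont hφ hI q hq hJ h
  P7 R J ρ₁ ρ₂ hJ h₁ h₂ he := by
    rw [tangentSpace_minimalLifts hcont]
    exact ⟨fun h => diffClassMem_of_mem hJ h₁ h he, mem_of_diffClassMem h₁ h₂⟩

omit [Finite F] in
theorem tangentSpace_minimalLifts_eq_H1unr (hcont : IsOpen (ρbar.ker : Set G))
    (hI : (Nat.card (I.map ρbar)).Coprime ℓ) :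
    tangentSpace ρbar (minimalLifts ℓ ρbar I) = H1unr (ad0 ρbar) I := by
  have hℓ : ℓ ≠ 1 := (Fact.out : ℓ.Prime).ne_one
  have : Finite (I.map ρbar) := Nat.finite_of_card_ne_zero fun h0 => by
    rw [h0, Nat.coprime_zero_left] at hI
    exact hℓ hI
  rw [tangentSpace_minimalLifts hcont, H1unr_eq]
  refine map_mk_Z1van_eq ρbar I ?_ hcont fun g hg => ad0_eq_one hg
  rw [Ne, CharP.cast_eq_zero_iff F ℓ]
  exact fun hd => hℓ (hI.symm.eq_one_of_dvd hd)

end Admissible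

end LocalDef

end

/-! ### Assembly for the absolute Galois group of a local field. -/

theorem mainTheorem8
    {ℓ p : ℕ} [Fact ℓ.Prime] [Fact p.Prime] (hℓp : ℓ ≠ p)
    {F : Type u} [Field F] [Finite F] [CharP F ℓ]
    {K : Type v} [Field K] [ValuativeRel K] [TopologicalSpace K] [IsNonarchimedeanLocalField K]
    [CharP K p] {n : ℕ}
    (ρbar : LocalDef.AbsGal K →* GL (Fin n) F)
    (hcont : IsOpen (ρbar.ker : Set (LocalDef.AbsGal K)))
    (hI : Nat.Coprime (Nat.card ((LocalDef.inertia K).map ρbar)) ℓ) :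
    -- the classes coming from `C(F[ε])` form a subspace `L`, and `(C, L)` is admissible
    (LocalDef.tangentSpace ρbar (LocalDef.minimalLifts ℓ ρbar (LocalDef.inertia K)) :
        Set (LocalDef.H1 (LocalDef.ad0 ρbar))) =
      LocalDef.tangentClasses ρbar (LocalDef.minimalLifts ℓ ρbar (LocalDef.inertia K)) ∧
    LocalDef.Admissible ρbar (LocalDef.minimalLifts ℓ ρbar (LocalDef.inertia K))
      (LocalDef.tangentSpace ρbar (LocalDef.minimalLifts ℓ ρbar (LocalDef.inertia K))) ∧
    -- `L = H¹_unr` and `dim L = h⁰(G, ad⁰)`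
    LocalDef.tangentSpace ρbar (LocalDef.minimalLifts ℓ ρbar (LocalDef.inertia K)) =
      LocalDef.H1unr (LocalDef.ad0 ρbar) (LocalDef.inertia K) ∧
    Module.Finite F
      (LocalDef.tangentSpace ρbar (LocalDef.minimalLifts ℓ ρbar (LocalDef.inertia K))) ∧
    Module.finrank F
        (LocalDef.tangentSpace ρbar (LocalDef.minimalLifts ℓ ρbar (LocalDef.inertia K))) =
      Module.finrank F (LocalDef.ad0 ρbar).invariants ∧
    -- conductors: the ranks in the definition are ranks of free modules, and conductors agree
    ∀ (R : LocalDef.CNL ℓ F) (ρ : LocalDef.AbsGal K →* GL (Fin n) R),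
      ρ ∈ LocalDef.minimalLifts ℓ ρbar (LocalDef.inertia K) R →
      (∀ x : ℝ, -1 < x → Module.Free R (LocalDef.fixedVectors ρ (LocalDef.upperRam K x))) ∧
      LocalDef.conductor ρ = LocalDef.conductor ρbar := by
  obtain ⟨φ, hφ⟩ := LocalDef.exists_isFreeGenerator_inertia K p
  have hL := LocalDef.tangentSpace_minimalLifts_eq_H1unr hcont hI
  have hdim := hφ.finrank_H1unr (r := LocalDef.ad0 ρbar) hcont fun _ hg => LocalDef.ad0_eq_one hg
  refine ⟨?_, LocalDef.admissible_minimalLifts hcont hφ hI, hL, ?_, ?_, fun R ρ hρ =>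
    ⟨fun x hx => (LocalDef.free_fixedVectors hI hρ (LocalDef.upperRam_subset_inertia K hx)).1,
      LocalDef.conductor_eq hI hρ⟩⟩
  · rw [LocalDef.tangentSpace_minimalLifts hcont, LocalDef.tangentClasses_minimalLifts hcont]
  · rw [hL]
    exact hdim.1
  · rw [hL]
    exact hdim.2
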